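/- Let $T,L>0$ and consider, in $Q_T=\{0\le t<T,\ 0\le x\le L,\ 0\le y<\infty\}$, the Prandtl problem $$\partial_t u+u\,\partial_x u+v\,\partial_y u=\partial_y^2u-\partial_xP,\qquad \partial_x u+\partial_y v=0,$$ $$u|_{y=0}=v|_{y=0}=0,\qquad \lim_{y\to\infty}u=U_e(t,x),\qquad u|_{t=0}=u_0(x,y),\qquad u|_{x=0}=u_1(t,y),$$ where $\partial_tU_e+U_e\partial_xU_e=-\partial_xP$. Assume that $U_e\in C^1([0,T]\times[0,L])$, that $U_e>0$ and $\partial_xP>0$ on $[0,T]\times[0,L]$, and that the data are positive off the wall and strictly monotone: $u_0(x,y)>0$, $u_1(t,y)>0$ for $y>0$, and $\partial_yu_0(x,y)>0$, $\partial_yu_1(t,y)>0$ for $y\ge0$ ($0\le t<T$, $0\le x\le L$). A classical solution is a pair $(u,v)$ satisfying the problem pointwise in $Q_T$ such that $u,\partial_tu,\partial_xu,\partial_yu,\partial_y^2u$ and $v$ are continuous on $Q_T$; $\partial_t\partial_yu,\ \partial_x\partial_yu,\ \partial_y^3u$ exist and are continuous in the interior of $Q_T$; and, on $[0,T']\times[0,L]\times[0,\infty)$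 for every $T'<T$, the derivatives $\partial_xu,\partial_yu$ are bounded and $u\to U_e$ as $y\to\infty$ uniformly in $(t,x)$. Let $(u,v)$ be a classical solution. A first zero of $\partial_yu$ is a point $(t_0,x_0,y_0)\in Q_T$ with $t_0>0$, $\partial_yu(t_0,x_0,y_0)=0$, and $\partial_yu(t,x,y)\neq0$ for all $0\le t<t_0$, $x\in[0,L]$, $y\ge0$. (1) Every first zero $(t_0,x_0,y_0)$ of $\partial_yu$ lies on the boundary, i.e. $y_0=0$; and if $\partial_yu$ vanishes somewhere in $Q_T$ at a time $t>0$, then a first zero exists. (2) There is a constant $C_*>0$, depending only on $L$, $T$, $U_e$ and $\partial_xP$ (and not on $u_0,u_1,u,v$), such that if $$\int_0^\infty\!\!\int_0^L\frac{(L-x)^{3/2}\,\partial_yu_0}{\sqrt{(\partial_yu_0)^2+u_0^2}}\,dx\,dy\ \ge\ C_*,$$ then there is a back flow point $(t^*,x^*)\in(0,T)\times[0,L]$, that is, $$\partial_yu(t^*,x^*,0)=0,\qquad \partial_yu(t,x,y)>0\quad\text{for all }0\le t<t^*,\ x\in[0,L],\ y\ge0;$$ moreover $\partial_y^2u(t^*,x^*,0)=\partial_xP(t^*,x^*)\neq0$.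 -/

import Mathlib

open Set Filter Topology MeasureTheory

noncomputable section

namespace Prandtl

/-- The domain `{0 ≤ t < T, 0 ≤ x ≤ L, 0 ≤ y < ∞}` of the boundary layer. -/
def domain (T L : ℝ) : Set (ℝ × ℝ × ℝ) := Ico 0 T ×ˢ Icc 0 L ×ˢ Ici 0

/-- The open domain `{0 < t < T, 0 < x < L, 0 < y < ∞}`. -/
def openDomain (T L : ℝ) : Set (ℝ × ℝ × ℝ) := Ioo 0 T ×ˢ Ioo 0 L ×ˢ Ioi 0

/-- `∂_t f` on the domain (one-sided at `t = 0`). -/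
def partialT (T : ℝ) (f : ℝ → ℝ → ℝ → ℝ) (t x y : ℝ) : ℝ :=
  derivWithin (fun s => f s x y) (Ico 0 T) t

/-- `∂_x f` on the domain (one-sided at `x = 0` and `x = L`). -/
def partialX (L : ℝ) (f : ℝ → ℝ → ℝ → ℝ) (t x y : ℝ) : ℝ :=
  derivWithin (fun s => f t s y) (Icc 0 L) x

/-- `∂_y f` on the domain (one-sided at the wall `y = 0`). -/
def partialY (f : ℝ → ℝ → ℝ → ℝ) (t x y : ℝ) : ℝ :=
  derivWithin (fun s => f t x s) (Ici 0) y

/-- The partial derivatives `∂_t f`, `∂_x f`, `∂_y f`, `∂_y² f` exist at every point of `D`, and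
they and `f` are continuous on `D`. It is used for `D = domain T L` and `D = openDomain T L`. -/
structure IsC112On (T L : ℝ) (f : ℝ → ℝ → ℝ → ℝ) (D : Set (ℝ × ℝ × ℝ)) : Prop where
  diff_t : ∀ q ∈ D, DifferentiableWithinAt ℝ (fun s => f s q.2.1 q.2.2) (Ico 0 T) q.1
  diff_x : ∀ q ∈ D, DifferentiableWithinAt ℝ (fun s => f q.1 s q.2.2) (Icc 0 L) q.2.1
  diff_y : ∀ q ∈ D, DifferentiableWithinAt ℝ (fun s => f q.1 q.2.1 s) (Ici 0) q.2.2
  diff_yy : ∀ q ∈ D, DifferentiableWithinAt ℝ (fun s => partialY f q.1 q.2.1 s) (Ici 0) q.2.2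
  cont : ContinuousOn (fun q : ℝ × ℝ × ℝ => f q.1 q.2.1 q.2.2) D
  cont_t : ContinuousOn (fun q : ℝ × ℝ × ℝ => partialT T f q.1 q.2.1 q.2.2) D
  cont_x : ContinuousOn (fun q : ℝ × ℝ × ℝ => partialX L f q.1 q.2.1 q.2.2) D
  cont_y : ContinuousOn (fun q : ℝ × ℝ × ℝ => partialY f q.1 q.2.1 q.2.2) D
  cont_yy : ContinuousOn (fun q : ℝ × ℝ × ℝ => partialY (partialY f) q.1 q.2.1 q.2.2) D

/-- The pressure gradient `∂_x P (t, x)` for `x ∈ [0, L]`. -/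
def pressureGradient (L : ℝ) (P : ℝ → ℝ → ℝ) (t x : ℝ) : ℝ :=
  derivWithin (fun s => P t s) (Icc 0 L) x

/-- Bernoulli's law `∂_t U_e + U_e ∂_x U_e = -∂_x P` on `[0, T] × [0, L]`. -/
def Bernoulli (T L : ℝ) (Ue P : ℝ → ℝ → ℝ) : Prop :=
  ∀ t ∈ Icc 0 T, ∀ x ∈ Icc 0 L,
    derivWithin (fun s => Ue s x) (Icc 0 T) t +
      Ue t x * derivWithin (fun s => Ue t s) (Icc 0 L) x = -pressureGradient L P t x

/-- The pressure gradient is adverse on `[0, T] × [0, L]`. -/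
def AdversePressure (T L : ℝ) (P : ℝ → ℝ → ℝ) : Prop :=
  ∀ t ∈ Icc 0 T, ∀ x ∈ Icc 0 L, 0 < pressureGradient L P t x

/-- The initial and inflow data are positive off the wall and strictly monotone in `y`, up to
the wall. (On the wall itself the data vanish, by the no-slip condition.) -/
structure MonotoneData (T L : ℝ) (u₀ u₁ : ℝ → ℝ → ℝ) : Prop where
  pos_initial : ∀ x ∈ Icc 0 L, ∀ y > 0, 0 < u₀ x y
  pos_inflow : ∀ t ∈ Ico 0 T, ∀ y > 0, 0 < u₁ t y
  mono_initial : ∀ x ∈ Icc 0 L, ∀ y ≥ 0, 0 < derivWithin (fun s => u₀ x s) (Ici 0) y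
  mono_inflow : ∀ t ∈ Ico 0 T, ∀ y ≥ 0, 0 < derivWithin (fun s => u₁ t s) (Ici 0) y

/-- `(u, v)` is a classical solution, for `0 ≤ t < T`, of the Prandtl problem with outer flow
`(U_e, P)`, initial velocity `u₀` and inflow velocity `u₁`. -/
structure IsClassicalSolution (T L : ℝ) (Ue P u₀ u₁ : ℝ → ℝ → ℝ)
    (u v : ℝ → ℝ → ℝ → ℝ) : Prop where
  regular_u : IsC112On T L u (domain T L)
  /-- The vorticity has the derivatives that occur in the vorticity equation, in the interior. -/
  regular_uy : IsC112On T L (partialY u) (openDomain T L)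
  cont_v : ContinuousOn (fun q : ℝ × ℝ × ℝ => v q.1 q.2.1 q.2.2) (domain T L)
  diff_v : ∀ q ∈ domain T L, DifferentiableWithinAt ℝ (fun s => v q.1 q.2.1 s) (Ici 0) q.2.2
  momentum : ∀ t ∈ Ico 0 T, ∀ x ∈ Icc 0 L, ∀ y ≥ 0,
    partialT T u t x y + u t x y * partialX L u t x y + v t x y * partialY u t x y =
      partialY (partialY u) t x y - pressureGradient L P t x
  incompressible : ∀ t ∈ Ico 0 T, ∀ x ∈ Icc 0 L, ∀ y ≥ 0,
    partialX L u t x y + partialY v t x y = 0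
  wall_u : ∀ t ∈ Ico 0 T, ∀ x ∈ Icc 0 L, u t x 0 = 0
  wall_v : ∀ t ∈ Ico 0 T, ∀ x ∈ Icc 0 L, v t x 0 = 0
  /-- `u → U_e` as `y → ∞`, uniformly in `x` and locally uniformly in `t`. -/
  far_field : ∀ T' < T, TendstoUniformlyOn (fun (y : ℝ) (q : ℝ × ℝ) => u q.1 q.2 y)
    (fun q => Ue q.1 q.2) atTop (Icc 0 T' ×ˢ Icc 0 L)
  /-- `∂_x u` and `∂_y u` are bounded, locally uniformly in `t`. -/
  bounded : ∀ T' < T, ∃ M : ℝ, ∀ t ∈ Icc 0 T', ∀ x ∈ Icc 0 L, ∀ y ≥ 0,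
    |partialX L u t x y| ≤ M ∧ |partialY u t x y| ≤ M
  initial : ∀ x ∈ Icc 0 L, ∀ y ≥ 0, u 0 x y = u₀ x y
  inflow : ∀ t ∈ Ico 0 T, ∀ y ≥ 0, u t 0 y = u₁ t y

/-- `(t₀, x₀, y₀)` is a first zero of `∂_y u` as time evolves. -/
structure IsFirstCriticalPoint (T L : ℝ) (u : ℝ → ℝ → ℝ → ℝ) (t₀ x₀ y₀ : ℝ) : Prop where
  mem_t : t₀ ∈ Ioo 0 T
  mem_x : x₀ ∈ Icc 0 L
  mem_y : 0 ≤ y₀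
  zero : partialY u t₀ x₀ y₀ = 0
  first : ∀ t ∈ Ico 0 t₀, ∀ x ∈ Icc 0 L, ∀ y ≥ 0, partialY u t x y ≠ 0

/-- `(t₀, x₀, 0)` is a back flow point of `u`. -/
def IsBackFlowPoint (u : ℝ → ℝ → ℝ → ℝ) (t₀ x₀ : ℝ) : Prop :=
  partialY u t₀ x₀ 0 = 0 ∧ ∀ t ∈ Ioo 0 t₀, ∀ x ∈ Ioo 0 x₀, 0 < partialY u t x 0

/-- `∫_0^∞ ∫_0^L (L - x)^{3/2} ∂_y u₀ / √((∂_y u₀)² + u₀²) dx dy`, with values in `[0, ∞]`; the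
integrand is nonnegative when `u₀` is monotone in `y`. -/
def initialFunctional (L : ℝ) (u₀ : ℝ → ℝ → ℝ) : ENNReal :=
  ∫⁻ y in Ioi (0 : ℝ), ∫⁻ x in Icc 0 L, ENNReal.ofReal
    ((L - x) ^ (3 / 2 : ℝ) * derivWithin (fun s => u₀ x s) (Ici 0) y /
      √(derivWithin (fun s => u₀ x s) (Ici 0) y ^ 2 + u₀ x y ^ 2))

end Prandtl

end

/-!
The vorticity `w = ∂_y u` solves `w_t + u w_x + v w_y = w_yy`, with no zeroth-order term. As long as
`w > 0`, also `u ≥ 0`, so fluid leaves the domain through `x = L` and the minimum principle needs no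
condition there. At the time of a first zero, the barrier `(r² - (y - y₀)²)² e^{-K t}` keeps `w`
positive off the wall; the barrier `-η e^{c t} (1 + y²)` prevents zeros from entering from
`y = ∞`. Hence first zeros exist as soon as `w` vanishes somewhere, and they lie on the wall, where
the momentum equation reads `∂_y² u = ∂_x P`.

Suppose now that `w` stays positive and let `F = w / √(w² + u²)`. Then `F` satisfies
`F_t + u F_x + v F_y ≥ F_yy - F / 3 + ∂_x P u w / (w² + u²)^{3/2}`. Integrating against the weight
`(L - x)^{3/2}` gives an energy `E` with `E' ≥ c E³ - E - C`: the pressure term yields the cubic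
gain, and the transport and boundary terms stay bounded because `∫ w dy ≤ U_e`. If `E(0)` is large,
`E` blows up before the time `T / 2`, which is impossible since `E` is continuous on `[0, T / 2]`.
-/

namespace Prandtl

/-! ### Calculus and finite-time blow-up -/

section Calculus

theorem second_deriv_nonneg_of_isLocalMin {f f' : ℝ → ℝ} {f'' x : ℝ} (hmin : IsLocalMin f x)
    (hf : ∀ᶠ s in 𝓝 x, HasDerivAt f (f' s) s) (hf' : HasDerivAt f' f'' x) : 0 ≤ f'' := by
  by_contra! hneg
  have hd : deriv f =ᶠ[𝓝 x] f' := hf.mono fun s hs => hs.deriv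
  have hdd : deriv (deriv f) x = f'' := by rw [hd.deriv_eq, hf'.deriv]
  -- Otherwise `x` is also a local maximum, so `f` is locally constant.
  have hmax : IsLocalMax f x :=
    isLocalMax_of_deriv_deriv_neg (hdd ▸ hneg) hmin.deriv_eq_zero hf.self_of_nhds.continuousAt
  have hconst : f =ᶠ[𝓝 x] fun _ => f x := by
    filter_upwards [hmin, hmax] with s h1 h2 using le_antisymm h2 h1
  have hzero : deriv f =ᶠ[𝓝 x] fun _ => 0 := by simpa using hconst.deriv
  rw [hzero.deriv_eq, deriv_const] at hdd
  exact hneg.ne' hdd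

theorem deriv_nonpos_of_isMinOn_Icc {f : ℝ → ℝ} {f' a b t : ℝ} (ht : t ∈ Ioc a b)
    (hmin : IsMinOn f (Icc a b) t) (hf : HasDerivWithinAt f f' (Icc a b) t) : f' ≤ 0 := by
  have hcone : a - t ∈ posTangentConeAt (Icc a b) t :=
    sub_mem_posTangentConeAt_of_segment_subset <| by
      rw [segment_symm, segment_eq_Icc ht.1.le]
      exact Icc_subset_Icc_right ht.2
  have h : 0 ≤ (a - t) * f' := by
    simpa using hmin.localize.hasFDerivWithinAt_nonneg hf.hasFDerivWithinAt hcone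
  exact nonpos_of_mul_nonneg_right h (sub_neg.2 ht.1)

theorem isLocallyClosed_prod {X Y : Type*} [TopologicalSpace X] [TopologicalSpace Y] {s : Set X}
    {t : Set Y} (hs : IsLocallyClosed s) (ht : IsLocallyClosed t) : IsLocallyClosed (s ×ˢ t) :=
  (hs.preimage continuous_fst).inter (ht.preimage continuous_snd)

theorem integral_mul_deriv_le {a b U : ℝ} (hab : a ≤ b) {φ φ' M M' : ℝ → ℝ}
    (hφ : ∀ x ∈ Icc a b, HasDerivAt φ (φ' x) x) (hM : ∀ x ∈ Icc a b, HasDerivAt M (M' x) x)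
    (hφi : IntervalIntegrable φ' volume a b) (hMi : IntervalIntegrable M' volume a b)
    (hφ0 : ∀ x ∈ Icc a b, 0 ≤ φ x) (hφ'0 : ∀ x ∈ Icc a b, φ' x ≤ 0)
    (hM0 : 0 ≤ M a) (hMU : ∀ x ∈ Icc a b, M x ≤ U) :
    ∫ x in a..b, φ x * M' x ≤ φ a * U := by
  have hI : uIcc a b = Icc a b := uIcc_of_le hab
  have hφc : ContinuousOn M (uIcc a b) := fun x hx =>
    (hM x (hI ▸ hx)).continuousAt.continuousWithinAt
  have hint : ∫ x in a..b, φ' x * U ≤ ∫ x in a..b, φ' x * M x :=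
    intervalIntegral.integral_mono_on hab (hφi.mul_const U) (hφi.mul_continuousOn hφc)
      fun x hx => mul_le_mul_of_nonpos_left (hMU x hx) (hφ'0 x hx)
  rw [intervalIntegral.integral_mul_const,
    intervalIntegral.integral_eq_sub_of_hasDerivAt (fun x hx => hφ x (hI ▸ hx)) hφi] at hint
  have ha := mul_nonneg (hφ0 a (left_mem_Icc.2 hab)) hM0
  have hb := mul_le_mul_of_nonneg_left (hMU b (right_mem_Icc.2 hab)) (hφ0 b (right_mem_Icc.2 hab))
  calc ∫ x in a..b, φ x * M' x = φ b * M b - φ a * M a - ∫ x in a..b, φ' x * M x :=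
        intervalIntegral.integral_mul_deriv_eq_deriv_mul (fun x hx => hφ x (hI ▸ hx))
          (fun x hx => hM x (hI ▸ hx)) hφi hMi
    _ ≤ φ a * U := by linarith

variable {E : Type*} [NormedAddCommGroup E] [NormedSpace ℝ E]

theorem continuousOn_intervalIntegral {X : Type*} [TopologicalSpace X] [FirstCountableTopology X]
    [LocallyCompactSpace X] {S : Set X} (hS : IsLocallyClosed S) {a b : ℝ} (hab : a ≤ b)
    {f : X → ℝ → E} (hf : ContinuousOn (fun q : X × ℝ => f q.1 q.2) (S ×ˢ Icc a b)) :
    ContinuousOn (fun s => ∫ y in a..b, f s y) S := by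
  have : LocallyCompactSpace S := hS.locallyCompactSpace
  rw [continuousOn_iff_continuous_domRestrict]
  -- Extended constantly in `y` beyond `[a, b]`, the integrand is continuous on `S × ℝ`.
  have hcont : Continuous fun q : S × ℝ => f q.1 (projIcc a b hab q.2) :=
    hf.comp_continuous (f := fun q : S × ℝ => ((q.1 : X), (projIcc a b hab q.2 : ℝ)))
      (by fun_prop) fun q => ⟨q.1.2, (projIcc a b hab q.2).2⟩
  refine (intervalIntegral.continuous_parametric_intervalIntegral_of_continuous'
    (μ := volume) (f := fun (s : S) (y : ℝ) => f s (projIcc a b hab y)) hcont a b).congr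
    fun s => intervalIntegral.integral_congr fun y hy => ?_
  rw [uIcc_of_le hab] at hy
  simp only [projIcc_of_mem hab hy]

theorem hasDerivAt_intervalIntegral {α β c d s : ℝ} (hs : s ∈ Ioo α β) (hcd : c ≤ d)
    {f f' : ℝ → ℝ → E}
    (hf : ∀ r ∈ Ioo α β, ContinuousOn (f r) (Icc c d))
    (hf' : ContinuousOn (fun q : ℝ × ℝ => f' q.1 q.2) (Ioo α β ×ˢ Icc c d))
    (hd : ∀ r ∈ Ioo α β, ∀ y ∈ Icc c d, HasDerivAt (fun r => f r y) (f' r y) r) :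
    HasDerivAt (fun r => ∫ y in c..d, f r y) (∫ y in c..d, f' s y) s := by
  obtain ⟨a, ha1, ha2⟩ := exists_between hs.1
  obtain ⟨b, hb1, hb2⟩ := exists_between hs.2
  have hsub : Icc a b ⊆ Ioo α β := Icc_subset_Ioo ha1 hb2
  obtain ⟨C, hC⟩ := (isCompact_Icc.prod isCompact_Icc).exists_bound_of_continuousOn
    (hf'.mono (prod_mono hsub Subset.rfl))
  have hI : uIoc c d ⊆ Icc c d := by rw [uIoc_of_le hcd]; exact Ioc_subset_Icc_self
  have hm : ∀ {g : ℝ → E}, ContinuousOn g (Icc c d) →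
      AEStronglyMeasurable g (volume.restrict (uIoc c d)) := fun hg =>
    (hg.mono hI).aestronglyMeasurable measurableSet_uIoc
  refine (intervalIntegral.hasDerivAt_integral_of_dominated_loc_of_deriv_le
    (s := Icc a b) (bound := fun _ => C) (Icc_mem_nhds ha2 hb1) ?_ ?_ ?_ ?_ ?_ ?_).2
  · filter_upwards [Icc_mem_nhds ha2 hb1] with r hr using hm (hf r (hsub hr))
  · exact (hf s hs).intervalIntegrable_of_Icc hcd
  · exact hm (hf'.comp (f := fun y => (s, y)) (by fun_prop) fun y hy => ⟨hs, hy⟩)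
  · exact ae_of_all _ fun y hy r hr => hC (r, y) ⟨hr, hI hy⟩
  · exact intervalIntegrable_const
  · exact ae_of_all _ fun y hy r hr => hd r (hsub hr) y (hI hy)

theorem sub_eq_integral_of_mixed_deriv [CompleteSpace E] {α β c d s : ℝ} (hs : s ∈ Ioo α β)
    (hcd : c ≤ d) {f fs g h : ℝ → ℝ → E}
    (hfs : ∀ y ∈ Icc c d, HasDerivAt (fun r => f r y) (fs s y) s)
    (hfy : ∀ r ∈ Ioo α β, ∀ y ∈ Icc c d, HasDerivAt (f r) (g r y) y)
    (hg : ∀ r ∈ Ioo α β, ContinuousOn (g r) (Icc c d))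
    (hgs : ∀ r ∈ Ioo α β, ∀ y ∈ Icc c d, HasDerivAt (fun r => g r y) (h r y) r)
    (hh : ContinuousOn (fun q : ℝ × ℝ => h q.1 q.2) (Ioo α β ×ˢ Icc c d)) :
    fs s d - fs s c = ∫ y in c..d, h s y := by
  have hleft : HasDerivAt (fun r => f r d - f r c) (fs s d - fs s c) s :=
    (hfs d (right_mem_Icc.2 hcd)).sub (hfs c (left_mem_Icc.2 hcd))
  have hright := hasDerivAt_intervalIntegral hs hcd hg hh hgs
  refine hleft.unique (hright.congr_of_eventuallyEq ?_)
  filter_upwards [Ioo_mem_nhds hs.1 hs.2] with r hr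
  rw [intervalIntegral.integral_eq_sub_of_hasDerivAt
    (fun y hy => hfy r hr y (uIcc_of_le hcd ▸ hy)) ((hg r hr).intervalIntegrable_of_Icc hcd)]

/-- Unlike in Schwarz's theorem, only one of the mixed derivatives is assumed to exist. -/
theorem hasDerivAt_partial_swap [CompleteSpace E] {α β c d s y : ℝ} {f fs g h : ℝ → ℝ → E}
    (hfs : ∀ y ∈ Ioo c d, HasDerivAt (fun r => f r y) (fs s y) s)
    (hfy : ∀ r ∈ Ioo α β, ∀ y ∈ Ioo c d, HasDerivAt (f r) (g r y) y)
    (hg : ∀ r ∈ Ioo α β, ContinuousOn (g r) (Ioo c d))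
    (hgs : ∀ r ∈ Ioo α β, ∀ y ∈ Ioo c d, HasDerivAt (fun r => g r y) (h r y) r)
    (hh : ContinuousOn (fun q : ℝ × ℝ => h q.1 q.2) (Ioo α β ×ˢ Ioo c d))
    (hs : s ∈ Ioo α β) (hy : y ∈ Ioo c d) : HasDerivAt (fs s) (h s y) y := by
  obtain ⟨y₁, h1, h2⟩ := exists_between hy.1
  have hhs : ContinuousOn (h s) (Ioo c d) :=
    hh.comp (f := fun y => (s, y)) (by fun_prop) fun y hy => ⟨hs, hy⟩
  have hint : HasDerivAt (fun z => ∫ r in y₁..z, h s r) (h s y) y :=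
    intervalIntegral.integral_hasDerivAt_right
      ((hhs.mono (Icc_subset_Ioo h1 hy.2)).intervalIntegrable_of_Icc h2.le)
      (hhs.stronglyMeasurableAtFilter isOpen_Ioo y hy)
      (hhs.continuousAt (Ioo_mem_nhds hy.1 hy.2))
  refine (hint.const_add (fs s y₁)).congr_of_eventuallyEq ?_
  filter_upwards [Ioo_mem_nhds h2 hy.2] with z hz
  have hsub : Icc y₁ z ⊆ Ioo c d := Icc_subset_Ioo h1 hz.2
  rw [← sub_eq_iff_eq_add']
  exact sub_eq_integral_of_mixed_deriv hs hz.1.le (fun y hy => hfs y (hsub hy))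
    (fun r hr y hy => hfy r hr y (hsub hy)) (fun r hr => (hg r hr).mono hsub)
    (fun r hr y hy => hgs r hr y (hsub hy)) (hh.mono (prod_mono Subset.rfl hsub))

end Calculus

section BlowUp

variable {A A' : ℝ → ℝ}

theorem inv_le_of_sq_lt_deriv {a b K : ℝ} (hK : 0 < K) (hab : b - a < K⁻¹)
    (hA : ContinuousOn A (Icc a b)) (hd : ∀ t ∈ Ico a b, HasDerivAt A (A' t) t)
    (hineq : ∀ t ∈ Ico a b, K ≤ A t → A t ^ 2 < A' t) (ha : K ≤ A a) :
    ∀ t ∈ Icc a b, (K⁻¹ - (t - a))⁻¹ ≤ A t := by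
  -- `B` solves `B' = B ^ 2`, `B a = K`.
  let B : ℝ → ℝ := fun t => (K⁻¹ - (t - a))⁻¹
  have hden : ∀ t ∈ Icc a b, 0 < K⁻¹ - (t - a) := fun t ht => by linarith [ht.2]
  have hB : ∀ t ∈ Icc a b, HasDerivAt B (B t ^ 2) t := by
    intro t ht
    have h : HasDerivAt (fun t => K⁻¹ - (t - a)) (-1) t := by
      simpa using ((hasDerivAt_id t).sub_const a).const_sub K⁻¹
    refine (h.fun_inv (hden t ht).ne').congr_deriv ?_
    simp only [B, neg_neg, one_div, inv_pow]
  have hKB : ∀ t ∈ Icc a b, K ≤ B t := fun t ht => by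
    rw [le_inv_comm₀ hK (hden t ht)]
    linarith [ht.1]
  intro t ht
  refine neg_le_neg_iff.1 (image_le_of_deriv_right_lt_deriv_boundary' (f := fun t => -A t)
    (f' := fun t => -A' t) (B := fun t => -B t) (B' := fun t => -(B t ^ 2)) hA.neg
    (fun t ht => (hd t ht).neg.hasDerivWithinAt) (by simpa [B] using ha)
    (fun t ht => (hB t ht).neg.continuousAt.continuousWithinAt)
    (fun t ht => (hB t (Ico_subset_Icc_self ht)).neg.hasDerivWithinAt) ?_ ht)
  intro t ht hAB
  rw [neg_inj] at hAB
  rw [neg_lt_neg_iff, ← hAB]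
  exact hineq t ht (hAB ▸ hKB t (Ico_subset_Icc_self ht))

theorem le_of_sq_lt_deriv {τ K : ℝ} (hK : 0 < K) (hτ : K⁻¹ < τ) (hA : ContinuousOn A (Icc 0 τ))
    (hd : ∀ t ∈ Ioo 0 τ, HasDerivAt A (A' t) t)
    (hineq : ∀ t ∈ Ioo 0 τ, K ≤ A t → A t ^ 2 < A' t) : A 0 ≤ K := by
  by_contra! h0
  have hτ0 : 0 < τ := (inv_pos.2 hK).trans hτ
  obtain ⟨t₁, hKt₁, ht₁, ht₁τ⟩ : ∃ t₁, K < A t₁ ∧ 0 < t₁ ∧ t₁ < τ - K⁻¹ := by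
    have h : ∀ᶠ t in 𝓝[>] (0 : ℝ), K < A t :=
      ((hA 0 (left_mem_Icc.2 hτ0.le)).mono_of_mem_nhdsWithin (Icc_mem_nhdsGT hτ0)).eventually
        (lt_mem_nhds h0)
    exact (h.and (Ioo_mem_nhdsGT (sub_pos.2 hτ))).exists
  obtain ⟨M, hM⟩ := isCompact_Icc.exists_bound_of_continuousOn hA
  have hMpos : 0 < max M K + 1 := by linarith [le_max_right M K]
  have hMK : (max M K + 1)⁻¹ < K⁻¹ := inv_strictAnti₀ hK (by linarith [le_max_right M K])
  have hMinv : 0 < (max M K + 1)⁻¹ := inv_pos.2 hMpos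
  -- The comparison function reaches a value beyond the bound `M` of `A` at time `t₂ < τ`.
  set t₂ := t₁ + (K⁻¹ - (max M K + 1)⁻¹) with ht₂
  have hsub : ∀ t ∈ Ico t₁ t₂, t ∈ Ioo 0 τ := fun t ht =>
    ⟨ht₁.trans_le ht.1, by linarith [ht.2]⟩
  have hlarge := inv_le_of_sq_lt_deriv (a := t₁) (b := t₂) hK (by linarith)
    (hA.mono (Icc_subset_Icc ht₁.le (by linarith))) (fun t ht => hd t (hsub t ht))
    (fun t ht => hineq t (hsub t ht)) hKt₁.le t₂ (right_mem_Icc.2 (by linarith))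
  rw [ht₂, add_sub_cancel_left, sub_sub_cancel, inv_inv] at hlarge
  have hsmall := (le_abs_self _).trans (hM t₂ ⟨by linarith, by linarith⟩)
  linarith [le_max_left M K]

theorem sq_lt_cubic {c C a : ℝ} (hC : 0 ≤ C) (ha1 : 1 ≤ a) (ha : C + 2 < c * a) :
    a ^ 2 < c * a ^ 3 - a - C := by
  have hlin : a ≤ a ^ 2 := by nlinarith
  have hconst : C ≤ C * a ^ 2 := le_mul_of_one_le_right hC (one_le_pow₀ ha1)
  have hcubic : (C + 2) * a ^ 2 < c * a * a ^ 2 := mul_lt_mul_of_pos_right ha (by positivity)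
  linarith

theorem exists_blowup_threshold {c C τ : ℝ} (hc : 0 < c) (hC : 0 ≤ C) (hτ : 0 < τ) :
    ∃ K > 0, ∀ A A' : ℝ → ℝ, ContinuousOn A (Icc 0 τ) →
      (∀ t ∈ Ioo 0 τ, HasDerivAt A (A' t) t) →
      (∀ t ∈ Ioo 0 τ, 0 ≤ A t → c * A t ^ 3 - A t - C ≤ A' t) → A 0 ≤ K := by
  obtain ⟨K, hK⟩ : ∃ K, max 1 (max (2 / τ) ((C + 2) / c)) < K := exists_gt _
  obtain ⟨hK1, hKτ, hKc⟩ : 1 < K ∧ 2 / τ < K ∧ (C + 2) / c < K := by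
    simpa only [max_lt_iff] using hK
  have hKpos : 0 < K := one_pos.trans hK1
  have hinv : K⁻¹ < τ := by
    rw [inv_lt_comm₀ hKpos hτ]
    refine lt_of_lt_of_le ?_ hKτ.le
    rw [inv_eq_one_div]
    exact div_lt_div_of_pos_right one_lt_two hτ
  refine ⟨K, hKpos, fun A A' hA hd hineq => le_of_sq_lt_deriv hKpos hinv hA hd ?_⟩
  intro t ht hKA
  refine (sq_lt_cubic hC (hK1.le.trans hKA) ?_).trans_le (hineq t ht (hKpos.le.trans hKA))
  have := (div_lt_iff₀' hc).1 hKc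
  exact this.trans_le (mul_le_mul_of_nonneg_left hKA hc.le)

end BlowUp

/-! ### The vorticity equation -/

section Regularity

variable {T L : ℝ} {f : ℝ → ℝ → ℝ → ℝ} {D : Set (ℝ × ℝ × ℝ)} {t x y : ℝ}

theorem openDomain_subset : openDomain T L ⊆ domain T L :=
  prod_mono Ioo_subset_Ico_self (prod_mono Ioo_subset_Icc_self Ioi_subset_Ici_self)

theorem IsC112On.hasDerivAt_t (hf : IsC112On T L f D) (hq : (t, x, y) ∈ D) (ht : t ∈ Ioo 0 T) :
    HasDerivAt (fun s => f s x y) (partialT T f t x y) t :=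
  (hf.diff_t _ hq).hasDerivWithinAt.hasDerivAt (Ico_mem_nhds ht.1 ht.2)

theorem IsC112On.hasDerivAt_x (hf : IsC112On T L f D) (hq : (t, x, y) ∈ D) (hx : x ∈ Ioo 0 L) :
    HasDerivAt (fun s => f t s y) (partialX L f t x y) x :=
  (hf.diff_x _ hq).hasDerivWithinAt.hasDerivAt (Icc_mem_nhds hx.1 hx.2)

theorem IsC112On.hasDerivAt_y (hf : IsC112On T L f D) (hq : (t, x, y) ∈ D) (hy : 0 < y) :
    HasDerivAt (fun s => f t x s) (partialY f t x y) y :=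
  (hf.diff_y _ hq).hasDerivWithinAt.hasDerivAt (Ici_mem_nhds hy)

theorem IsC112On.hasDerivAt_yy (hf : IsC112On T L f D) (hq : (t, x, y) ∈ D) (hy : 0 < y) :
    HasDerivAt (fun s => partialY f t x s) (partialY (partialY f) t x y) y :=
  (hf.diff_yy _ hq).hasDerivWithinAt.hasDerivAt (Ici_mem_nhds hy)

variable {u : ℝ → ℝ → ℝ → ℝ}

theorem hasDerivAt_partialT_y (hu : IsC112On T L u (domain T L))
    (hw : IsC112On T L (partialY u) (openDomain T L)) (ht : t ∈ Ioo 0 T) (hx : x ∈ Ioo 0 L)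
    (hy : 0 < y) :
    HasDerivAt (fun z => partialT T u t x z) (partialT T (partialY u) t x y) y := by
  have hmem : ∀ s ∈ Ioo 0 T, ∀ z ∈ Ioo 0 (y + 1), (s, x, z) ∈ openDomain T L :=
    fun s hs z hz => ⟨hs, hx, hz.1⟩
  have hmem' : ∀ s ∈ Ioo 0 T, ∀ z ∈ Ioo 0 (y + 1), (s, x, z) ∈ domain T L :=
    fun s hs z hz => openDomain_subset (hmem s hs z hz)
  exact hasDerivAt_partial_swap (f := fun s z => u s x z) (fs := fun s z => partialT T u s x z)
    (g := fun s z => partialY u s x z) (h := fun s z => partialT T (partialY u) s x z)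
    (fun z hz => hu.hasDerivAt_t (hmem' t ht z hz) ht)
    (fun s hs z hz => hu.hasDerivAt_y (hmem' s hs z hz) hz.1)
    (fun s hs => hu.cont_y.comp (f := fun z => (s, x, z)) (by fun_prop) (hmem' s hs))
    (fun s hs z hz => hw.hasDerivAt_t (hmem s hs z hz) hs)
    (hw.cont_t.comp (f := fun q : ℝ × ℝ => (q.1, x, q.2)) (by fun_prop)
      fun q hq => hmem q.1 hq.1 q.2 hq.2) ht ⟨hy, lt_add_one y⟩

theorem hasDerivAt_partialX_y (hu : IsC112On T L u (domain T L))
    (hw : IsC112On T L (partialY u) (openDomain T L)) (ht : t ∈ Ioo 0 T) (hx : x ∈ Ioo 0 L)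
    (hy : 0 < y) :
    HasDerivAt (fun z => partialX L u t x z) (partialX L (partialY u) t x y) y := by
  have hmem : ∀ s ∈ Ioo 0 L, ∀ z ∈ Ioo 0 (y + 1), (t, s, z) ∈ openDomain T L :=
    fun s hs z hz => ⟨ht, hs, hz.1⟩
  have hmem' : ∀ s ∈ Ioo 0 L, ∀ z ∈ Ioo 0 (y + 1), (t, s, z) ∈ domain T L :=
    fun s hs z hz => openDomain_subset (hmem s hs z hz)
  exact hasDerivAt_partial_swap (f := fun s z => u t s z) (fs := fun s z => partialX L u t s z)
    (g := fun s z => partialY u t s z) (h := fun s z => partialX L (partialY u) t s z)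
    (fun z hz => hu.hasDerivAt_x (hmem' x hx z hz) hx)
    (fun s hs z hz => hu.hasDerivAt_y (hmem' s hs z hz) hz.1)
    (fun s hs => hu.cont_y.comp (f := fun z => (t, s, z)) (by fun_prop) (hmem' s hs))
    (fun s hs z hz => hw.hasDerivAt_x (hmem s hs z hz) hs)
    (hw.cont_x.comp (f := fun q : ℝ × ℝ => (t, q.1, q.2)) (by fun_prop)
      fun q hq => hmem q.1 hq.1 q.2 hq.2) hx ⟨hy, lt_add_one y⟩

end Regularity

namespace IsClassicalSolution

variable {T L : ℝ} {Ue P u₀ u₁ : ℝ → ℝ → ℝ} {u v : ℝ → ℝ → ℝ → ℝ} {t x y : ℝ}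

theorem vorticity_equation (h : IsClassicalSolution T L Ue P u₀ u₁ u v) (ht : t ∈ Ioo 0 T)
    (hx : x ∈ Ioo 0 L) (hy : 0 < y) :
    partialT T (partialY u) t x y + u t x y * partialX L (partialY u) t x y +
      v t x y * partialY (partialY u) t x y = partialY (partialY (partialY u)) t x y := by
  have ht' : t ∈ Ico 0 T := Ioo_subset_Ico_self ht
  have hx' : x ∈ Icc 0 L := Ioo_subset_Icc_self hx
  have hq : (t, x, y) ∈ openDomain T L := ⟨ht, hx, hy⟩
  have hq' : (t, x, y) ∈ domain T L := openDomain_subset hq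
  have hdt := hasDerivAt_partialT_y h.regular_u h.regular_uy ht hx hy
  have hdx := hasDerivAt_partialX_y h.regular_u h.regular_uy ht hx hy
  have hdu := h.regular_u.hasDerivAt_y hq' hy
  have hdv : HasDerivAt (fun z => v t x z) (partialY v t x y) y :=
    (h.diff_v _ hq').hasDerivWithinAt.hasDerivAt (Ici_mem_nhds hy)
  have hleft := (hdt.fun_add (hdu.fun_mul hdx)).fun_add
    (hdv.fun_mul (h.regular_u.hasDerivAt_yy hq' hy))
  have hright := (h.regular_uy.hasDerivAt_yy hq hy).sub_const (pressureGradient L P t x)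
  have hmomentum : (fun z => partialT T u t x z + u t x z * partialX L u t x z +
      v t x z * partialY u t x z) =ᶠ[𝓝 y]
      fun z => partialY (partialY u) t x z - pressureGradient L P t x := by
    filter_upwards [Ioi_mem_nhds hy] with z hz using h.momentum t ht' x hx' z (le_of_lt hz)
  linear_combination hleft.unique (hright.congr_of_eventuallyEq hmomentum) -
    partialY u t x y * h.incompressible t ht' x hx' y hy.le

theorem hasDerivWithinAt_u (h : IsClassicalSolution T L Ue P u₀ u₁ u v) (ht : t ∈ Ico 0 T)
    (hx : x ∈ Icc 0 L) (hy : 0 ≤ y) : HasDerivWithinAt (u t x) (partialY u t x y) (Ici 0) y :=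
  (h.regular_u.diff_y (t, x, y) ⟨ht, hx, hy⟩).hasDerivWithinAt

theorem hasDerivAt_u (h : IsClassicalSolution T L Ue P u₀ u₁ u v) (ht : t ∈ Ico 0 T)
    (hx : x ∈ Icc 0 L) (hy : 0 < y) : HasDerivAt (u t x) (partialY u t x y) y :=
  (h.hasDerivWithinAt_u ht hx hy.le).hasDerivAt (Ici_mem_nhds hy)

theorem continuousOn_u (h : IsClassicalSolution T L Ue P u₀ u₁ u v) (ht : t ∈ Ico 0 T)
    (hx : x ∈ Icc 0 L) : ContinuousOn (u t x) (Ici 0) := fun _ hy =>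
  (h.hasDerivWithinAt_u ht hx hy).continuousWithinAt

theorem continuousOn_uy (h : IsClassicalSolution T L Ue P u₀ u₁ u v) (ht : t ∈ Ico 0 T)
    (hx : x ∈ Icc 0 L) : ContinuousOn (partialY u t x) (Ici 0) :=
  h.regular_u.cont_y.comp (f := fun z => (t, x, z)) (by fun_prop) fun _ hz => ⟨ht, hx, hz⟩

theorem u_nonneg (h : IsClassicalSolution T L Ue P u₀ u₁ u v) (ht : t ∈ Ico 0 T)
    (hx : x ∈ Icc 0 L) (hy : 0 ≤ y) (hw : ∀ z ∈ Ioo 0 y, 0 ≤ partialY u t x z) :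
    0 ≤ u t x y := by
  have hmono : MonotoneOn (u t x) (Icc 0 y) := by
    refine monotoneOn_of_deriv_nonneg (convex_Icc 0 y)
      ((h.continuousOn_u ht hx).mono Icc_subset_Ici_self) ?_ ?_ <;> rw [interior_Icc]
    · exact fun z hz => (h.hasDerivAt_u ht hx hz.1).differentiableAt.differentiableWithinAt
    · exact fun z hz => (h.hasDerivAt_u ht hx hz.1).deriv ▸ hw z hz
  rw [← h.wall_u t ht x hx]
  exact hmono (left_mem_Icc.2 hy) (right_mem_Icc.2 hy) hy

theorem strictMonoOn_u (h : IsClassicalSolution T L Ue P u₀ u₁ u v) (ht : t ∈ Ico 0 T)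
    (hx : x ∈ Icc 0 L) (hw : ∀ y > 0, 0 < partialY u t x y) :
    StrictMonoOn (u t x) (Ici 0) := by
  refine strictMonoOn_of_deriv_pos (convex_Ici 0) (h.continuousOn_u ht hx) ?_
  rw [interior_Ici]
  exact fun y hy => (h.hasDerivAt_u ht hx hy).deriv ▸ hw y hy

theorem u_pos (h : IsClassicalSolution T L Ue P u₀ u₁ u v) (ht : t ∈ Ico 0 T)
    (hx : x ∈ Icc 0 L) (hy : 0 < y) (hw : ∀ y > 0, 0 < partialY u t x y) :
    0 < u t x y := by
  rw [← h.wall_u t ht x hx]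
  exact h.strictMonoOn_u ht hx hw self_mem_Ici hy.le hy

theorem tendsto_u (h : IsClassicalSolution T L Ue P u₀ u₁ u v) (ht : t ∈ Ico 0 T)
    (hx : x ∈ Icc 0 L) : Tendsto (u t x) atTop (𝓝 (Ue t x)) :=
  (h.far_field t ht.2).tendsto_at (x := (t, x)) ⟨⟨ht.1, le_rfl⟩, hx⟩

theorem u_le (h : IsClassicalSolution T L Ue P u₀ u₁ u v) (ht : t ∈ Ico 0 T)
    (hx : x ∈ Icc 0 L) (hy : 0 ≤ y) (hw : ∀ y > 0, 0 < partialY u t x y) :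
    u t x y ≤ Ue t x := by
  refine ge_of_tendsto (h.tendsto_u ht hx) ?_
  filter_upwards [eventually_ge_atTop y] with z hz
  exact (h.strictMonoOn_u ht hx hw).monotoneOn hy (hy.trans hz) hz

theorem integral_uy (h : IsClassicalSolution T L Ue P u₀ u₁ u v) (ht : t ∈ Ico 0 T)
    (hx : x ∈ Icc 0 L) {a b : ℝ} (ha : 0 ≤ a) (hab : a ≤ b) :
    ∫ y in a..b, partialY u t x y = u t x b - u t x a := by
  have hs : Icc a b ⊆ Ici 0 := fun y hy => ha.trans hy.1
  exact intervalIntegral.integral_eq_sub_of_hasDerivAt_of_le hab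
    ((h.continuousOn_u ht hx).mono hs) (fun y hy => h.hasDerivAt_u ht hx (ha.trans_lt hy.1))
    (((h.continuousOn_uy ht hx).mono hs).intervalIntegrable_of_Icc hab)

theorem abs_v_le (h : IsClassicalSolution T L Ue P u₀ u₁ u v) (ht : t ∈ Ico 0 T)
    (hx : x ∈ Icc 0 L) (hy : 0 ≤ y) {M : ℝ} (hM : ∀ y ≥ 0, |partialX L u t x y| ≤ M) :
    |v t x y| ≤ M * y := by
  have hvy : ∀ z ∈ Ici 0, ‖partialY v t x z‖ ≤ M := fun z hz => by
    rw [eq_neg_of_add_eq_zero_right (h.incompressible t ht x hx z hz), norm_neg]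
    exact hM z hz
  have hlip := (convex_Ici (0 : ℝ)).norm_image_sub_le_of_norm_hasDerivWithin_le
    (f := v t x) (fun z hz => (h.diff_v (t, x, z) ⟨ht, hx, hz⟩).hasDerivWithinAt) hvy
    self_mem_Ici hy
  simpa [h.wall_v t ht x hx, abs_of_nonneg hy] using hlip

theorem wall_balance (h : IsClassicalSolution T L Ue P u₀ u₁ u v) (ht : t ∈ Ico 0 T)
    (hx : x ∈ Icc 0 L) : partialY (partialY u) t x 0 = pressureGradient L P t x := by
  have hut : partialT T u t x 0 = 0 := by
    have : partialT T u t x 0 = derivWithin (fun _ => (0 : ℝ)) (Ico 0 T) t :=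
      derivWithin_congr (fun s hs => h.wall_u s hs x hx) (h.wall_u t ht x hx)
    rw [this, derivWithin_fun_const, Pi.zero_apply]
  have hmomentum := h.momentum t ht x hx 0 le_rfl
  rw [h.wall_u t ht x hx, h.wall_v t ht x hx, hut] at hmomentum
  linarith

theorem partialY_initial (h : IsClassicalSolution T L Ue P u₀ u₁ u v)
    (hx : x ∈ Icc 0 L) (hy : 0 ≤ y) :
    partialY u 0 x y = derivWithin (fun s => u₀ x s) (Ici 0) y :=
  derivWithin_congr (fun s hs => h.initial x hx s hs) (h.initial x hx y hy)

theorem partialY_inflow (h : IsClassicalSolution T L Ue P u₀ u₁ u v) (ht : t ∈ Ico 0 T)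
    (hy : 0 ≤ y) : partialY u t 0 y = derivWithin (fun s => u₁ t s) (Ici 0) y :=
  derivWithin_congr (fun s hs => h.inflow t ht s hs) (h.inflow t ht y hy)

theorem uy_initial_pos (h : IsClassicalSolution T L Ue P u₀ u₁ u v)
    (hD : MonotoneData T L u₀ u₁) (hx : x ∈ Icc 0 L) (hy : 0 ≤ y) : 0 < partialY u 0 x y := by
  rw [h.partialY_initial hx hy]; exact hD.mono_initial x hx y hy

theorem uy_inflow_pos (h : IsClassicalSolution T L Ue P u₀ u₁ u v)
    (hD : MonotoneData T L u₀ u₁) (ht : t ∈ Ico 0 T) (hy : 0 ≤ y) : 0 < partialY u t 0 y := by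
  rw [h.partialY_inflow ht hy]; exact hD.mono_inflow t ht y hy

end IsClassicalSolution

section MinimumPrinciple

theorem exists_le_div_sub {x L η : ℝ} (hx : x < L) (hη : 0 < η) (M : ℝ) :
    ∃ L' ∈ Ioo x L, M ≤ η / (L - L') := by
  have hblow : Tendsto (fun s => η / (L - s)) (𝓝[<] L) atTop := by
    refine (tendsto_inv_nhdsGT_zero.comp (tendsto_nhdsWithin_iff.2 ⟨?_, ?_⟩)).const_mul_atTop hη
    · exact ((continuous_const.sub continuous_id).tendsto' L 0 (sub_self L)).mono_left
        nhdsWithin_le_nhds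
    · filter_upwards [self_mem_nhdsWithin] with s hs using sub_pos.2 (mem_Iio.1 hs)
  exact (Filter.Eventually.and (Ioo_mem_nhdsLT hx) (hblow.eventually_ge_atTop M)).exists

variable {τ L y₁ y₂ η : ℝ} {a b z zt zx zy zyy : ℝ → ℝ → ℝ → ℝ} {t x y : ℝ}

/-- `z` is a strict supersolution of `∂_t z + a ∂_x z + b ∂_y z = ∂_y² z` on the box
`[0, τ] × [0, L] × [y₁, y₂]`. The derivatives of `z` are part of the data; they are needed only
off the parabolic boundary and off the outflow boundary `x = L`. -/
structure IsStrictSupersolution (τ L y₁ y₂ : ℝ) (a b z zt zx zy zyy : ℝ → ℝ → ℝ → ℝ) : Prop where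
  cont : ContinuousOn (fun q : ℝ × ℝ × ℝ => z q.1 q.2.1 q.2.2) (Icc 0 τ ×ˢ Icc 0 L ×ˢ Icc y₁ y₂)
  deriv_t : ∀ t ∈ Ioc 0 τ, ∀ x ∈ Ioo 0 L, ∀ y ∈ Ioo y₁ y₂,
    HasDerivWithinAt (fun s => z s x y) (zt t x y) (Icc 0 τ) t
  deriv_x : ∀ t ∈ Ioc 0 τ, ∀ x ∈ Ioo 0 L, ∀ y ∈ Ioo y₁ y₂,
    HasDerivAt (fun s => z t s y) (zx t x y) x
  deriv_y : ∀ t ∈ Ioc 0 τ, ∀ x ∈ Ioo 0 L, ∀ y ∈ Ioo y₁ y₂, HasDerivAt (z t x) (zy t x y) y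
  deriv_yy : ∀ t ∈ Ioc 0 τ, ∀ x ∈ Ioo 0 L, ∀ y ∈ Ioo y₁ y₂, HasDerivAt (zy t x) (zyy t x y) y
  strict : ∀ t ∈ Ioc 0 τ, ∀ x ∈ Ioo 0 L, ∀ y ∈ Ioo y₁ y₂,
    0 < zt t x y + a t x y * zx t x y + b t x y * zy t x y - zyy t x y

namespace IsStrictSupersolution

theorem not_isMinOn (hz : IsStrictSupersolution τ L y₁ y₂ a b z zt zx zy zyy) (ht : t ∈ Ioc 0 τ)
    (hx : x ∈ Ioo 0 L) (hy : y ∈ Ioo y₁ y₂) :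
    ¬ IsMinOn (fun q : ℝ × ℝ × ℝ => z q.1 q.2.1 q.2.2) (Icc 0 τ ×ˢ Icc 0 L ×ˢ Icc y₁ y₂)
      (t, x, y) := by
  intro hmin
  have ht' : t ∈ Icc 0 τ := Ioc_subset_Icc_self ht
  have hx' : x ∈ Icc 0 L := Ioo_subset_Icc_self hx
  have hy' : y ∈ Icc y₁ y₂ := Ioo_subset_Icc_self hy
  have hmint : IsMinOn (fun s => z s x y) (Icc 0 τ) t := fun s hs =>
    hmin (show (s, x, y) ∈ _ from ⟨hs, hx', hy'⟩)
  have hminx : IsLocalMin (fun s => z t s y) x := by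
    filter_upwards [Icc_mem_nhds hx.1 hx.2] with s hs using
      hmin (show (t, s, y) ∈ _ from ⟨ht', hs, hy'⟩)
  have hminy : IsLocalMin (z t x) y := by
    filter_upwards [Icc_mem_nhds hy.1 hy.2] with s hs using
      hmin (show (t, x, s) ∈ _ from ⟨ht', hx', hs⟩)
  have hzt : zt t x y ≤ 0 := deriv_nonpos_of_isMinOn_Icc ht hmint (hz.deriv_t t ht x hx y hy)
  have hzx : zx t x y = 0 := hminx.hasDerivAt_eq_zero (hz.deriv_x t ht x hx y hy)
  have hzy : zy t x y = 0 := hminy.hasDerivAt_eq_zero (hz.deriv_y t ht x hx y hy)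
  have hzyy : 0 ≤ zyy t x y := by
    refine second_deriv_nonneg_of_isLocalMin hminy ?_ (hz.deriv_yy t ht x hx y hy)
    filter_upwards [Ioo_mem_nhds hy.1 hy.2] with s hs using hz.deriv_y t ht x hx s hs
  have hstrict := hz.strict t ht x hx y hy
  rw [hzx, hzy] at hstrict
  linarith

theorem nonneg_of_nonneg_boundary (hz : IsStrictSupersolution τ L y₁ y₂ a b z zt zx zy zyy)
    (h0 : ∀ x ∈ Icc 0 L, ∀ y ∈ Icc y₁ y₂, 0 ≤ z 0 x y)
    (hin : ∀ t ∈ Icc 0 τ, ∀ y ∈ Icc y₁ y₂, 0 ≤ z t 0 y)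
    (hout : ∀ t ∈ Icc 0 τ, ∀ y ∈ Icc y₁ y₂, 0 ≤ z t L y)
    (hlo : ∀ t ∈ Icc 0 τ, ∀ x ∈ Icc 0 L, 0 ≤ z t x y₁)
    (hhi : ∀ t ∈ Icc 0 τ, ∀ x ∈ Icc 0 L, 0 ≤ z t x y₂) :
    ∀ t ∈ Icc 0 τ, ∀ x ∈ Icc 0 L, ∀ y ∈ Icc y₁ y₂, 0 ≤ z t x y := by
  intro t ht x hx y hy
  obtain ⟨⟨t', x', y'⟩, ⟨ht', hx', hy'⟩, hmin⟩ := (isCompact_Icc.prod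
    (isCompact_Icc.prod isCompact_Icc)).exists_isMinOn ⟨(t, x, y), ht, hx, hy⟩ hz.cont
  refine le_trans ?_ (hmin (show (t, x, y) ∈ _ from ⟨ht, hx, hy⟩))
  by_contra! hneg
  dsimp only at ht' hx' hy' hneg
  refine hz.not_isMinOn ⟨ht'.1.lt_of_ne ?_, ht'.2⟩ ⟨hx'.1.lt_of_ne ?_, hx'.2.lt_of_ne ?_⟩
    ⟨hy'.1.lt_of_ne ?_, hy'.2.lt_of_ne ?_⟩ hmin
  · rintro rfl; exact hneg.not_ge (h0 x' hx' y' hy')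
  · rintro rfl; exact hneg.not_ge (hin t' ht' y' hy')
  · rintro rfl; exact hneg.not_ge (hout t' ht' y' hy')
  · rintro rfl; exact hneg.not_ge (hlo t' ht' x' hx')
  · rintro rfl; exact hneg.not_ge (hhi t' ht' x' hx')

/-- Adding `η / (L - x)` creates a barrier at the outflow boundary; this is where the sign of the
transport coefficient `a` enters. -/
theorem add_outflow_barrier (hz : IsStrictSupersolution τ L y₁ y₂ a b z zt zx zy zyy)
    (ha : ∀ t ∈ Ioc 0 τ, ∀ x ∈ Ioo 0 L, ∀ y ∈ Ioo y₁ y₂, 0 ≤ a t x y) (hη : 0 ≤ η) {L' : ℝ}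
    (hL' : L' < L) :
    IsStrictSupersolution τ L' y₁ y₂ a b (fun t x y => z t x y + η / (L - x)) zt
      (fun t x y => zx t x y + η / (L - x) ^ 2) zy zyy := by
  have hsub : ∀ {x}, x ∈ Ioo 0 L' → x ∈ Ioo 0 L := fun hx => ⟨hx.1, hx.2.trans hL'⟩
  refine ⟨?_, fun t ht x hx y hy => (hz.deriv_t t ht x (hsub hx) y hy).add_const _,
    fun t ht x hx y hy => ?_, fun t ht x hx y hy => (hz.deriv_y t ht x (hsub hx) y hy).add_const _,
    fun t ht x hx y hy => hz.deriv_yy t ht x (hsub hx) y hy, fun t ht x hx y hy => ?_⟩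
  · refine (hz.cont.mono (prod_mono Subset.rfl
      (prod_mono (Icc_subset_Icc_right hL'.le) Subset.rfl))).add
      (continuousOn_const.div (by fun_prop) fun q hq => ?_)
    exact (sub_pos.2 (hq.2.1.2.trans_lt hL')).ne'
  · have hne : L - x ≠ 0 := (sub_pos.2 (hsub hx).2).ne'
    have hbar : HasDerivAt (fun s => η / (L - s)) (η / (L - x) ^ 2) x := by
      refine ((hasDerivAt_const x η).fun_div ((hasDerivAt_id x).const_sub L) hne).congr_deriv ?_
      simp
    exact (hz.deriv_x t ht x (hsub hx) y hy).fun_add hbar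
  · have hstrict := hz.strict t ht x (hsub hx) y hy
    have hpos : 0 ≤ a t x y * (η / (L - x) ^ 2) :=
      mul_nonneg (ha t ht x (hsub hx) y hy) (div_nonneg hη (sq_nonneg _))
    linarith

theorem nonneg_of_lt (hz : IsStrictSupersolution τ L y₁ y₂ a b z zt zx zy zyy)
    (ha : ∀ t ∈ Ioc 0 τ, ∀ x ∈ Ioo 0 L, ∀ y ∈ Ioo y₁ y₂, 0 ≤ a t x y)
    (h0 : ∀ x ∈ Icc 0 L, ∀ y ∈ Icc y₁ y₂, 0 ≤ z 0 x y)
    (hin : ∀ t ∈ Icc 0 τ, ∀ y ∈ Icc y₁ y₂, 0 ≤ z t 0 y)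
    (hlo : ∀ t ∈ Icc 0 τ, ∀ x ∈ Icc 0 L, 0 ≤ z t x y₁)
    (hhi : ∀ t ∈ Icc 0 τ, ∀ x ∈ Icc 0 L, 0 ≤ z t x y₂)
    (ht : t ∈ Icc 0 τ) (hx : x ∈ Ico 0 L) (hy : y ∈ Icc y₁ y₂) : 0 ≤ z t x y := by
  obtain ⟨M, hM⟩ := (isCompact_Icc.prod
    (isCompact_Icc.prod isCompact_Icc)).exists_bound_of_continuousOn hz.cont
  have hLx : 0 < L - x := sub_pos.2 hx.2
  suffices h : ∀ η > 0, 0 ≤ z t x y + η / (L - x) by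
    refine le_of_forall_pos_le_add fun ε hε => ?_
    simpa [mul_div_cancel_right₀ _ hLx.ne'] using h (ε * (L - x)) (mul_pos hε hLx)
  intro η hη
  obtain ⟨L', ⟨hxL', hL'L⟩, hL'⟩ := exists_le_div_sub hx.2 hη M
  have hsub : ∀ {r}, r ∈ Icc 0 L' → r ∈ Icc 0 L := fun hr => ⟨hr.1, hr.2.trans hL'L.le⟩
  have hbar : ∀ {r}, r ∈ Icc 0 L' → 0 ≤ η / (L - r) := fun hr =>
    div_nonneg hη.le (sub_nonneg.2 (hsub hr).2)
  have hL'0 : (0 : ℝ) ≤ L' := hx.1.trans hxL'.le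
  refine (hz.add_outflow_barrier ha hη.le hL'L).nonneg_of_nonneg_boundary
    (fun r hr s hs => add_nonneg (h0 r (hsub hr) s hs) (hbar hr))
    (fun r hr s hs => add_nonneg (hin r hr s hs) (hbar (left_mem_Icc.2 hL'0)))
    (fun r hr s hs => ?_)
    (fun r hr s hs => add_nonneg (hlo r hr s (hsub hs)) (hbar hs))
    (fun r hr s hs => add_nonneg (hhi r hr s (hsub hs)) (hbar hs)) t ht x ⟨hx.1, hxL'.le⟩ y hy
  have hbound := neg_le_of_abs_le
    (hM (r, L', s) ⟨hr, hsub (right_mem_Icc.2 hL'0), hs⟩)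
  linarith

/-- No condition is imposed at `x = L`, where the flow leaves the box. -/
theorem nonneg (hz : IsStrictSupersolution τ L y₁ y₂ a b z zt zx zy zyy)
    (ha : ∀ t ∈ Ioc 0 τ, ∀ x ∈ Ioo 0 L, ∀ y ∈ Ioo y₁ y₂, 0 ≤ a t x y)
    (h0 : ∀ x ∈ Icc 0 L, ∀ y ∈ Icc y₁ y₂, 0 ≤ z 0 x y)
    (hin : ∀ t ∈ Icc 0 τ, ∀ y ∈ Icc y₁ y₂, 0 ≤ z t 0 y)
    (hlo : ∀ t ∈ Icc 0 τ, ∀ x ∈ Icc 0 L, 0 ≤ z t x y₁)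
    (hhi : ∀ t ∈ Icc 0 τ, ∀ x ∈ Icc 0 L, 0 ≤ z t x y₂) :
    ∀ t ∈ Icc 0 τ, ∀ x ∈ Icc 0 L, ∀ y ∈ Icc y₁ y₂, 0 ≤ z t x y := by
  intro t ht x hx y hy
  rcases hx.1.trans hx.2 |>.eq_or_lt with rfl | hL
  · obtain rfl : x = 0 := le_antisymm hx.2 hx.1
    exact hin t ht y hy
  rw [← closure_Ico hL.ne] at hx
  refine le_on_closure (f := fun _ => 0) (g := fun s => z t s y) (fun s hs =>
    hz.nonneg_of_lt ha h0 hin hlo hhi ht hs hy) continuousOn_const ?_ hx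
  rw [closure_Ico hL.ne]
  exact hz.cont.comp (f := fun s => (t, s, y)) (by fun_prop) fun s hs => ⟨ht, hs, hy⟩

end IsStrictSupersolution

end MinimumPrinciple

/-! ### Minimum principle and first zeros -/

theorem exists_first_nonpos {X : Type*} [TopologicalSpace X] [T2Space X] {K : Set X}
    (hK : IsCompact K) {a b : ℝ} {f : ℝ × X → ℝ} (hf : ContinuousOn f (Icc a b ×ˢ K))
    (hne : ∃ q ∈ Icc a b ×ˢ K, f q ≤ 0) :
    ∃ q ∈ Icc a b ×ˢ K, f q ≤ 0 ∧ ∀ t ∈ Ico a q.1, ∀ x ∈ K, 0 < f (t, x) := by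
  have hbox : IsCompact (Icc a b ×ˢ K) := isCompact_Icc.prod hK
  have hZ : IsCompact ((Icc a b ×ˢ K) ∩ f ⁻¹' Iic 0) := hbox.of_isClosed_subset
    (hf.preimage_isClosed_of_isClosed hbox.isClosed isClosed_Iic) inter_subset_left
  obtain ⟨q, ⟨hq, hle⟩, hmin⟩ := hZ.exists_isMinOn hne (f := Prod.fst) continuousOn_fst
  exact ⟨q, hq, hle, fun t ht x hx => not_le.1 fun hle' => ht.2.not_ge
    (hmin (show (t, x) ∈ _ from ⟨⟨⟨ht.1, ht.2.le.trans hq.1.2⟩, hx⟩, hle'⟩))⟩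

section Bump

variable {r y₀ y : ℝ}

/-- The bump `(r² - (y - y₀)²)²`, used on `|y - y₀| ≤ r` as a lower barrier for the vorticity. -/
def bump (r y₀ y : ℝ) : ℝ := (r ^ 2 - (y - y₀) ^ 2) ^ 2

/-- The derivative of `bump`. -/
def bumpDeriv (r y₀ y : ℝ) : ℝ := -4 * (y - y₀) * (r ^ 2 - (y - y₀) ^ 2)

/-- The second derivative of `bump`. -/
def bumpDeriv₂ (r y₀ y : ℝ) : ℝ := -4 * (r ^ 2 - (y - y₀) ^ 2) + 8 * (y - y₀) ^ 2

theorem hasDerivAt_bump : HasDerivAt (bump r y₀) (bumpDeriv r y₀ y) y := by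
  have hs : HasDerivAt (fun s => s - y₀) 1 y := (hasDerivAt_id y).sub_const y₀
  exact (((hs.fun_pow 2).const_sub (r ^ 2)).fun_pow 2).congr_deriv
    (by simp only [bumpDeriv]; push_cast; ring)

theorem hasDerivAt_bumpDeriv : HasDerivAt (bumpDeriv r y₀) (bumpDeriv₂ r y₀ y) y := by
  have hs : HasDerivAt (fun s => s - y₀) 1 y := (hasDerivAt_id y).sub_const y₀
  exact ((hs.const_mul (-4)).fun_mul ((hs.fun_pow 2).const_sub (r ^ 2))).congr_deriv
    (by simp only [bumpDeriv₂]; push_cast; ring)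

theorem bump_le (hy : |y - y₀| ≤ r) : bump r y₀ y ≤ r ^ 4 := by
  have hsq : (y - y₀) ^ 2 ≤ r ^ 2 := sq_le_sq' (abs_le.1 hy).1 (abs_le.1 hy).2
  calc bump r y₀ y ≤ (r ^ 2) ^ 2 :=
        pow_le_pow_left₀ (sub_nonneg.2 hsq) (sub_le_self _ (sq_nonneg _)) 2
    _ = r ^ 4 := by ring

theorem mul_exp_mul_bump_le {m K s : ℝ} (hr : 0 < r) (hm : 0 ≤ m) (hK : 0 ≤ K) (hs : 0 ≤ s)
    (hy : |y - y₀| ≤ r) : m / r ^ 4 * Real.exp (-K * s) * bump r y₀ y ≤ m := by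
  have hexp : Real.exp (-K * s) ≤ 1 := Real.exp_le_one_iff.2
    (mul_nonpos_of_nonpos_of_nonneg (neg_nonpos.2 hK) hs)
  calc m / r ^ 4 * Real.exp (-K * s) * bump r y₀ y ≤ m / r ^ 4 * 1 * r ^ 4 := by
        gcongr
        exacts [sq_nonneg _, bump_le hy]
    _ = m := by field_simp

/-- After the substitution `s = r² - (y - y₀)²` the operator is a quadratic polynomial in `s`
that is negative at `s = 0`, so a large multiple of `-s²` makes it negative everywhere. -/
theorem exists_bump_subsolution (hr : 0 < r) {V : ℝ} (hV : 0 ≤ V) :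
    ∃ K ≥ 0, ∀ y w : ℝ, |y - y₀| ≤ r → |w| ≤ V →
      -K * bump r y₀ y + w * bumpDeriv r y₀ y - bumpDeriv₂ r y₀ y < 0 := by
  set B := 4 * (V * r) + 12
  refine ⟨(B / (4 * r)) ^ 2, sq_nonneg _, fun y w hy hw => ?_⟩
  set s := r ^ 2 - (y - y₀) ^ 2 with hs
  have hs0 : 0 ≤ s := sub_nonneg.2 (sq_le_sq' (abs_le.1 hy).1 (abs_le.1 hy).2)
  have htransport : -(w * (y - y₀)) ≤ V * r := by
    refine (neg_le_abs _).trans ?_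
    rw [abs_mul]
    exact mul_le_mul hw hy (abs_nonneg _) hV
  calc -(B / (4 * r)) ^ 2 * bump r y₀ y + w * bumpDeriv r y₀ y - bumpDeriv₂ r y₀ y
      = -(B / (4 * r)) ^ 2 * s ^ 2 + (4 * -(w * (y - y₀)) + 12) * s - 8 * r ^ 2 := by
        simp only [bump, bumpDeriv, bumpDeriv₂, hs]; ring
    _ ≤ -(B / (4 * r)) ^ 2 * s ^ 2 + B * s - 8 * r ^ 2 := by gcongr; linarith
    _ = -((B / (4 * r)) * s - 2 * r) ^ 2 - 4 * r ^ 2 := by field_simp; ring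
    _ < 0 := by nlinarith [sq_nonneg ((B / (4 * r)) * s - 2 * r), pow_pos hr 2]

end Bump

namespace IsClassicalSolution

variable {T L : ℝ} {Ue P u₀ u₁ : ℝ → ℝ → ℝ} {u v : ℝ → ℝ → ℝ → ℝ} {τ y₁ y₂ t x y : ℝ}

theorem isStrictSupersolution_uy_sub (h : IsClassicalSolution T L Ue P u₀ u₁ u v) (hτ : τ < T)
    (hy₁ : 0 ≤ y₁) {c κ : ℝ} (hc : 0 < c) {q q' q'' : ℝ → ℝ}
    (hq : ∀ y, HasDerivAt q (q' y) y) (hq' : ∀ y, HasDerivAt q' (q'' y) y)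
    (hsub : ∀ t ∈ Icc 0 τ, ∀ x ∈ Icc 0 L, ∀ y ∈ Icc y₁ y₂,
      κ * q y + v t x y * q' y - q'' y < 0) :
    IsStrictSupersolution τ L y₁ y₂ u v
      (fun t x y => partialY u t x y - c * Real.exp (κ * t) * q y)
      (fun t x y => partialT T (partialY u) t x y - c * (Real.exp (κ * t) * κ) * q y)
      (partialX L (partialY u))
      (fun t x y => partialY (partialY u) t x y - c * Real.exp (κ * t) * q' y)
      (fun t x y => partialY (partialY (partialY u)) t x y - c * Real.exp (κ * t) * q'' y) := by
  have hint : ∀ {t x y}, t ∈ Ioc 0 τ → x ∈ Ioo 0 L → y ∈ Ioo y₁ y₂ →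
      (t, x, y) ∈ openDomain T L :=
    fun ht hx hy => ⟨⟨ht.1, ht.2.trans_lt hτ⟩, hx, hy₁.trans_lt hy.1⟩
  refine ⟨?_, fun t ht x hx y hy => ?_, fun t ht x hx y hy => ?_, fun t ht x hx y hy => ?_,
    fun t ht x hx y hy => ?_, fun t ht x hx y hy => ?_⟩
  · have hqc : Continuous q := continuous_iff_continuousAt.2 fun y => (hq y).continuousAt
    refine (h.regular_u.cont_y.mono fun q hq => ?_).sub (by fun_prop)
    exact ⟨⟨hq.1.1, hq.1.2.trans_lt hτ⟩, hq.2.1, hy₁.trans hq.2.2.1⟩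
  · have hexp : HasDerivAt (fun s => Real.exp (κ * s)) (Real.exp (κ * t) * κ) t := by
      simpa using ((hasDerivAt_id t).const_mul κ).exp
    exact ((h.regular_uy.hasDerivAt_t (hint ht hx hy) (hint ht hx hy).1).fun_sub
      ((hexp.const_mul c).mul_const _)).hasDerivWithinAt
  · exact (h.regular_uy.hasDerivAt_x (hint ht hx hy) hx).sub_const _
  · exact (h.regular_u.hasDerivAt_yy (openDomain_subset (hint ht hx hy))
      (hint ht hx hy).2.2).fun_sub ((hq y).const_mul _)
  · exact (h.regular_uy.hasDerivAt_yy (hint ht hx hy) (hint ht hx hy).2.2).fun_sub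
      ((hq' y).const_mul _)
  · have hneg := mul_neg_of_pos_of_neg (mul_pos hc (Real.exp_pos (κ * t)))
      (hsub t (Ioc_subset_Icc_self ht) x (Ioo_subset_Icc_self hx) y (Ioo_subset_Icc_self hy))
    linear_combination hneg - h.vorticity_equation (hint ht hx hy).1 hx (hint ht hx hy).2.2

theorem exp_mul_le_uy (h : IsClassicalSolution T L Ue P u₀ u₁ u v) (hτ : τ < T) (hy₁ : 0 ≤ y₁)
    {c κ : ℝ} (hc : 0 < c) {q q' q'' : ℝ → ℝ} (hq : ∀ y, HasDerivAt q (q' y) y)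
    (hq' : ∀ y, HasDerivAt q' (q'' y) y)
    (hu : ∀ t ∈ Icc 0 τ, ∀ x ∈ Icc 0 L, ∀ y ∈ Icc y₁ y₂, 0 ≤ u t x y)
    (hsub : ∀ t ∈ Icc 0 τ, ∀ x ∈ Icc 0 L, ∀ y ∈ Icc y₁ y₂,
      κ * q y + v t x y * q' y - q'' y < 0)
    (h0 : ∀ x ∈ Icc 0 L, ∀ y ∈ Icc y₁ y₂, c * Real.exp (κ * 0) * q y ≤ partialY u 0 x y)
    (hin : ∀ t ∈ Icc 0 τ, ∀ y ∈ Icc y₁ y₂, c * Real.exp (κ * t) * q y ≤ partialY u t 0 y)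
    (hlo : ∀ t ∈ Icc 0 τ, ∀ x ∈ Icc 0 L, c * Real.exp (κ * t) * q y₁ ≤ partialY u t x y₁)
    (hhi : ∀ t ∈ Icc 0 τ, ∀ x ∈ Icc 0 L, c * Real.exp (κ * t) * q y₂ ≤ partialY u t x y₂) :
    ∀ t ∈ Icc 0 τ, ∀ x ∈ Icc 0 L, ∀ y ∈ Icc y₁ y₂,
      c * Real.exp (κ * t) * q y ≤ partialY u t x y := fun t ht x hx y hy =>
  sub_nonneg.1 <| (h.isStrictSupersolution_uy_sub hτ hy₁ hc hq hq' hsub).nonneg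
    (fun t ht x hx y hy => hu t (Ioc_subset_Icc_self ht) x (Ioo_subset_Icc_self hx) y
      (Ioo_subset_Icc_self hy))
    (fun x hx y hy => sub_nonneg.2 (h0 x hx y hy)) (fun t ht y hy => sub_nonneg.2 (hin t ht y hy))
    (fun t ht x hx => sub_nonneg.2 (hlo t ht x hx))
    (fun t ht x hx => sub_nonneg.2 (hhi t ht x hx)) t ht x hx y hy

theorem exists_le_uy_initial_and_inflow (h : IsClassicalSolution T L Ue P u₀ u₁ u v) (hL : 0 ≤ L)
    (hD : MonotoneData T L u₀ u₁) (hT : 0 < T) (hτ : τ < T) (hy₁ : 0 ≤ y₁) :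
    ∃ m > 0, (∀ x ∈ Icc 0 L, ∀ y ∈ Icc y₁ y₂, m ≤ partialY u 0 x y) ∧
      ∀ t ∈ Icc 0 τ, ∀ y ∈ Icc y₁ y₂, m ≤ partialY u t 0 y := by
  obtain ⟨m₁, hm₁, hle₁⟩ := (isCompact_Icc.prod isCompact_Icc).exists_forall_le'
    (f := fun q : ℝ × ℝ => partialY u 0 q.1 q.2) (s := Icc 0 L ×ˢ Icc y₁ y₂) (a := 0)
    (h.regular_u.cont_y.comp (f := fun q : ℝ × ℝ => (0, q.1, q.2)) (by fun_prop)
      fun q hq => ⟨⟨le_rfl, hT⟩, hq.1, hy₁.trans hq.2.1⟩)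
    (fun q hq => h.uy_initial_pos hD hq.1 (hy₁.trans hq.2.1))
  obtain ⟨m₂, hm₂, hle₂⟩ := (isCompact_Icc.prod isCompact_Icc).exists_forall_le'
    (f := fun q : ℝ × ℝ => partialY u q.1 0 q.2) (s := Icc 0 τ ×ˢ Icc y₁ y₂) (a := 0)
    (h.regular_u.cont_y.comp (f := fun q : ℝ × ℝ => (q.1, 0, q.2)) (by fun_prop)
      fun q hq => ⟨⟨hq.1.1, hq.1.2.trans_lt hτ⟩, ⟨le_rfl, hL⟩, hy₁.trans hq.2.1⟩)
    (fun q hq => h.uy_inflow_pos hD ⟨hq.1.1, hq.1.2.trans_lt hτ⟩ (hy₁.trans hq.2.1))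
  exact ⟨min m₁ m₂, lt_min hm₁ hm₂,
    fun x hx y hy => (min_le_left _ _).trans (hle₁ (x, y) ⟨hx, hy⟩),
    fun t ht y hy => (min_le_right _ _).trans (hle₂ (t, y) ⟨ht, hy⟩)⟩

theorem uy_pos_of_nonneg (h : IsClassicalSolution T L Ue P u₀ u₁ u v)
    (hD : MonotoneData T L u₀ u₁) (hτ : τ < T)
    (hw : ∀ t ∈ Icc 0 τ, ∀ x ∈ Icc 0 L, ∀ y ≥ 0, 0 ≤ partialY u t x y) :
    ∀ t ∈ Icc 0 τ, ∀ x ∈ Icc 0 L, ∀ y > 0, 0 < partialY u t x y := by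
  intro t ht x hx y₀ hy₀
  have hT : ∀ {s}, s ∈ Icc 0 τ → s ∈ Ico 0 T := fun hs => ⟨hs.1, hs.2.trans_lt hτ⟩
  obtain ⟨r, hr0, hry⟩ : ∃ r, 0 < r ∧ r < y₀ := exists_between hy₀
  have hlo : 0 ≤ y₀ - r := by linarith
  have hy₀mem : y₀ ∈ Icc (y₀ - r) (y₀ + r) := ⟨by linarith, by linarith⟩
  have habs : ∀ {y}, y ∈ Icc (y₀ - r) (y₀ + r) → |y - y₀| ≤ r := fun hy =>
    abs_le.2 ⟨by linarith [hy.1], by linarith [hy.2]⟩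
  obtain ⟨V, hV⟩ := (isCompact_Icc.prod (isCompact_Icc.prod isCompact_Icc))
    |>.exists_bound_of_continuousOn (s := Icc 0 τ ×ˢ Icc 0 L ×ˢ Icc (y₀ - r) (y₀ + r))
    (h.cont_v.mono fun q hq => ⟨hT hq.1, hq.2.1, hlo.trans hq.2.2.1⟩)
  obtain ⟨K, hK0, hK⟩ := exists_bump_subsolution (y₀ := y₀) hr0
    ((norm_nonneg _).trans (hV (t, x, y₀) ⟨ht, hx, hy₀mem⟩))
  obtain ⟨m, hm, hm0, hmin⟩ := h.exists_le_uy_initial_and_inflow (hx.1.trans hx.2) hD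
    ((ht.1.trans ht.2).trans_lt hτ) hτ hlo (y₂ := y₀ + r)
  have hedge : ∀ {s x y}, s ∈ Icc 0 τ → x ∈ Icc 0 L → 0 ≤ y → bump r y₀ y = 0 →
      m / r ^ 4 * Real.exp (-K * s) * bump r y₀ y ≤ partialY u s x y := by
    intro s x y hs hx hy hzero
    rw [hzero, mul_zero]
    exact hw s hs x hx y hy
  have hbarrier := h.exp_mul_le_uy hτ hlo (c := m / r ^ 4) (by positivity)
    (fun _ => hasDerivAt_bump) (fun _ => hasDerivAt_bumpDeriv)
    (fun s hs x hx y hy => h.u_nonneg (hT hs) hx (hlo.trans hy.1)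
      fun z hz => hw s hs x hx z hz.1.le)
    (fun s hs x hx y hy => hK y _ (habs hy) (hV (s, x, y) ⟨hs, hx, hy⟩))
    (fun x hx y hy => (mul_exp_mul_bump_le hr0 hm.le hK0 le_rfl (habs hy)).trans (hm0 x hx y hy))
    (fun s hs y hy => (mul_exp_mul_bump_le hr0 hm.le hK0 hs.1 (habs hy)).trans (hmin s hs y hy))
    (fun s hs x hx => hedge hs hx hlo (by simp [bump]))
    (fun s hs x hx => hedge hs hx (by linarith) (by simp [bump])) t ht x hx y₀ hy₀mem
  have hcenter : bump r y₀ y₀ = r ^ 4 := by simp only [bump, sub_self]; ring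
  refine lt_of_lt_of_le ?_ hbarrier
  rw [hcenter]
  positivity

theorem neg_exp_mul_le_uy (h : IsClassicalSolution T L Ue P u₀ u₁ u v)
    (hD : MonotoneData T L u₀ u₁) (hτ : τ < T) (hy₁ : 0 ≤ y₁) {M η : ℝ} (hη : 0 < η)
    (hM : ∀ t ∈ Icc 0 τ, ∀ x ∈ Icc 0 L, ∀ y ≥ 0,
      |partialX L u t x y| ≤ M ∧ |partialY u t x y| ≤ M)
    (hu : ∀ t ∈ Icc 0 τ, ∀ x ∈ Icc 0 L, ∀ y ≥ y₁, 0 ≤ u t x y)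
    (hw : ∀ t ∈ Icc 0 τ, ∀ x ∈ Icc 0 L, 0 ≤ partialY u t x y₁)
    (ht : t ∈ Icc 0 τ) (hx : x ∈ Icc 0 L) (hy : y₁ ≤ y) :
    η * Real.exp ((2 * M + 3) * t) * -(1 + y ^ 2) ≤ partialY u t x y := by
  have hy0 : 0 ≤ y := hy₁.trans hy
  have hT : ∀ {s}, s ∈ Icc 0 τ → s ∈ Ico 0 T := fun hs => ⟨hs.1, hs.2.trans_lt hτ⟩
  have hM0 : 0 ≤ M := (abs_nonneg _).trans (hM t ht x hx y hy0).1
  have hMη : 0 ≤ M / η := div_nonneg hM0 hη.le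
  have hneg : ∀ s y : ℝ, η * Real.exp ((2 * M + 3) * s) * -(1 + y ^ 2) ≤ 0 := fun s y =>
    mul_nonpos_of_nonneg_of_nonpos (by positivity) (neg_nonpos.2 (by positivity))
  -- At `y₂` the barrier lies below `-M`.
  set y₂ := y + M / η + 1
  have hfar : M ≤ η * (1 + y₂ ^ 2) := by
    rw [← div_le_iff₀' hη]
    nlinarith
  refine h.exp_mul_le_uy hτ hy₁ (y₂ := y₂) (q := fun y => -(1 + y ^ 2)) (q' := fun y => -(2 * y))
    (q'' := fun _ => -(2 * 1)) hη
    (fun y => ((((hasDerivAt_id y).fun_pow 2).const_add 1).fun_neg).congr_deriv (by simp))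
    (fun y => ((hasDerivAt_id y).const_mul 2).fun_neg)
    (fun s hs x hx y hy => hu s hs x hx y hy.1) (fun s hs x hx y hy => ?_)
    (fun x hx y hy => (hneg 0 y).trans (h.uy_initial_pos hD hx (hy₁.trans hy.1)).le)
    (fun s hs y hy => (hneg s y).trans (h.uy_inflow_pos hD (hT hs) (hy₁.trans hy.1)).le)
    (fun s hs x hx => (hneg s y₁).trans (hw s hs x hx)) (fun s hs x hx => ?_)
    t ht x hx y ⟨hy, by linarith⟩
  · have hy0 : 0 ≤ y := hy₁.trans hy.1
    have hv := neg_le_of_abs_le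
      (h.abs_v_le (hT hs) hx hy0 fun z hz => (hM s hs x hx z hz).1)
    nlinarith [mul_le_mul_of_nonneg_right hv hy0, sq_nonneg y]
  · have huy := neg_le_of_abs_le (hM s hs x hx y₂ (by linarith)).2
    have hexp : 1 ≤ Real.exp ((2 * M + 3) * s) :=
      Real.one_le_exp (mul_nonneg (by positivity) hs.1)
    have : η * 1 * (1 + y₂ ^ 2) ≤ η * Real.exp ((2 * M + 3) * s) * (1 + y₂ ^ 2) := by gcongr
    linarith

theorem uy_nonneg_of_far (h : IsClassicalSolution T L Ue P u₀ u₁ u v)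
    (hD : MonotoneData T L u₀ u₁) (hτ : τ < T) (hy₁ : 0 ≤ y₁)
    (hu : ∀ t ∈ Icc 0 τ, ∀ x ∈ Icc 0 L, ∀ y ≥ y₁, 0 ≤ u t x y)
    (hw : ∀ t ∈ Icc 0 τ, ∀ x ∈ Icc 0 L, 0 ≤ partialY u t x y₁) :
    ∀ t ∈ Icc 0 τ, ∀ x ∈ Icc 0 L, ∀ y ≥ y₁, 0 ≤ partialY u t x y := by
  intro t ht x hx y hy
  obtain ⟨M, hM⟩ := h.bounded τ hτ
  set c := Real.exp ((2 * M + 3) * t) * (1 + y ^ 2) with hc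
  have hc0 : 0 < c := by positivity
  refine le_of_forall_pos_le_add fun ε hε => ?_
  have hbarrier := h.neg_exp_mul_le_uy hD hτ hy₁ (div_pos hε hc0) hM hu hw ht hx hy
  have hval : ε / c * Real.exp ((2 * M + 3) * t) * -(1 + y ^ 2) = -(ε / c * c) := by
    rw [hc]; ring
  rw [hval, div_mul_cancel₀ _ hc0.ne'] at hbarrier
  linarith

theorem exists_u_pos_far (h : IsClassicalSolution T L Ue P u₀ u₁ u v)
    (hUe : ContinuousOn (fun q : ℝ × ℝ => Ue q.1 q.2) (Icc 0 T ×ˢ Icc 0 L))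
    (hUe_pos : ∀ t ∈ Icc 0 T, ∀ x ∈ Icc 0 L, 0 < Ue t x) (hτ : τ < T) :
    ∃ Y > 0, ∀ t ∈ Icc 0 τ, ∀ x ∈ Icc 0 L, ∀ y ≥ Y, 0 < u t x y := by
  obtain ⟨m, hm, hmUe⟩ := (isCompact_Icc.prod isCompact_Icc).exists_forall_le'
    hUe (fun q hq => hUe_pos q.1 hq.1 q.2 hq.2)
  obtain ⟨Y, hY⟩ := eventually_atTop.1
    (Metric.tendstoUniformlyOn_iff.1 (h.far_field τ hτ) m hm)
  refine ⟨max Y 1, by positivity, fun t ht x hx y hy => ?_⟩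
  have hclose : Ue t x - u t x y < m :=
    (le_abs_self _).trans_lt (hY y ((le_max_left _ _).trans hy) (t, x) ⟨ht, hx⟩)
  have hlow : m ≤ Ue t x := hmUe (t, x) ⟨⟨ht.1, ht.2.trans hτ.le⟩, hx⟩
  linarith

theorem uy_nonneg_of_pos_before (h : IsClassicalSolution T L Ue P u₀ u₁ u v)
    (ht : t ∈ Ioo 0 T) (hx : x ∈ Icc 0 L) (hy : 0 ≤ y)
    (hw : ∀ s ∈ Ico 0 t, 0 < partialY u s x y) : 0 ≤ partialY u t x y := by
  have hcl : closure (Ico 0 t) = Icc 0 t := closure_Ico ht.1.ne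
  refine le_on_closure (s := Ico 0 t) (f := fun _ => 0) (g := fun s => partialY u s x y)
    (fun s hs => (hw s hs).le) continuousOn_const ?_ (hcl ▸ right_mem_Icc.2 ht.1.le)
  rw [hcl]
  exact h.regular_u.cont_y.comp (f := fun s => (s, x, y)) (by fun_prop)
    fun s hs => ⟨⟨hs.1, hs.2.trans_lt ht.2⟩, hx, hy⟩

theorem uy_pos_of_ne_zero (h : IsClassicalSolution T L Ue P u₀ u₁ u v)
    (hD : MonotoneData T L u₀ u₁) (ht : t ∈ Ico 0 T) (hx : x ∈ Icc 0 L) (hy : 0 ≤ y)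
    (hne : ∀ s ∈ Icc 0 t, partialY u s x y ≠ 0) : 0 < partialY u t x y := by
  by_contra! hle
  have hc : ContinuousOn (fun s => partialY u s x y) (Icc 0 t) :=
    h.regular_u.cont_y.comp (f := fun s => (s, x, y)) (by fun_prop)
      fun s hs => ⟨⟨hs.1, hs.2.trans_lt ht.2⟩, hx, hy⟩
  obtain ⟨s, hs, hzero⟩ := intermediate_value_Icc' ht.1 hc ⟨hle, (h.uy_initial_pos hD hx hy).le⟩
  exact hne s hs hzero

theorem uy_pos_before_firstCriticalPoint (h : IsClassicalSolution T L Ue P u₀ u₁ u v)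
    (hD : MonotoneData T L u₀ u₁) {t₀ x₀ y₀ : ℝ} (hc : IsFirstCriticalPoint T L u t₀ x₀ y₀) :
    ∀ t ∈ Ico 0 t₀, ∀ x ∈ Icc 0 L, ∀ y ≥ 0, 0 < partialY u t x y :=
  fun _ ht x hx y hy => h.uy_pos_of_ne_zero hD ⟨ht.1, ht.2.trans hc.mem_t.2⟩ hx hy
    fun s hs => hc.first s ⟨hs.1, hs.2.trans_lt ht.2⟩ x hx y hy

theorem firstCriticalPoint_on_wall (h : IsClassicalSolution T L Ue P u₀ u₁ u v)
    (hD : MonotoneData T L u₀ u₁) {t₀ x₀ y₀ : ℝ} (hc : IsFirstCriticalPoint T L u t₀ x₀ y₀) :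
    y₀ = 0 := by
  have hpos := h.uy_pos_before_firstCriticalPoint hD hc
  have hnonneg : ∀ t ∈ Icc 0 t₀, ∀ x ∈ Icc 0 L, ∀ y ≥ 0, 0 ≤ partialY u t x y := by
    intro t ht x hx y hy
    rcases ht.2.lt_or_eq with hlt | rfl
    · exact (hpos t ⟨ht.1, hlt⟩ x hx y hy).le
    · exact h.uy_nonneg_of_pos_before hc.mem_t hx hy fun s hs => hpos s hs x hx y hy
  by_contra hy
  exact (h.uy_pos_of_nonneg hD hc.mem_t.2 hnonneg t₀ ⟨hc.mem_t.1.le, le_rfl⟩ x₀ hc.mem_x y₀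
    (hc.mem_y.lt_of_ne' hy)).ne' hc.zero

theorem uy_pos_of_pos_near (h : IsClassicalSolution T L Ue P u₀ u₁ u v)
    (hD : MonotoneData T L u₀ u₁) (hτ : τ < T) {Y : ℝ} (hY : 0 ≤ Y)
    (hu : ∀ t ∈ Icc 0 τ, ∀ x ∈ Icc 0 L, ∀ y ≥ Y, 0 ≤ u t x y)
    (hnear : ∀ t ∈ Icc 0 τ, ∀ x ∈ Icc 0 L, ∀ y ∈ Icc 0 Y, 0 < partialY u t x y) :
    ∀ t ∈ Icc 0 τ, ∀ x ∈ Icc 0 L, ∀ y ≥ 0, 0 < partialY u t x y := by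
  have hfar := h.uy_nonneg_of_far hD hτ hY hu
    fun t ht x hx => (hnear t ht x hx Y ⟨hY, le_rfl⟩).le
  have hnonneg : ∀ t ∈ Icc 0 τ, ∀ x ∈ Icc 0 L, ∀ y ≥ 0, 0 ≤ partialY u t x y := by
    intro t ht x hx y hy
    rcases le_total y Y with hyY | hyY
    exacts [(hnear t ht x hx y ⟨hy, hyY⟩).le, hfar t ht x hx y hyY]
  intro t ht x hx y hy
  rcases hy.eq_or_lt with rfl | hy
  exacts [hnear t ht x hx 0 ⟨le_rfl, hY⟩, h.uy_pos_of_nonneg hD hτ hnonneg t ht x hx y hy]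

theorem exists_firstCriticalPoint (h : IsClassicalSolution T L Ue P u₀ u₁ u v)
    (hD : MonotoneData T L u₀ u₁)
    (hUe : ContinuousOn (fun q : ℝ × ℝ => Ue q.1 q.2) (Icc 0 T ×ˢ Icc 0 L))
    (hUe_pos : ∀ t ∈ Icc 0 T, ∀ x ∈ Icc 0 L, 0 < Ue t x)
    (hzero : ∃ t ∈ Ioo 0 T, ∃ x ∈ Icc 0 L, ∃ y ≥ 0, partialY u t x y = 0) :
    ∃ t₀ x₀, IsFirstCriticalPoint T L u t₀ x₀ 0 := by
  obtain ⟨t₁, ht₁, x₁, hx₁, y₁, hy₁, hzero⟩ := hzero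
  obtain ⟨Y, hY0, hY⟩ := h.exists_u_pos_far hUe hUe_pos ht₁.2
  have hpos_of_near : ∀ τ ≤ t₁,
      (∀ t ∈ Icc 0 τ, ∀ x ∈ Icc 0 L, ∀ y ∈ Icc 0 Y, 0 < partialY u t x y) →
        ∀ t ∈ Icc 0 τ, ∀ x ∈ Icc 0 L, ∀ y ≥ 0, 0 < partialY u t x y := fun τ hτ =>
    h.uy_pos_of_pos_near hD (hτ.trans_lt ht₁.2) hY0.le
      fun t ht x hx y hy => (hY t ⟨ht.1, ht.2.trans hτ⟩ x hx y hy).le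
  obtain ⟨⟨t₀, x₀, y₀⟩, ⟨ht₀, hx₀, hy₀⟩, hle, hbefore⟩ := exists_first_nonpos
    (f := fun q : ℝ × ℝ × ℝ => partialY u q.1 q.2.1 q.2.2) (isCompact_Icc.prod isCompact_Icc)
    (h.regular_u.cont_y.mono fun q hq => ⟨⟨hq.1.1, hq.1.2.trans_lt ht₁.2⟩, hq.2.1, hq.2.2.1⟩)
    (show ∃ q ∈ Icc 0 t₁ ×ˢ Icc 0 L ×ˢ Icc 0 Y, partialY u q.1 q.2.1 q.2.2 ≤ 0 by
      by_contra! hnear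
      exact (hpos_of_near t₁ le_rfl (fun t ht x hx y hy => hnear (t, x, y) ⟨ht, hx, hy⟩)
        t₁ ⟨ht₁.1.le, le_rfl⟩ x₁ hx₁ y₁ hy₁).ne' hzero)
  dsimp only at ht₀ hx₀ hy₀ hle hbefore
  have ht₀0 : 0 < t₀ := ht₀.1.lt_of_ne <| by
    rintro rfl
    exact hle.not_gt (h.uy_initial_pos hD hx₀ hy₀.1)
  have ht₀T : t₀ ∈ Ioo 0 T := ⟨ht₀0, ht₀.2.trans_lt ht₁.2⟩
  have hpos : ∀ t ∈ Ico 0 t₀, ∀ x ∈ Icc 0 L, ∀ y ≥ 0, 0 < partialY u t x y := fun t ht =>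
    hpos_of_near t (ht.2.le.trans ht₀.2) (fun s hs x hx y hy =>
      hbefore s ⟨hs.1, hs.2.trans_lt ht.2⟩ (x, y) ⟨hx, hy⟩) t ⟨ht.1, le_rfl⟩
  have hfirst : IsFirstCriticalPoint T L u t₀ x₀ y₀ :=
    ⟨ht₀T, hx₀, hy₀.1, le_antisymm hle (h.uy_nonneg_of_pos_before ht₀T hx₀ hy₀.1
      fun s hs => hpos s hs x₀ hx₀ y₀ hy₀.1), fun t ht x hx y hy => (hpos t ht x hx y hy).ne'⟩
  exact ⟨t₀, x₀, h.firstCriticalPoint_on_wall hD hfirst ▸ hfirst⟩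

end IsClassicalSolution

/-! ### The normalized shear -/

/-- The sine of the argument of `a + b i`, with the junk value `0` at the origin. -/
noncomputable def sinArg (a b : ℝ) : ℝ := b / √(b ^ 2 + a ^ 2)

/-- The derivative of `sinArg a b` along a curve `(a, b)` with velocity `(a', b')`. -/
noncomputable def sinArgDeriv (a b a' b' : ℝ) : ℝ := a * (a * b' - b * a') / √(b ^ 2 + a ^ 2) ^ 3

/-- The second derivative of `sinArg a a'` along a curve `a` with `(a', a'', a''') = (b, c, d)`. -/
noncomputable def sinArgDeriv₂ (a b c d : ℝ) : ℝ :=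
  (a ^ 2 * d - b ^ 3) / √(b ^ 2 + a ^ 2) ^ 3 -
    3 * (a * (a * c - b * b)) * (b * (a + c)) / √(b ^ 2 + a ^ 2) ^ 5

theorem sqrt_sq_add_sq_pos (a : ℝ) {b : ℝ} (hb : 0 < b) : 0 < √(b ^ 2 + a ^ 2) :=
  Real.sqrt_pos.2 (by positivity)

theorem sinArg_nonneg (a : ℝ) {b : ℝ} (hb : 0 ≤ b) : 0 ≤ sinArg a b := by
  unfold sinArg; positivity

theorem sinArg_le_one (a b : ℝ) : sinArg a b ≤ 1 :=
  div_le_one_of_le₀ (Real.le_sqrt_of_sq_le (le_add_of_nonneg_right (sq_nonneg a)))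
    (Real.sqrt_nonneg _)

theorem mul_sinArg_le (a : ℝ) {b : ℝ} (hb : 0 ≤ b) : a * sinArg a b ≤ b := by
  rw [sinArg, mul_div_left_comm]
  exact mul_le_of_le_one_right hb (div_le_one_of_le₀
    (Real.le_sqrt_of_sq_le (le_add_of_nonneg_left (sq_nonneg b))) (Real.sqrt_nonneg _))

theorem hasDerivAt_sqrt_sq_add_sq {a b : ℝ → ℝ} {a' b' s : ℝ} (ha : HasDerivAt a a' s)
    (hb : HasDerivAt b b' s) (hpos : 0 < b s) :
    HasDerivAt (fun s => √(b s ^ 2 + a s ^ 2))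
      ((a s * a' + b s * b') / √(b s ^ 2 + a s ^ 2)) s := by
  have := sqrt_sq_add_sq_pos (a s) hpos
  refine (((hb.fun_pow 2).fun_add (ha.fun_pow 2)).sqrt (by positivity)).congr_deriv ?_
  field_simp
  push_cast
  ring

theorem hasDerivAt_sinArg {a b : ℝ → ℝ} {a' b' s : ℝ} (ha : HasDerivAt a a' s)
    (hb : HasDerivAt b b' s) (hpos : 0 < b s) :
    HasDerivAt (fun s => sinArg (a s) (b s)) (sinArgDeriv (a s) (b s) a' b') s := by
  have h := sqrt_sq_add_sq_pos (a s) hpos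
  have h2 : √(b s ^ 2 + a s ^ 2) ^ 2 = b s ^ 2 + a s ^ 2 := Real.sq_sqrt (by positivity)
  refine (hb.fun_div (hasDerivAt_sqrt_sq_add_sq ha hb hpos) h.ne').congr_deriv ?_
  rw [sinArgDeriv]
  generalize √(b s ^ 2 + a s ^ 2) = ρ at *
  field_simp
  rw [h2]
  ring

theorem hasDerivAt_sinArgDeriv {a b c : ℝ → ℝ} {d s : ℝ} (ha : HasDerivAt a (b s) s)
    (hb : HasDerivAt b (c s) s) (hc : HasDerivAt c d s) (hpos : 0 < b s) :
    HasDerivAt (fun s => sinArgDeriv (a s) (b s) (b s) (c s))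
      (sinArgDeriv₂ (a s) (b s) (c s) d) s := by
  have h := sqrt_sq_add_sq_pos (a s) hpos
  have h2 : √(b s ^ 2 + a s ^ 2) ^ 2 = b s ^ 2 + a s ^ 2 := Real.sq_sqrt (by positivity)
  refine ((ha.fun_mul ((ha.fun_mul hc).fun_sub (hb.fun_mul hb))).fun_div
    ((hasDerivAt_sqrt_sq_add_sq ha hb hpos).fun_pow 3) (by positivity)).congr_deriv ?_
  rw [sinArgDeriv₂]
  generalize √(b s ^ 2 + a s ^ 2) = ρ at *
  field_simp
  push_cast
  ring

theorem sinArgDeriv₂_le {a b c d p : ℝ} (hb : 0 < b) :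
    sinArgDeriv₂ a b c d + p * (a * b / √(b ^ 2 + a ^ 2) ^ 3) - sinArg a b / 3 ≤
      a * (a * d - b * (c - p)) / √(b ^ 2 + a ^ 2) ^ 3 := by
  have h := sqrt_sq_add_sq_pos a hb
  have h2 : √(b ^ 2 + a ^ 2) ^ 2 = b ^ 2 + a ^ 2 := Real.sq_sqrt (by positivity)
  rw [sinArgDeriv₂, sinArg]
  generalize √(b ^ 2 + a ^ 2) = ρ at *
  have e : a * (a * d - b * (c - p)) / ρ ^ 3 - ((a ^ 2 * d - b ^ 3) / ρ ^ 3 -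
      3 * (a * (a * c - b * b)) * (b * (a + c)) / ρ ^ 5 + p * (a * b / ρ ^ 3) - b / ρ / 3) =
      b * (3 * ((b ^ 2 - a * c) * ρ ^ 2 + 3 * a * (a * c - b ^ 2) * (a + c)) + (ρ ^ 2) ^ 2)
        / (3 * ρ ^ 5) := by
    field_simp
    ring
  rw [← sub_nonneg, e, h2]
  have hsq : 3 * ((b ^ 2 - a * c) * (b ^ 2 + a ^ 2) + 3 * a * (a * c - b ^ 2) * (a + c)) +
      (b ^ 2 + a ^ 2) ^ 2 = (3 * (a * c) + a ^ 2 - 2 * b ^ 2) ^ 2 := by ring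
  rw [hsq]
  positivity

theorem three_mul_sq_mul_sinArg_sub_le {a b lam : ℝ} (ha : 0 < a) (hb : 0 < b) (hl : 0 ≤ lam) :
    3 * lam ^ 2 * sinArg a b - 2 * lam ^ 3 * (b / √a) ≤ a * b / √(b ^ 2 + a ^ 2) ^ 3 := by
  have h := sqrt_sq_add_sq_pos a hb
  rw [sinArg]
  generalize √(b ^ 2 + a ^ 2) = ρ at *
  have hs : 0 < √a := Real.sqrt_pos.2 ha
  have ha2 : a = √a ^ 2 := (Real.sq_sqrt ha.le).symm
  generalize √a = s at *
  subst ha2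
  have e : s ^ 2 * b / ρ ^ 3 - (3 * lam ^ 2 * (b / ρ) - 2 * lam ^ 3 * (b / s)) =
      b * ((s - lam * ρ) ^ 2 * (s + 2 * (lam * ρ))) / (ρ ^ 3 * s) := by
    field_simp
    ring
  rw [← sub_nonneg, e]
  positivity

/-- The cutoff `(1 - y / N)²` in the normal direction; it vanishes to second order at `y = N`, so
that integration by parts on `[ε, N]` leaves no boundary term there. -/
noncomputable def cutoff (N y : ℝ) : ℝ := (1 - y / N) ^ 2

/-- The derivative of `cutoff N`. -/
noncomputable def cutoffDeriv (N y : ℝ) : ℝ := -(2 / N) * (1 - y / N)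

theorem hasDerivAt_cutoff (N y : ℝ) : HasDerivAt (cutoff N) (cutoffDeriv N y) y := by
  have h1 : HasDerivAt (fun y => 1 - y / N) (-(1 / N)) y :=
    ((hasDerivAt_id y).div_const N).const_sub 1
  refine (h1.fun_pow 2).congr_deriv ?_
  rw [cutoffDeriv]
  push_cast
  ring

theorem hasDerivAt_cutoffDeriv (N y : ℝ) : HasDerivAt (cutoffDeriv N) (2 / N ^ 2) y := by
  have h1 : HasDerivAt (fun y => 1 - y / N) (-(1 / N)) y :=
    ((hasDerivAt_id y).div_const N).const_sub 1
  refine (h1.const_mul (-(2 / N))).congr_deriv ?_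
  field_simp

theorem cutoff_nonneg (N y : ℝ) : 0 ≤ cutoff N y := sq_nonneg _

theorem cutoff_le_one {N y : ℝ} (hy : y ∈ Icc 0 N) : cutoff N y ≤ 1 := by
  have h1 : 0 ≤ y / N := div_nonneg hy.1 (hy.1.trans hy.2)
  have h2 : y / N ≤ 1 := div_le_one_of_le₀ hy.2 (hy.1.trans hy.2)
  unfold cutoff
  nlinarith

@[fun_prop]
theorem continuous_cutoff (N : ℝ) : Continuous (cutoff N) := by unfold cutoff; fun_prop

@[fun_prop]
theorem continuous_cutoffDeriv (N : ℝ) : Continuous (cutoffDeriv N) := by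
  unfold cutoffDeriv; fun_prop

theorem cutoff_self {N : ℝ} (hN : N ≠ 0) : cutoff N N = 0 := by simp [cutoff, hN]

theorem cutoffDeriv_self {N : ℝ} (hN : N ≠ 0) : cutoffDeriv N N = 0 := by
  simp [cutoffDeriv, hN]

theorem abs_cutoffDeriv_le {N y : ℝ} (hy : y ∈ Icc 0 N) : |cutoffDeriv N y| ≤ 2 / N := by
  have hN : 0 ≤ 2 / N := div_nonneg zero_le_two (hy.1.trans hy.2)
  have h0 : 0 ≤ y / N := div_nonneg hy.1 (hy.1.trans hy.2)
  have h1 : y / N ≤ 1 := div_le_one_of_le₀ hy.2 (hy.1.trans hy.2)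
  rw [cutoffDeriv, abs_mul, abs_neg, abs_of_nonneg hN]
  exact mul_le_of_le_one_right hN (abs_le.2 ⟨by linarith, by linarith⟩)

theorem continuousOn_sinArg {X : Type*} [TopologicalSpace X] {S : Set X} {a b : X → ℝ}
    (ha : ContinuousOn a S) (hb : ContinuousOn b S) (hpos : ∀ q ∈ S, 0 < b q) :
    ContinuousOn (fun q => sinArg (a q) (b q)) S :=
  hb.div ((hb.pow 2).add (ha.pow 2)).sqrt fun q hq => (sqrt_sq_add_sq_pos (a q) (hpos q hq)).ne'

theorem continuousOn_sinArgDeriv {X : Type*} [TopologicalSpace X] {S : Set X} {a b a' b' : X → ℝ}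
    (ha : ContinuousOn a S) (hb : ContinuousOn b S) (ha' : ContinuousOn a' S)
    (hb' : ContinuousOn b' S) (hpos : ∀ q ∈ S, 0 < b q) :
    ContinuousOn (fun q => sinArgDeriv (a q) (b q) (a' q) (b' q)) S :=
  (ha.mul ((ha.mul hb').sub (hb.mul ha'))).div (((hb.pow 2).add (ha.pow 2)).sqrt.pow 3)
    fun q hq => pow_ne_zero 3 (sqrt_sq_add_sq_pos (a q) (hpos q hq)).ne'

theorem continuousOn_sinArgDeriv₂ {X : Type*} [TopologicalSpace X] {S : Set X} {a b c d : X → ℝ}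
    (ha : ContinuousOn a S) (hb : ContinuousOn b S) (hc : ContinuousOn c S)
    (hd : ContinuousOn d S) (hpos : ∀ q ∈ S, 0 < b q) :
    ContinuousOn (fun q => sinArgDeriv₂ (a q) (b q) (c q) (d q)) S := by
  have hs := ((hb.pow 2).add (ha.pow 2)).sqrt
  refine ContinuousOn.sub ((((ha.pow 2).mul hd).sub (hb.pow 3)).div (hs.pow 3) ?_)
    (ContinuousOn.div (((ha.mul ((ha.mul hc).sub (hb.mul hb))).const_mul 3).mul
      (hb.mul (ha.add hc))) (hs.pow 5) ?_)
  · exact fun q hq => pow_ne_zero 3 (sqrt_sq_add_sq_pos (a q) (hpos q hq)).ne'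
  · exact fun q hq => (sqrt_sq_add_sq_pos (a q) (hpos q hq)).ne' |> pow_ne_zero 5

/-- The normalized shear `∂_y u / √((∂_y u)² + u²)`, the integrand of the initial functional; its
weighted integral is the energy that would blow up if `∂_y u` stayed positive. -/
noncomputable def shearRatio (u : ℝ → ℝ → ℝ → ℝ) (t x y : ℝ) : ℝ :=
  sinArg (u t x y) (partialY u t x y)

/-- The time derivative of `shearRatio u`. -/
noncomputable def shearRatioT (T : ℝ) (u : ℝ → ℝ → ℝ → ℝ) (t x y : ℝ) : ℝ :=
  sinArgDeriv (u t x y) (partialY u t x y) (partialT T u t x y) (partialT T (partialY u) t x y)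

/-- The tangential derivative of `shearRatio u`. -/
noncomputable def shearRatioX (L : ℝ) (u : ℝ → ℝ → ℝ → ℝ) (t x y : ℝ) : ℝ :=
  sinArgDeriv (u t x y) (partialY u t x y) (partialX L u t x y) (partialX L (partialY u) t x y)

/-- The normal derivative of `shearRatio u`. -/
noncomputable def shearRatioY (u : ℝ → ℝ → ℝ → ℝ) (t x y : ℝ) : ℝ :=
  sinArgDeriv (u t x y) (partialY u t x y) (partialY u t x y) (partialY (partialY u) t x y)

/-- The second normal derivative of `shearRatio u`. -/
noncomputable def shearRatioYY (u : ℝ → ℝ → ℝ → ℝ) (t x y : ℝ) : ℝ :=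
  sinArgDeriv₂ (u t x y) (partialY u t x y) (partialY (partialY u) t x y)
    (partialY (partialY (partialY u)) t x y)

/-- The tangential flux of the normalized shear. -/
noncomputable def tangentialFlux (u : ℝ → ℝ → ℝ → ℝ) (t x y : ℝ) : ℝ :=
  u t x y * shearRatio u t x y

/-- The tangential derivative of `tangentialFlux u`. -/
noncomputable def tangentialFluxX (L : ℝ) (u : ℝ → ℝ → ℝ → ℝ) (t x y : ℝ) : ℝ :=
  partialX L u t x y * shearRatio u t x y + u t x y * shearRatioX L u t x y

/-- The flux `χ F_y - χ' F - χ v F` in the normal direction, where `χ` is the cutoff and `F` the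
normalized shear. -/
noncomputable def normalFlux (N : ℝ) (u v : ℝ → ℝ → ℝ → ℝ) (t x y : ℝ) : ℝ :=
  cutoff N y * shearRatioY u t x y - cutoffDeriv N y * shearRatio u t x y -
    cutoff N y * v t x y * shearRatio u t x y

/-- The part `χ' v F` of the normal transport that falls on the cutoff. -/
noncomputable def normalDrift (N : ℝ) (u v : ℝ → ℝ → ℝ → ℝ) (t x y : ℝ) : ℝ :=
  cutoffDeriv N y * v t x y * shearRatio u t x y

/-- The normal derivative of `normalFlux`, with `∂_y v` replaced by `-∂_x u`. -/
noncomputable def normalFluxY (L N : ℝ) (u v : ℝ → ℝ → ℝ → ℝ) (t x y : ℝ) : ℝ :=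
  cutoff N y * (shearRatioYY u t x y + partialX L u t x y * shearRatio u t x y -
    v t x y * shearRatioY u t x y) - 2 / N ^ 2 * shearRatio u t x y - normalDrift N u v t x y

/-- The integral of `f` across the layer `ε ≤ y ≤ N`, weighted by the cutoff. -/
noncomputable def layerIntegral (N ε : ℝ) (f : ℝ → ℝ → ℝ → ℝ) (t x : ℝ) : ℝ :=
  ∫ y in ε..N, cutoff N y * f t x y

/-- The vorticity is positive in the whole layer. -/
def PosVorticity (T L : ℝ) (u : ℝ → ℝ → ℝ → ℝ) : Prop :=
  ∀ t ∈ Ico 0 T, ∀ x ∈ Icc 0 L, ∀ y ≥ 0, 0 < partialY u t x y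

namespace IsClassicalSolution

variable {T L : ℝ} {Ue P u₀ u₁ : ℝ → ℝ → ℝ} {u v : ℝ → ℝ → ℝ → ℝ} {t x y : ℝ}

theorem continuousOn_shearRatio (h : IsClassicalSolution T L Ue P u₀ u₁ u v)
    (hw : PosVorticity T L u) :
    ContinuousOn (fun q : ℝ × ℝ × ℝ => shearRatio u q.1 q.2.1 q.2.2) (domain T L) :=
  continuousOn_sinArg h.regular_u.cont h.regular_u.cont_y
    fun q hq => hw q.1 hq.1 q.2.1 hq.2.1 q.2.2 hq.2.2

theorem continuousOn_shearRatioY (h : IsClassicalSolution T L Ue P u₀ u₁ u v)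
    (hw : PosVorticity T L u) :
    ContinuousOn (fun q : ℝ × ℝ × ℝ => shearRatioY u q.1 q.2.1 q.2.2) (domain T L) :=
  continuousOn_sinArgDeriv h.regular_u.cont h.regular_u.cont_y h.regular_u.cont_y
    h.regular_u.cont_yy fun q hq => hw q.1 hq.1 q.2.1 hq.2.1 q.2.2 hq.2.2

theorem continuousOn_shearRatioT (h : IsClassicalSolution T L Ue P u₀ u₁ u v)
    (hw : PosVorticity T L u) :
    ContinuousOn (fun q : ℝ × ℝ × ℝ => shearRatioT T u q.1 q.2.1 q.2.2) (openDomain T L) :=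
  have hs := openDomain_subset (T := T) (L := L)
  continuousOn_sinArgDeriv (h.regular_u.cont.mono hs) (h.regular_u.cont_y.mono hs)
    (h.regular_u.cont_t.mono hs) h.regular_uy.cont_t
    fun q hq => hw q.1 (hs hq).1 q.2.1 (hs hq).2.1 q.2.2 (hs hq).2.2

theorem continuousOn_shearRatioX (h : IsClassicalSolution T L Ue P u₀ u₁ u v)
    (hw : PosVorticity T L u) :
    ContinuousOn (fun q : ℝ × ℝ × ℝ => shearRatioX L u q.1 q.2.1 q.2.2) (openDomain T L) :=
  have hs := openDomain_subset (T := T) (L := L)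
  continuousOn_sinArgDeriv (h.regular_u.cont.mono hs) (h.regular_u.cont_y.mono hs)
    (h.regular_u.cont_x.mono hs) h.regular_uy.cont_x
    fun q hq => hw q.1 (hs hq).1 q.2.1 (hs hq).2.1 q.2.2 (hs hq).2.2

theorem continuousOn_shearRatioYY (h : IsClassicalSolution T L Ue P u₀ u₁ u v)
    (hw : PosVorticity T L u) :
    ContinuousOn (fun q : ℝ × ℝ × ℝ => shearRatioYY u q.1 q.2.1 q.2.2) (openDomain T L) :=
  have hs := openDomain_subset (T := T) (L := L)
  continuousOn_sinArgDeriv₂ (h.regular_u.cont.mono hs) (h.regular_u.cont_y.mono hs)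
    h.regular_uy.cont_y h.regular_uy.cont_yy
    fun q hq => hw q.1 (hs hq).1 q.2.1 (hs hq).2.1 q.2.2 (hs hq).2.2

theorem hasDerivAt_shearRatio_t (h : IsClassicalSolution T L Ue P u₀ u₁ u v)
    (hw : PosVorticity T L u) (ht : t ∈ Ioo 0 T) (hx : x ∈ Ioo 0 L) (hy : 0 < y) :
    HasDerivAt (fun s => shearRatio u s x y) (shearRatioT T u t x y) t :=
  have hq : (t, x, y) ∈ openDomain T L := ⟨ht, hx, hy⟩
  have hq' := openDomain_subset hq
  hasDerivAt_sinArg (h.regular_u.hasDerivAt_t hq' ht) (h.regular_uy.hasDerivAt_t hq ht)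
    (hw t hq'.1 x hq'.2.1 y hq'.2.2)

theorem hasDerivAt_shearRatio_x (h : IsClassicalSolution T L Ue P u₀ u₁ u v)
    (hw : PosVorticity T L u) (ht : t ∈ Ioo 0 T) (hx : x ∈ Ioo 0 L) (hy : 0 < y) :
    HasDerivAt (fun s => shearRatio u t s y) (shearRatioX L u t x y) x :=
  have hq : (t, x, y) ∈ openDomain T L := ⟨ht, hx, hy⟩
  have hq' := openDomain_subset hq
  hasDerivAt_sinArg (a := fun s => u t s y) (b := fun s => partialY u t s y)
    (h.regular_u.hasDerivAt_x hq' hx) (h.regular_uy.hasDerivAt_x hq hx)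
    (hw t hq'.1 x hq'.2.1 y hq'.2.2)

theorem hasDerivAt_shearRatio_y (h : IsClassicalSolution T L Ue P u₀ u₁ u v)
    (hw : PosVorticity T L u) (ht : t ∈ Ioo 0 T) (hx : x ∈ Ioo 0 L) (hy : 0 < y) :
    HasDerivAt (fun s => shearRatio u t x s) (shearRatioY u t x y) y :=
  have hq' := openDomain_subset (show (t, x, y) ∈ openDomain T L from ⟨ht, hx, hy⟩)
  hasDerivAt_sinArg (h.regular_u.hasDerivAt_y hq' hy) (h.regular_u.hasDerivAt_yy hq' hy)
    (hw t hq'.1 x hq'.2.1 y hq'.2.2)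

theorem hasDerivAt_shearRatioY (h : IsClassicalSolution T L Ue P u₀ u₁ u v)
    (hw : PosVorticity T L u) (ht : t ∈ Ioo 0 T) (hx : x ∈ Ioo 0 L) (hy : 0 < y) :
    HasDerivAt (fun s => shearRatioY u t x s) (shearRatioYY u t x y) y :=
  have hq : (t, x, y) ∈ openDomain T L := ⟨ht, hx, hy⟩
  have hq' := openDomain_subset hq
  hasDerivAt_sinArgDeriv (a := fun s => u t x s) (b := fun s => partialY u t x s)
    (c := fun s => partialY (partialY u) t x s) (h.regular_u.hasDerivAt_y hq' hy)
    (h.regular_u.hasDerivAt_yy hq' hy) (h.regular_uy.hasDerivAt_yy hq hy)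
    (hw t hq'.1 x hq'.2.1 y hy.le)

theorem shearRatioYY_le (h : IsClassicalSolution T L Ue P u₀ u₁ u v) (hw : PosVorticity T L u)
    (ht : t ∈ Ioo 0 T) (hx : x ∈ Ioo 0 L) (hy : 0 < y) :
    shearRatioYY u t x y + pressureGradient L P t x *
        (u t x y * partialY u t x y / √(partialY u t x y ^ 2 + u t x y ^ 2) ^ 3) -
        shearRatio u t x y / 3 ≤
      shearRatioT T u t x y + u t x y * shearRatioX L u t x y + v t x y * shearRatioY u t x y := by
  have hq : (t, x, y) ∈ openDomain T L := ⟨ht, hx, hy⟩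
  have hq' := openDomain_subset hq
  have hpos := hw t hq'.1 x hq'.2.1 y hq'.2.2
  refine (sinArgDeriv₂_le hpos).trans_eq ?_
  have h1 := h.momentum t hq'.1 x hq'.2.1 y hq'.2.2
  have h2 := h.vorticity_equation ht hx hy
  rw [← h1, ← h2]
  simp only [shearRatioT, shearRatioX, shearRatioY, sinArgDeriv]
  ring

theorem continuousOn_tangentialFluxX (h : IsClassicalSolution T L Ue P u₀ u₁ u v)
    (hw : PosVorticity T L u) :
    ContinuousOn (fun q : ℝ × ℝ × ℝ => tangentialFluxX L u q.1 q.2.1 q.2.2) (openDomain T L) :=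
  have hs := openDomain_subset (T := T) (L := L)
  ((h.regular_u.cont_x.mono hs).mul ((h.continuousOn_shearRatio hw).mono hs)).add
    ((h.regular_u.cont.mono hs).mul (h.continuousOn_shearRatioX hw))

theorem continuousOn_normalDrift (h : IsClassicalSolution T L Ue P u₀ u₁ u v)
    (hw : PosVorticity T L u) (N : ℝ) :
    ContinuousOn (fun q : ℝ × ℝ × ℝ => normalDrift N u v q.1 q.2.1 q.2.2) (domain T L) :=
  ((by fun_prop : Continuous fun q : ℝ × ℝ × ℝ => cutoffDeriv N q.2.2).continuousOn.mul
    h.cont_v).mul (h.continuousOn_shearRatio hw)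

theorem continuousOn_normalFluxY (h : IsClassicalSolution T L Ue P u₀ u₁ u v)
    (hw : PosVorticity T L u) (N : ℝ) :
    ContinuousOn (fun q : ℝ × ℝ × ℝ => normalFluxY L N u v q.1 q.2.1 q.2.2) (openDomain T L) := by
  have hs := openDomain_subset (T := T) (L := L)
  have hF := (h.continuousOn_shearRatio hw).mono hs
  have hχ : ContinuousOn (fun q : ℝ × ℝ × ℝ => cutoff N q.2.2) (openDomain T L) := by fun_prop
  exact ((hχ.mul (((h.continuousOn_shearRatioYY hw).add
    ((h.regular_u.cont_x.mono hs).mul hF)).sub ((h.cont_v.mono hs).mul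
      ((h.continuousOn_shearRatioY hw).mono hs)))).sub (continuousOn_const.mul hF)).sub
    ((h.continuousOn_normalDrift hw N).mono hs)

theorem hasDerivAt_normalFlux (h : IsClassicalSolution T L Ue P u₀ u₁ u v)
    (hw : PosVorticity T L u) (ht : t ∈ Ioo 0 T) (hx : x ∈ Ioo 0 L) (hy : 0 < y) (N : ℝ) :
    HasDerivAt (fun s => normalFlux N u v t x s) (normalFluxY L N u v t x y) y := by
  have hq := openDomain_subset (show (t, x, y) ∈ openDomain T L from ⟨ht, hx, hy⟩)
  have hv : HasDerivAt (fun s => v t x s) (partialY v t x y) y :=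
    (h.diff_v _ hq).hasDerivWithinAt.hasDerivAt (Ici_mem_nhds hy)
  have hvy : partialY v t x y = -partialX L u t x y :=
    eq_neg_of_add_eq_zero_right (h.incompressible t hq.1 x hq.2.1 y hq.2.2)
  have hF := h.hasDerivAt_shearRatio_y hw ht hx hy
  have hχ := hasDerivAt_cutoff N y
  refine (((hχ.fun_mul (h.hasDerivAt_shearRatioY hw ht hx hy)).fun_sub
    ((hasDerivAt_cutoffDeriv N y).fun_mul hF)).fun_sub
    ((hχ.fun_mul hv).fun_mul hF)).congr_deriv ?_
  rw [normalFluxY, normalDrift, hvy]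
  ring

theorem normalFluxY_add_normalDrift_le (h : IsClassicalSolution T L Ue P u₀ u₁ u v)
    (hw : PosVorticity T L u) (ht : t ∈ Ioo 0 T) (hx : x ∈ Ioo 0 L) {N p lam : ℝ}
    (hy : y ∈ Ioc 0 N) (hp : 0 ≤ p) (hpP : p ≤ pressureGradient L P t x) (hl : 0 ≤ lam) :
    normalFluxY L N u v t x y + normalDrift N u v t x y +
        (3 * p * lam ^ 2 - 1 / 3) * (cutoff N y * shearRatio u t x y) -
        2 * p * lam ^ 3 * (partialY u t x y / √(u t x y)) ≤
      cutoff N y * (shearRatioT T u t x y + tangentialFluxX L u t x y) := by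
  have ht' : t ∈ Ico 0 T := ⟨ht.1.le, ht.2⟩
  have hx' : x ∈ Icc 0 L := ⟨hx.1.le, hx.2.le⟩
  have hwy := hw t ht' x hx' y hy.1.le
  have hu := h.u_pos ht' hx' hy.1 fun z hz => hw t ht' x hx' z hz.le
  have hF : 0 ≤ 2 / N ^ 2 * shearRatio u t x y :=
    mul_nonneg (by positivity) (sinArg_nonneg _ hwy.le)
  have hsuper := h.shearRatioYY_le hw ht hx hy.1
  have hyoung : 3 * lam ^ 2 * shearRatio u t x y - 2 * lam ^ 3 * (partialY u t x y / √(u t x y)) ≤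
      u t x y * partialY u t x y / √(partialY u t x y ^ 2 + u t x y ^ 2) ^ 3 :=
    three_mul_sq_mul_sinArg_sub_le hu hwy hl
  have hpress := (mul_le_mul_of_nonneg_left hyoung hp).trans
    (mul_le_mul_of_nonneg_right hpP (by positivity))
  have hcut := mul_le_mul_of_nonneg_left
    (hsuper.trans' (sub_le_sub_right (add_le_add_right hpress _) _)) (cutoff_nonneg N y)
  have hloss : cutoff N y * (2 * p * lam ^ 3 * (partialY u t x y / √(u t x y))) ≤
      2 * p * lam ^ 3 * (partialY u t x y / √(u t x y)) :=
    mul_le_of_le_one_left (by positivity) (cutoff_le_one ⟨hy.1.le, hy.2⟩)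
  rw [normalFluxY, tangentialFluxX]
  linarith

theorem intervalIntegrable_uy_div_sqrt_u (h : IsClassicalSolution T L Ue P u₀ u₁ u v)
    (hw : ∀ y > 0, 0 < partialY u t x y) (ht : t ∈ Ico 0 T) (hx : x ∈ Icc 0 L) {ε N : ℝ}
    (hε : 0 < ε) (hεN : ε ≤ N) :
    IntervalIntegrable (fun y => partialY u t x y / √(u t x y)) volume ε N := by
  have hsub : Icc ε N ⊆ Ici 0 := fun y hy => hε.le.trans hy.1
  refine ContinuousOn.intervalIntegrable_of_Icc hεN ?_
  exact ((h.continuousOn_uy ht hx).mono hsub).div ((h.continuousOn_u ht hx).mono hsub).sqrt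
    fun y hy => (Real.sqrt_pos.2 (h.u_pos ht hx (hε.trans_le hy.1) hw)).ne'

theorem integral_uy_div_sqrt_u_le (h : IsClassicalSolution T L Ue P u₀ u₁ u v)
    (hw : ∀ y > 0, 0 < partialY u t x y) (ht : t ∈ Ico 0 T) (hx : x ∈ Icc 0 L) {ε N U : ℝ}
    (hε : 0 < ε) (hεN : ε ≤ N) (hU : Ue t x ≤ U) :
    ∫ y in ε..N, partialY u t x y / √(u t x y) ≤ 2 * √U := by
  rw [intervalIntegral.integral_eq_sub_of_hasDerivAt (f := fun y => 2 * √(u t x y)) ?_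
    (h.intervalIntegrable_uy_div_sqrt_u hw ht hx hε hεN)]
  · have hUN : √(u t x N) ≤ √U :=
      Real.sqrt_le_sqrt ((h.u_le ht hx (hε.le.trans hεN) hw).trans hU)
    linarith [Real.sqrt_nonneg (u t x ε)]
  · intro y hy
    have hy0 : 0 < y := hε.trans_le (uIcc_of_le hεN ▸ hy).1
    refine (((h.hasDerivAt_u ht hx hy0).sqrt (h.u_pos ht hx hy0 hw).ne').const_mul 2).congr_deriv ?_
    ring

end IsClassicalSolution

theorem intervalIntegrable_of_continuousOn_openDomain {T L t x ε N : ℝ} {f : ℝ → ℝ → ℝ → ℝ}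
    (hf : ContinuousOn (fun q : ℝ × ℝ × ℝ => f q.1 q.2.1 q.2.2) (openDomain T L))
    (ht : t ∈ Ioo 0 T) (hx : x ∈ Ioo 0 L) (hε : 0 < ε) (hεN : ε ≤ N) :
    IntervalIntegrable (f t x) volume ε N :=
  ContinuousOn.intervalIntegrable_of_Icc hεN <|
    hf.comp (f := fun y => (t, x, y)) (by fun_prop) fun _ hy => ⟨ht, hx, hε.trans_le hy.1⟩

theorem intervalIntegrable_cutoff_mul {T L t x ε N : ℝ} {f : ℝ → ℝ → ℝ → ℝ}
    (hf : ContinuousOn (fun q : ℝ × ℝ × ℝ => f q.1 q.2.1 q.2.2) (openDomain T L))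
    (ht : t ∈ Ioo 0 T) (hx : x ∈ Ioo 0 L) (hε : 0 < ε) (hεN : ε ≤ N) :
    IntervalIntegrable (fun y => cutoff N y * f t x y) volume ε N :=
  (intervalIntegrable_of_continuousOn_openDomain hf ht hx hε hεN).continuousOn_mul
    (continuous_cutoff N).continuousOn

namespace IsClassicalSolution

variable {T L : ℝ} {Ue P u₀ u₁ : ℝ → ℝ → ℝ} {u v : ℝ → ℝ → ℝ → ℝ} {t x y : ℝ}

theorem integral_normalFluxY (h : IsClassicalSolution T L Ue P u₀ u₁ u v)
    (hw : PosVorticity T L u) (ht : t ∈ Ioo 0 T) (hx : x ∈ Ioo 0 L) {ε N : ℝ} (hε : 0 < ε)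
    (hεN : ε ≤ N) : ∫ y in ε..N, normalFluxY L N u v t x y = -normalFlux N u v t x ε := by
  have hN : N ≠ 0 := (hε.trans_le hεN).ne'
  have hFTC := intervalIntegral.integral_eq_sub_of_hasDerivAt
    (fun y hy => h.hasDerivAt_normalFlux hw ht hx (hε.trans_le (uIcc_of_le hεN ▸ hy).1) N)
    (intervalIntegrable_of_continuousOn_openDomain (h.continuousOn_normalFluxY hw N) ht hx hε hεN)
  have hN : normalFlux N u v t x N = 0 := by
    simp [normalFlux, cutoff_self hN, cutoffDeriv_self hN]
  rw [hFTC, hN, zero_sub]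

theorem layer_inequality (h : IsClassicalSolution T L Ue P u₀ u₁ u v) (hw : PosVorticity T L u)
    (ht : t ∈ Ioo 0 T) (hx : x ∈ Ioo 0 L) {ε N p U lam : ℝ} (hε : 0 < ε) (hεN : ε ≤ N)
    (hp : 0 ≤ p) (hpP : p ≤ pressureGradient L P t x) (hU : Ue t x ≤ U) (hl : 0 ≤ lam) :
    -normalFlux N u v t x ε + (∫ y in ε..N, normalDrift N u v t x y) +
        (3 * p * lam ^ 2 - 1 / 3) * layerIntegral N ε (shearRatio u) t x -
        4 * p * lam ^ 3 * √U ≤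
      layerIntegral N ε (shearRatioT T u) t x + layerIntegral N ε (tangentialFluxX L u) t x := by
  have ht' : t ∈ Ico 0 T := ⟨ht.1.le, ht.2⟩
  have hx' : x ∈ Icc 0 L := ⟨hx.1.le, hx.2.le⟩
  have hs := openDomain_subset (T := T) (L := L)
  have iflux := intervalIntegrable_of_continuousOn_openDomain
    (h.continuousOn_normalFluxY hw N) ht hx hε hεN
  have idrift := intervalIntegrable_of_continuousOn_openDomain
    ((h.continuousOn_normalDrift hw N).mono hs) ht hx hε hεN
  have iF := (intervalIntegrable_cutoff_mul ((h.continuousOn_shearRatio hw).mono hs)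
    ht hx hε hεN).const_mul (3 * p * lam ^ 2 - 1 / 3)
  have iFT := intervalIntegrable_cutoff_mul (h.continuousOn_shearRatioT hw) ht hx hε hεN
  have iFX := intervalIntegrable_cutoff_mul (h.continuousOn_tangentialFluxX hw) ht hx hε hεN
  have hw' : ∀ y > 0, 0 < partialY u t x y := fun y hy => hw t ht' x hx' y hy.le
  have iloss := (h.intervalIntegrable_uy_div_sqrt_u hw' ht' hx' hε hεN).const_mul (2 * p * lam ^ 3)
  have hmono := intervalIntegral.integral_mono_on hεN (((iflux.add idrift).add iF).sub iloss)
    (iFT.add iFX) fun y hy => (h.normalFluxY_add_normalDrift_le hw ht hx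
      ⟨hε.trans_le hy.1, hy.2⟩ hp hpP hl).trans_eq (mul_add _ _ _)
  rw [intervalIntegral.integral_sub ((iflux.add idrift).add iF) iloss,
    intervalIntegral.integral_add (iflux.add idrift) iF, intervalIntegral.integral_add iflux idrift,
    intervalIntegral.integral_add iFT iFX, intervalIntegral.integral_const_mul,
    intervalIntegral.integral_const_mul, h.integral_normalFluxY hw ht hx hε hεN] at hmono
  have hloss := mul_le_mul_of_nonneg_left
    (h.integral_uy_div_sqrt_u_le hw' ht' hx' hε hεN hU)
    (by positivity : 0 ≤ 2 * p * lam ^ 3)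
  simp only [layerIntegral]
  linarith

end IsClassicalSolution

/-! ### Boundary fluxes -/

namespace IsClassicalSolution

variable {T L : ℝ} {Ue P u₀ u₁ : ℝ → ℝ → ℝ} {u v : ℝ → ℝ → ℝ → ℝ} {t x y : ℝ}

theorem abs_normalDrift_le (h : IsClassicalSolution T L Ue P u₀ u₁ u v) (hw : PosVorticity T L u)
    (ht : t ∈ Ico 0 T) (hx : x ∈ Icc 0 L) {N M : ℝ} (hy : y ∈ Icc 0 N)
    (hM : ∀ z ≥ 0, |partialX L u t x z| ≤ M) :
    |normalDrift N u v t x y| ≤ 2 * M / N * (y * shearRatio u t x y) := by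
  have hF : 0 ≤ shearRatio u t x y := sinArg_nonneg _ (hw t ht x hx y hy.1).le
  have hN : 0 ≤ N := hy.1.trans hy.2
  rw [normalDrift, abs_mul, abs_mul, abs_of_nonneg hF]
  calc |cutoffDeriv N y| * |v t x y| * shearRatio u t x y
      ≤ 2 / N * (M * y) * shearRatio u t x y := by
        gcongr
        · exact abs_cutoffDeriv_le hy
        · exact h.abs_v_le ht hx hy.1 hM
    _ = 2 * M / N * (y * shearRatio u t x y) := by ring

theorem intervalIntegrable_normalDrift (h : IsClassicalSolution T L Ue P u₀ u₁ u v)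
    (hw : PosVorticity T L u) (ht : t ∈ Ico 0 T) (hx : x ∈ Icc 0 L) (N : ℝ) {a b : ℝ}
    (ha : 0 ≤ a) (hab : a ≤ b) : IntervalIntegrable (normalDrift N u v t x) volume a b :=
  ContinuousOn.intervalIntegrable_of_Icc hab <|
    (h.continuousOn_normalDrift hw N).comp (f := fun y => (t, x, y)) (by fun_prop)
      fun _ hy => ⟨ht, hx, ha.trans hy.1⟩

theorem neg_le_integral_normalDrift_near (h : IsClassicalSolution T L Ue P u₀ u₁ u v)
    (hw : PosVorticity T L u) (ht : t ∈ Ico 0 T) (hx : x ∈ Icc 0 L) {ε Y N M : ℝ} (hε : 0 ≤ ε)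
    (hεY : ε ≤ Y) (hYN : Y ≤ N) (hM : ∀ z ≥ 0, |partialX L u t x z| ≤ M) :
    -(2 * M * Y ^ 2 / N) ≤ ∫ y in ε..Y, normalDrift N u v t x y := by
  have hM0 : 0 ≤ M := (abs_nonneg _).trans (hM 0 le_rfl)
  have hY : 0 ≤ Y := hε.trans hεY
  have hN : 0 ≤ N := hY.trans hYN
  calc -(2 * M * Y ^ 2 / N) ≤ (Y - ε) * -(2 * M / N * Y) := by
        have : (Y - ε) * (2 * M / N * Y) ≤ Y * (2 * M / N * Y) := by
          gcongr
          exact sub_le_self Y hε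
        linarith [show Y * (2 * M / N * Y) = 2 * M * Y ^ 2 / N by ring]
    _ = ∫ _ in ε..Y, -(2 * M / N * Y) := by rw [intervalIntegral.integral_const, smul_eq_mul]
    _ ≤ ∫ y in ε..Y, normalDrift N u v t x y := by
        refine intervalIntegral.integral_mono_on hεY intervalIntegrable_const
          (h.intervalIntegrable_normalDrift hw ht hx N hε hεY) fun y hy => ?_
        have hy0 : 0 ≤ y := hε.trans hy.1
        refine (neg_le_neg ?_).trans
          (neg_le_of_abs_le (h.abs_normalDrift_le hw ht hx ⟨hy0, hy.2.trans hYN⟩ hM))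
        gcongr
        exact (mul_le_of_le_one_right hy0 (sinArg_le_one _ _)).trans hy.2

theorem neg_le_integral_normalDrift_far (h : IsClassicalSolution T L Ue P u₀ u₁ u v)
    (hw : PosVorticity T L u) (ht : t ∈ Ico 0 T) (hx : x ∈ Icc 0 L) {Y N M c : ℝ} (hY : 0 < Y)
    (hYN : Y ≤ N) (hM : ∀ z ≥ 0, |partialX L u t x z| ≤ M) (hc : 0 < c)
    (hu : ∀ y ≥ Y, c ≤ u t x y) :
    -(2 * M / c * (u t x N - u t x Y)) ≤ ∫ y in Y..N, normalDrift N u v t x y := by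
  have hM0 : 0 ≤ M := (abs_nonneg _).trans (hM 0 le_rfl)
  have hN : 0 < N := hY.trans_le hYN
  rw [← h.integral_uy ht hx hY.le hYN, ← neg_mul, ← intervalIntegral.integral_const_mul]
  refine intervalIntegral.integral_mono_on hYN
    ((ContinuousOn.intervalIntegrable_of_Icc hYN ((h.continuousOn_uy ht hx).mono
      fun y hy => hY.le.trans hy.1)).const_mul _)
    (h.intervalIntegrable_normalDrift hw ht hx N hY.le hYN) fun y hy => ?_
  have hy0 : 0 ≤ y := hY.le.trans hy.1
  have hwy := hw t ht x hx y hy0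
  have hF : shearRatio u t x y ≤ partialY u t x y / c := by
    rw [le_div_iff₀' hc]
    exact (mul_le_mul_of_nonneg_right (hu y hy.1) (sinArg_nonneg _ hwy.le)).trans
      (mul_sinArg_le _ hwy.le)
  rw [neg_mul]
  refine (neg_le_neg ?_).trans (neg_le_of_abs_le (h.abs_normalDrift_le hw ht hx ⟨hy0, hy.2⟩ hM))
  calc 2 * M / N * (y * shearRatio u t x y) ≤ 2 * M / N * (N * (partialY u t x y / c)) := by
        gcongr
        · exact sinArg_nonneg _ hwy.le
        · exact hy.2
    _ = 2 * M / c * partialY u t x y := by field_simp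

theorem exists_forall_neg_one_le_integral_normalDrift
    (h : IsClassicalSolution T L Ue P u₀ u₁ u v) (hw : PosVorticity T L u)
    (hUe : ContinuousOn (fun q : ℝ × ℝ => Ue q.1 q.2) (Icc 0 T ×ˢ Icc 0 L))
    (hUe_pos : ∀ t ∈ Icc 0 T, ∀ x ∈ Icc 0 L, 0 < Ue t x) {τ : ℝ} (hτ : τ < T) :
    ∃ N₀ ≥ 1, ∀ N ≥ N₀, ∀ t ∈ Icc 0 τ, ∀ x ∈ Icc 0 L, ∀ ε ∈ Ioc (0 : ℝ) 1,
      -1 ≤ ∫ y in ε..N, normalDrift N u v t x y := by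
  obtain ⟨m, hm, hmUe⟩ := (isCompact_Icc.prod isCompact_Icc).exists_forall_le'
    (f := fun q : ℝ × ℝ => Ue q.1 q.2) (a := 0) hUe fun q hq => hUe_pos q.1 hq.1 q.2 hq.2
  obtain ⟨M₀, hM₀⟩ := h.bounded τ hτ
  set M := |M₀|
  set η := min (m / 2) (m / (8 * M + 8))
  have hη0 : 0 < η := by positivity
  obtain ⟨Y₀, hY₀⟩ := eventually_atTop.1
    (Metric.tendstoUniformlyOn_iff.1 (h.far_field τ hτ) η hη0)
  set Y := max Y₀ 1
  have hY : 1 ≤ Y := le_max_right _ _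
  refine ⟨max Y (4 * M * Y ^ 2 + 1), hY.trans (le_max_left _ _), fun N hN t ht x hx ε hε => ?_⟩
  have hYN : Y ≤ N := (le_max_left _ _).trans hN
  have ht' : t ∈ Ico 0 T := ⟨ht.1, ht.2.trans_lt hτ⟩
  have hM : ∀ z ≥ 0, |partialX L u t x z| ≤ M := fun z hz =>
    (hM₀ t ht x hx z hz).1.trans (le_abs_self _)
  have hfar : ∀ y ≥ Y, Ue t x - η < u t x y := fun y hy =>
    sub_lt_of_abs_sub_lt_right (hY₀ y ((le_max_left _ _).trans hy) (t, x) ⟨ht, hx⟩)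
  have hm2 : ∀ y ≥ Y, m / 2 ≤ u t x y := fun y hy => by
    linarith [hfar y hy, hmUe (t, x) ⟨⟨ht.1, ht'.2.le⟩, hx⟩, min_le_left (m / 2) (m / (8 * M + 8))]
  have hεY : ε ≤ Y := hε.2.trans hY
  have near := h.neg_le_integral_normalDrift_near hw ht' hx hε.1.le hεY hYN hM
  have far := h.neg_le_integral_normalDrift_far hw ht' hx (by linarith) hYN hM (half_pos hm) hm2
  have near_small : 2 * M * Y ^ 2 / N ≤ 1 / 2 := by
    rw [div_le_iff₀ (by linarith)]
    linarith [(le_max_right _ _).trans hN]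
  have far_small : 2 * M / (m / 2) * (u t x N - u t x Y) ≤ 1 / 2 := by
    have hosc : u t x N - u t x Y ≤ m / (8 * M + 8) := by
      linarith [hfar Y le_rfl, h.u_le ht' hx (by linarith : 0 ≤ N)
        fun z hz => hw t ht' x hx z hz.le, min_le_right (m / 2) (m / (8 * M + 8))]
    calc 2 * M / (m / 2) * (u t x N - u t x Y) ≤ 2 * M / (m / 2) * (m / (8 * M + 8)) := by gcongr
      _ = M / (2 * (M + 1)) := by field_simp; ring
      _ ≤ 1 / 2 := by rw [div_le_iff₀ (by positivity)]; linarith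
  rw [← intervalIntegral.integral_add_adjacent_intervals
    (h.intervalIntegrable_normalDrift hw ht' hx N hε.1.le hεY)
    (h.intervalIntegrable_normalDrift hw ht' hx N (by linarith) hYN)]
  linarith

theorem exists_forall_abs_shearRatioY_le_one_and_abs_v_le_one
    (h : IsClassicalSolution T L Ue P u₀ u₁ u v) (hw : PosVorticity T L u) {τ : ℝ} (hτ : τ < T) :
    ∃ ε₀ > 0, ∀ ε ∈ Ioo 0 ε₀, ∀ t ∈ Icc 0 τ, ∀ x ∈ Icc 0 L,
      |shearRatioY u t x ε| ≤ 1 ∧ |v t x ε| ≤ 1 := by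
  have hev : ∀ᶠ ε in 𝓝 (0 : ℝ), ∀ q ∈ Icc 0 τ ×ˢ Icc 0 L,
      q ∈ Icc 0 τ ×ˢ Icc 0 L → 0 ≤ ε → |shearRatioY u q.1 q.2 ε| ≤ 1 ∧ |v q.1 q.2 ε| ≤ 1 := by
    refine (isCompact_Icc.prod isCompact_Icc).eventually_forall_of_forall_eventually
      (P := fun ε (q : ℝ × ℝ) => q ∈ Icc 0 τ ×ˢ Icc 0 L → 0 ≤ ε →
        |shearRatioY u q.1 q.2 ε| ≤ 1 ∧ |v q.1 q.2 ε| ≤ 1) fun q hq => ?_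
    have hqT : q.1 ∈ Ico 0 T := ⟨hq.1.1, hq.1.2.trans_lt hτ⟩
    have hmem : (q.1, q.2, (0 : ℝ)) ∈ domain T L := ⟨hqT, hq.2, self_mem_Ici⟩
    have hFY : |shearRatioY u q.1 q.2 0| < 1 := by
      simp [shearRatioY, sinArgDeriv, h.wall_u q.1 hqT q.2 hq.2]
    have hv : |v q.1 q.2 0| < 1 := by simp [h.wall_v q.1 hqT q.2 hq.2]
    have hnear := eventually_nhdsWithin_iff.1
      (((h.continuousOn_shearRatioY hw _ hmem).abs.eventually (gt_mem_nhds hFY)).and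
        ((h.cont_v _ hmem).abs.eventually (gt_mem_nhds hv)))
    have hmap : Tendsto (fun p : ℝ × ℝ × ℝ => (p.2.1, p.2.2, p.1)) (𝓝 (0, q))
        (𝓝 (q.1, q.2, 0)) :=
      (by fun_prop : Continuous fun p : ℝ × ℝ × ℝ => (p.2.1, p.2.2, p.1)).tendsto (0, q)
    filter_upwards [hmap.eventually hnear] with p hp hpq hp0
    have hlt := hp ⟨⟨hpq.1.1, hpq.1.2.trans_lt hτ⟩, hpq.2, hp0⟩
    exact ⟨hlt.1.le, hlt.2.le⟩
  obtain ⟨ε₀, hε₀, hb⟩ := (nhdsGE_basis (0 : ℝ)).mem_iff.1 (mem_nhdsWithin_of_mem_nhds hev)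
  exact ⟨ε₀, hε₀, fun ε hε t ht x hx =>
    hb ⟨hε.1.le, hε.2⟩ (t, x) ⟨ht, hx⟩ ⟨ht, hx⟩ hε.1.le⟩

end IsClassicalSolution

theorem normalFlux_le_four {u v : ℝ → ℝ → ℝ → ℝ} {t x N ε : ℝ} (hN : 1 ≤ N) (hε : ε ∈ Icc 0 N)
    (hw : 0 ≤ partialY u t x ε) (hFY : |shearRatioY u t x ε| ≤ 1) (hv : |v t x ε| ≤ 1) :
    normalFlux N u v t x ε ≤ 4 := by
  have hχ0 := cutoff_nonneg N ε
  have hχ1 : cutoff N ε ≤ 1 := cutoff_le_one hε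
  have hF0 : 0 ≤ shearRatio u t x ε := sinArg_nonneg _ hw
  have hF1 : shearRatio u t x ε ≤ 1 := sinArg_le_one _ _
  have hχ' : |cutoffDeriv N ε| ≤ 2 :=
    (abs_cutoffDeriv_le hε).trans (div_le_self zero_le_two hN)
  have diffusion : cutoff N ε * shearRatioY u t x ε ≤ 1 := by
    refine (le_abs_self _).trans ?_
    rw [abs_mul, abs_of_nonneg hχ0]
    exact mul_le_one₀ hχ1 (abs_nonneg _) hFY
  have drift : -cutoffDeriv N ε * shearRatio u t x ε ≤ 2 :=
    (mul_le_mul ((neg_le_abs _).trans hχ') hF1 hF0 zero_le_two).trans_eq (mul_one 2)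
  have transport : -(cutoff N ε * v t x ε * shearRatio u t x ε) ≤ 1 := by
    refine (neg_le_abs _).trans ?_
    rw [abs_mul, abs_mul, abs_of_nonneg hχ0, abs_of_nonneg hF0]
    exact mul_le_one₀ (mul_le_one₀ hχ1 (abs_nonneg _) hv) hF0 hF1
  rw [normalFlux]
  linarith

/-! ### The energy inequality -/

theorem continuous_weight (L : ℝ) : Continuous fun x : ℝ => (L - x) ^ (3 / 2 : ℝ) :=
  (Real.continuous_rpow_const (by norm_num)).comp (by fun_prop)

theorem hasDerivAt_weight (L x : ℝ) :
    HasDerivAt (fun x : ℝ => (L - x) ^ (3 / 2 : ℝ)) (-(3 / 2 * (L - x) ^ (1 / 2 : ℝ))) x := by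
  have h1 : HasDerivAt (fun x => L - x) (-1) x := by simpa using (hasDerivAt_id x).const_sub L
  refine (h1.rpow_const (p := 3 / 2) (Or.inr (by norm_num))).congr_deriv ?_
  norm_num

theorem weight_nonneg {L x : ℝ} (hx : x ≤ L) : 0 ≤ (L - x) ^ (3 / 2 : ℝ) :=
  Real.rpow_nonneg (sub_nonneg.2 hx) _

theorem weight_le {L x : ℝ} (hx : x ∈ Icc 0 L) : (L - x) ^ (3 / 2 : ℝ) ≤ L ^ (3 / 2 : ℝ) :=
  Real.rpow_le_rpow (sub_nonneg.2 hx.2) (sub_le_self L hx.1) (by norm_num)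

/-- The integral of `f` over the box `[x₁, x₂] × [ε, N]`, with the weight `(L - x)^{3/2}` of the
initial functional and the cutoff in `y`. -/
noncomputable def boxIntegral (L x₁ x₂ N ε : ℝ) (f : ℝ → ℝ → ℝ → ℝ) (t : ℝ) : ℝ :=
  ∫ x in x₁..x₂, (L - x) ^ (3 / 2 : ℝ) * layerIntegral N ε f t x

section

variable {T L x₁ x₂ N ε t x : ℝ} {f f' : ℝ → ℝ → ℝ → ℝ}

theorem continuousOn_layerIntegral {S : Set (ℝ × ℝ)} {D : Set (ℝ × ℝ × ℝ)} (hS : IsLocallyClosed S)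
    (hεN : ε ≤ N) (hf : ContinuousOn (fun q : ℝ × ℝ × ℝ => f q.1 q.2.1 q.2.2) D)
    (hD : ∀ q ∈ S, ∀ y ∈ Icc ε N, (q.1, q.2, y) ∈ D) :
    ContinuousOn (fun q : ℝ × ℝ => layerIntegral N ε f q.1 q.2) S :=
  continuousOn_intervalIntegral hS hεN
    (f := fun (q : ℝ × ℝ) y => cutoff N y * f q.1 q.2 y) <|
    (by fun_prop : Continuous fun p : (ℝ × ℝ) × ℝ => cutoff N p.2).continuousOn.mul <|
      hf.comp (f := fun p : (ℝ × ℝ) × ℝ => (p.1.1, p.1.2, p.2)) (by fun_prop)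
        fun p hp => hD p.1 hp.1 p.2 hp.2

theorem continuousOn_boxIntegral
    (hf : ContinuousOn (fun q : ℝ × ℝ × ℝ => f q.1 q.2.1 q.2.2) (domain T L))
    (hx₁ : 0 ≤ x₁) (hx : x₁ ≤ x₂) (hx₂ : x₂ ≤ L) (hε : 0 ≤ ε) (hεN : ε ≤ N) :
    ContinuousOn (boxIntegral L x₁ x₂ N ε f) (Ico 0 T) := by
  refine continuousOn_intervalIntegral isLocallyClosed_Ico hx
    (f := fun t x => (L - x) ^ (3 / 2 : ℝ) * layerIntegral N ε f t x) ?_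
  refine ((continuous_weight L).comp continuous_snd).continuousOn.mul ?_
  exact continuousOn_layerIntegral (isLocallyClosed_prod isLocallyClosed_Ico isLocallyClosed_Icc)
    hεN hf fun _ hq _ hy => ⟨hq.1, ⟨hx₁.trans hq.2.1, hq.2.2.trans hx₂⟩, hε.trans hy.1⟩

theorem hasDerivAt_layerIntegral_t
    (hf : ContinuousOn (fun q : ℝ × ℝ × ℝ => f q.1 q.2.1 q.2.2) (openDomain T L))
    (hf' : ContinuousOn (fun q : ℝ × ℝ × ℝ => f' q.1 q.2.1 q.2.2) (openDomain T L))
    (hd : ∀ t ∈ Ioo 0 T, ∀ x ∈ Ioo 0 L, ∀ y > 0, HasDerivAt (fun s => f s x y) (f' t x y) t)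
    (ht : t ∈ Ioo 0 T) (hx : x ∈ Ioo 0 L) (hε : 0 < ε) (hεN : ε ≤ N) :
    HasDerivAt (fun s => layerIntegral N ε f s x) (layerIntegral N ε f' t x) t := by
  refine hasDerivAt_intervalIntegral (f := fun s y => cutoff N y * f s x y)
    (f' := fun s y => cutoff N y * f' s x y) ht hεN (fun r hr => ?_) ?_ fun r hr y hy =>
      (hd r hr x hx y (hε.trans_le hy.1)).const_mul _
  · exact (continuous_cutoff N).continuousOn.mul <| hf.comp (f := fun y => (r, x, y))
      (by fun_prop) fun y hy => ⟨hr, hx, hε.trans_le hy.1⟩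
  · exact (by fun_prop : Continuous fun q : ℝ × ℝ => cutoff N q.2).continuousOn.mul <|
      hf'.comp (f := fun q : ℝ × ℝ => (q.1, x, q.2)) (by fun_prop)
        fun q hq => ⟨hq.1, hx, hε.trans_le hq.2.1⟩

theorem hasDerivAt_layerIntegral_x
    (hf : ContinuousOn (fun q : ℝ × ℝ × ℝ => f q.1 q.2.1 q.2.2) (openDomain T L))
    (hf' : ContinuousOn (fun q : ℝ × ℝ × ℝ => f' q.1 q.2.1 q.2.2) (openDomain T L))
    (hd : ∀ t ∈ Ioo 0 T, ∀ x ∈ Ioo 0 L, ∀ y > 0, HasDerivAt (fun s => f t s y) (f' t x y) x)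
    (ht : t ∈ Ioo 0 T) (hx : x ∈ Ioo 0 L) (hε : 0 < ε) (hεN : ε ≤ N) :
    HasDerivAt (fun s => layerIntegral N ε f t s) (layerIntegral N ε f' t x) x := by
  refine hasDerivAt_intervalIntegral (f := fun s y => cutoff N y * f t s y)
    (f' := fun s y => cutoff N y * f' t s y) hx hεN (fun r hr => ?_) ?_ fun r hr y hy =>
      (hd t ht r hr y (hε.trans_le hy.1)).const_mul _
  · exact (continuous_cutoff N).continuousOn.mul <| hf.comp (f := fun y => (t, r, y))
      (by fun_prop) fun y hy => ⟨ht, hr, hε.trans_le hy.1⟩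
  · exact (by fun_prop : Continuous fun q : ℝ × ℝ => cutoff N q.2).continuousOn.mul <|
      hf'.comp (f := fun q : ℝ × ℝ => (t, q.1, q.2)) (by fun_prop)
        fun q hq => ⟨ht, hq.1, hε.trans_le hq.2.1⟩

theorem continuousOn_weight_mul_layerIntegral
    (hf : ContinuousOn (fun q : ℝ × ℝ × ℝ => f q.1 q.2.1 q.2.2) (openDomain T L))
    (hx₁ : 0 < x₁) (hx₂ : x₂ < L) (hε : 0 < ε) (hεN : ε ≤ N) :
    ContinuousOn (fun q : ℝ × ℝ => (L - q.2) ^ (3 / 2 : ℝ) * layerIntegral N ε f q.1 q.2)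
      (Ioo 0 T ×ˢ Icc x₁ x₂) :=
  ((continuous_weight L).comp continuous_snd).continuousOn.mul <|
    continuousOn_layerIntegral (isLocallyClosed_prod isLocallyClosed_Ioo isLocallyClosed_Icc) hεN hf
      fun _ hq _ hy => ⟨hq.1, ⟨hx₁.trans_le hq.2.1, hq.2.2.trans_lt hx₂⟩, hε.trans_le hy.1⟩

theorem intervalIntegrable_weight_mul_layerIntegral
    (hf : ContinuousOn (fun q : ℝ × ℝ × ℝ => f q.1 q.2.1 q.2.2) (openDomain T L))
    (ht : t ∈ Ioo 0 T) (hx₁ : 0 < x₁) (hx : x₁ ≤ x₂) (hx₂ : x₂ < L) (hε : 0 < ε) (hεN : ε ≤ N) :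
    IntervalIntegrable (fun x => (L - x) ^ (3 / 2 : ℝ) * layerIntegral N ε f t x) volume x₁ x₂ :=
  ContinuousOn.intervalIntegrable_of_Icc hx <|
    (continuousOn_weight_mul_layerIntegral hf hx₁ hx₂ hε hεN).comp (f := fun x => (t, x))
      (by fun_prop) fun _ hx => ⟨ht, hx⟩

theorem hasDerivAt_boxIntegral
    (hf : ContinuousOn (fun q : ℝ × ℝ × ℝ => f q.1 q.2.1 q.2.2) (openDomain T L))
    (hf' : ContinuousOn (fun q : ℝ × ℝ × ℝ => f' q.1 q.2.1 q.2.2) (openDomain T L))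
    (hd : ∀ t ∈ Ioo 0 T, ∀ x ∈ Ioo 0 L, ∀ y > 0, HasDerivAt (fun s => f s x y) (f' t x y) t)
    (ht : t ∈ Ioo 0 T) (hx₁ : 0 < x₁) (hx : x₁ ≤ x₂) (hx₂ : x₂ < L) (hε : 0 < ε) (hεN : ε ≤ N) :
    HasDerivAt (boxIntegral L x₁ x₂ N ε f) (boxIntegral L x₁ x₂ N ε f' t) t := by
  refine hasDerivAt_intervalIntegral
    (f := fun t x => (L - x) ^ (3 / 2 : ℝ) * layerIntegral N ε f t x)
    (f' := fun t x => (L - x) ^ (3 / 2 : ℝ) * layerIntegral N ε f' t x) ht hx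
    (fun r hr => ?_) (continuousOn_weight_mul_layerIntegral hf' hx₁ hx₂ hε hεN) fun r hr x hx =>
      (hasDerivAt_layerIntegral_t hf hf' hd hr ⟨hx₁.trans_le hx.1, hx.2.trans_lt hx₂⟩
        hε hεN).const_mul _
  exact (continuousOn_weight_mul_layerIntegral hf hx₁ hx₂ hε hεN).comp (f := fun x => (r, x))
    (by fun_prop) fun x hx => ⟨hr, hx⟩

theorem boxIntegral_le_of_hasDerivAt {U : ℝ}
    (hf : ContinuousOn (fun q : ℝ × ℝ × ℝ => f q.1 q.2.1 q.2.2) (openDomain T L))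
    (hf' : ContinuousOn (fun q : ℝ × ℝ × ℝ => f' q.1 q.2.1 q.2.2) (openDomain T L))
    (hd : ∀ t ∈ Ioo 0 T, ∀ x ∈ Ioo 0 L, ∀ y > 0, HasDerivAt (fun s => f t s y) (f' t x y) x)
    (ht : t ∈ Ioo 0 T) (hx₁ : 0 < x₁) (hx : x₁ ≤ x₂) (hx₂ : x₂ < L) (hε : 0 < ε) (hεN : ε ≤ N)
    (hbound : ∀ x ∈ Ioo 0 L, layerIntegral N ε f t x ∈ Icc 0 U) :
    boxIntegral L x₁ x₂ N ε f' t ≤ L ^ (3 / 2 : ℝ) * U := by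
  have hxs : ∀ x ∈ Icc x₁ x₂, x ∈ Ioo 0 L := fun x hx =>
    ⟨hx₁.trans_le hx.1, hx.2.trans_lt hx₂⟩
  have hx₁' := hxs x₁ (left_mem_Icc.2 hx)
  have hweight' : Continuous fun x : ℝ => -(3 / 2 * (L - x) ^ (1 / 2 : ℝ)) :=
    (((Real.continuous_rpow_const (by norm_num)).comp
      (continuous_const.sub continuous_id)).const_mul (3 / 2)).neg
  have hflux : ContinuousOn (layerIntegral N ε f' t) (Icc x₁ x₂) :=
    (continuousOn_layerIntegral (S := Ioo 0 T ×ˢ Icc x₁ x₂)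
      (isLocallyClosed_prod isLocallyClosed_Ioo isLocallyClosed_Icc) hεN hf'
      fun q hq y hy => ⟨hq.1, hxs q.2 hq.2, hε.trans_le hy.1⟩).comp (f := fun x => (t, x))
      (by fun_prop) fun x hx => ⟨ht, hx⟩
  calc boxIntegral L x₁ x₂ N ε f' t ≤ (L - x₁) ^ (3 / 2 : ℝ) * U :=
        integral_mul_deriv_le hx (fun x _ => hasDerivAt_weight L x)
          (fun x hx => hasDerivAt_layerIntegral_x hf hf' hd ht (hxs x hx) hε hεN)
          (hweight'.intervalIntegrable _ _) (hflux.intervalIntegrable_of_Icc hx)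
          (fun x hx => weight_nonneg (hxs x hx).2.le)
          (fun x hx => neg_nonpos.2 <| mul_nonneg (by norm_num) <|
            Real.rpow_nonneg (sub_nonneg.2 (hxs x hx).2.le) _)
          (hbound x₁ hx₁').1 fun x hx => (hbound x (hxs x hx)).2
    _ ≤ L ^ (3 / 2 : ℝ) * U :=
        mul_le_mul_of_nonneg_right (weight_le (Ioo_subset_Icc_self hx₁'))
          ((hbound x₁ hx₁').1.trans (hbound x₁ hx₁').2)

end

namespace IsClassicalSolution

variable {T L : ℝ} {Ue P u₀ u₁ : ℝ → ℝ → ℝ} {u v : ℝ → ℝ → ℝ → ℝ} {t x : ℝ}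

theorem continuousOn_tangentialFlux (h : IsClassicalSolution T L Ue P u₀ u₁ u v)
    (hw : PosVorticity T L u) :
    ContinuousOn (fun q : ℝ × ℝ × ℝ => tangentialFlux u q.1 q.2.1 q.2.2) (domain T L) :=
  h.regular_u.cont.mul (h.continuousOn_shearRatio hw)

theorem hasDerivAt_tangentialFlux_x (h : IsClassicalSolution T L Ue P u₀ u₁ u v)
    (hw : PosVorticity T L u) {y : ℝ} (ht : t ∈ Ioo 0 T) (hx : x ∈ Ioo 0 L) (hy : 0 < y) :
    HasDerivAt (fun s => tangentialFlux u t s y) (tangentialFluxX L u t x y) x :=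
  (h.regular_u.hasDerivAt_x (openDomain_subset ⟨ht, hx, hy⟩) hx).mul
    (h.hasDerivAt_shearRatio_x hw ht hx hy)

theorem layerIntegral_tangentialFlux_mem_Icc (h : IsClassicalSolution T L Ue P u₀ u₁ u v)
    (hw : PosVorticity T L u) (ht : t ∈ Ioo 0 T) (hx : x ∈ Ioo 0 L) {N ε U : ℝ} (hε : 0 < ε)
    (hεN : ε ≤ N) (hU : Ue t x ≤ U) : layerIntegral N ε (tangentialFlux u) t x ∈ Icc 0 U := by
  have ht' : t ∈ Ico 0 T := Ioo_subset_Ico_self ht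
  have hx' : x ∈ Icc 0 L := Ioo_subset_Icc_self hx
  have hwx : ∀ y ≥ 0, 0 < partialY u t x y := hw t ht' x hx'
  have hwx' : ∀ y > 0, 0 < partialY u t x y := fun y hy => hwx y (le_of_lt hy)
  have hpos : ∀ y ∈ Icc ε N, 0 < y := fun y hy => hε.trans_le hy.1
  have hflux : ∀ y ∈ Icc ε N, 0 ≤ tangentialFlux u t x y := fun y hy =>
    mul_nonneg (h.u_pos ht' hx' (hpos y hy) hwx').le
      (sinArg_nonneg _ (hwx y (hpos y hy).le).le)
  refine ⟨intervalIntegral.integral_nonneg hεN fun y hy =>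
    mul_nonneg (cutoff_nonneg N y) (hflux y hy), ?_⟩
  calc layerIntegral N ε (tangentialFlux u) t x ≤ ∫ y in ε..N, partialY u t x y := by
        refine intervalIntegral.integral_mono_on hεN
          (intervalIntegrable_cutoff_mul
            ((h.continuousOn_tangentialFlux hw).mono openDomain_subset) ht hx hε hεN)
          (intervalIntegrable_of_continuousOn_openDomain
            (h.regular_u.cont_y.mono openDomain_subset) ht hx hε hεN) fun y hy => ?_
        exact (mul_le_of_le_one_left (hflux y hy) (cutoff_le_one ⟨(hpos y hy).le, hy.2⟩)).trans
          (mul_sinArg_le _ (hwx y (hpos y hy).le).le)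
    _ = u t x N - u t x ε := h.integral_uy ht' hx' hε.le hεN
    _ ≤ u t x N := sub_le_self _ (h.u_pos ht' hx' hε hwx').le
    _ ≤ U := (h.u_le ht' hx' (hε.le.trans hεN) hwx').trans hU

theorem boxIntegral_tangentialFluxX_le (h : IsClassicalSolution T L Ue P u₀ u₁ u v)
    (hw : PosVorticity T L u) {x₁ x₂ N ε U : ℝ} (ht : t ∈ Ioo 0 T) (hx₁ : 0 < x₁) (hx : x₁ ≤ x₂)
    (hx₂ : x₂ < L) (hε : 0 < ε) (hεN : ε ≤ N) (hU : ∀ x ∈ Icc 0 L, Ue t x ≤ U) :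
    boxIntegral L x₁ x₂ N ε (tangentialFluxX L u) t ≤ L ^ (3 / 2 : ℝ) * U :=
  boxIntegral_le_of_hasDerivAt ((h.continuousOn_tangentialFlux hw).mono openDomain_subset)
    (h.continuousOn_tangentialFluxX hw)
    (fun _ ht _ hx _ hy => h.hasDerivAt_tangentialFlux_x hw ht hx hy) ht hx₁ hx hx₂ hε hεN
    fun x hx => h.layerIntegral_tangentialFlux_mem_Icc hw ht hx hε hεN
      (hU x (Ioo_subset_Icc_self hx))

theorem weighted_layer_inequality (h : IsClassicalSolution T L Ue P u₀ u₁ u v)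
    (hw : PosVorticity T L u) {N ε p U lam : ℝ} (ht : t ∈ Ioo 0 T) (hx : x ∈ Ioo 0 L) (hε : 0 < ε)
    (hεN : ε ≤ N) (hp : 0 ≤ p) (hpP : p ≤ pressureGradient L P t x) (hU : Ue t x ≤ U)
    (hl : 0 ≤ lam) (hflux : -5 ≤ -normalFlux N u v t x ε + ∫ y in ε..N, normalDrift N u v t x y) :
    (3 * p * lam ^ 2 - 1 / 3) * ((L - x) ^ (3 / 2 : ℝ) * layerIntegral N ε (shearRatio u) t x) -
        (4 * p * lam ^ 3 * √U + 5) * L ^ (3 / 2 : ℝ) ≤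
      (L - x) ^ (3 / 2 : ℝ) * layerIntegral N ε (shearRatioT T u) t x +
        (L - x) ^ (3 / 2 : ℝ) * layerIntegral N ε (tangentialFluxX L u) t x := by
  have hlayer := mul_le_mul_of_nonneg_left (h.layer_inequality hw ht hx hε hεN hp hpP hU hl)
    (weight_nonneg hx.2.le)
  have hflux' := mul_le_mul_of_nonneg_left hflux (weight_nonneg hx.2.le)
  have hweight := mul_le_mul_of_nonneg_left (weight_le (Ioo_subset_Icc_self hx))
    (show 0 ≤ 4 * p * lam ^ 3 * √U + 5 by positivity)
  linarith

theorem energy_inequality (h : IsClassicalSolution T L Ue P u₀ u₁ u v) (hw : PosVorticity T L u)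
    {x₁ x₂ N ε p U lam : ℝ} (ht : t ∈ Ioo 0 T) (hx₁ : 0 < x₁) (hx : x₁ ≤ x₂) (hx₂ : x₂ < L)
    (hε : 0 < ε) (hεN : ε ≤ N) (hp : 0 ≤ p) (hpP : ∀ x ∈ Icc 0 L, p ≤ pressureGradient L P t x)
    (hU : ∀ x ∈ Icc 0 L, Ue t x ≤ U) (hl : 0 ≤ lam)
    (hflux : ∀ x ∈ Icc 0 L,
      -5 ≤ -normalFlux N u v t x ε + ∫ y in ε..N, normalDrift N u v t x y) :
    (3 * p * lam ^ 2 - 1 / 3) * boxIntegral L x₁ x₂ N ε (shearRatio u) t -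
        (4 * p * lam ^ 3 * √U + 5) * (L ^ (3 / 2 : ℝ) * L) - L ^ (3 / 2 : ℝ) * U ≤
      boxIntegral L x₁ x₂ N ε (shearRatioT T u) t := by
  set m := 4 * p * lam ^ 3 * √U + 5
  have hm : 0 ≤ m * L ^ (3 / 2 : ℝ) := by
    have := hx₁.trans_le (hx.trans hx₂.le)
    positivity
  have iF := (intervalIntegrable_weight_mul_layerIntegral
    ((h.continuousOn_shearRatio hw).mono openDomain_subset) ht hx₁ hx hx₂ hε hεN).const_mul
    (3 * p * lam ^ 2 - 1 / 3)
  have iFT := intervalIntegrable_weight_mul_layerIntegral (h.continuousOn_shearRatioT hw)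
    ht hx₁ hx hx₂ hε hεN
  have iFX := intervalIntegrable_weight_mul_layerIntegral (h.continuousOn_tangentialFluxX hw)
    ht hx₁ hx hx₂ hε hεN
  have hmono := intervalIntegral.integral_mono_on hx
    (iF.sub (intervalIntegrable_const (c := m * L ^ (3 / 2 : ℝ)))) (iFT.add iFX) fun s hs =>
      have hs' : s ∈ Ioo 0 L := ⟨hx₁.trans_le hs.1, hs.2.trans_lt hx₂⟩
      have hs'' : s ∈ Icc 0 L := Ioo_subset_Icc_self hs'
      h.weighted_layer_inequality hw ht hs' hε hεN hp (hpP s hs'') (hU s hs'') hl (hflux s hs'')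
  rw [intervalIntegral.integral_sub iF intervalIntegrable_const,
    intervalIntegral.integral_add iFT iFX, intervalIntegral.integral_const_mul,
    intervalIntegral.integral_const, smul_eq_mul] at hmono
  have hlength := mul_le_mul_of_nonneg_right (show x₂ - x₁ ≤ L by linarith) hm
  have htangential := h.boxIntegral_tangentialFluxX_le hw ht hx₁ hx hx₂ hε hεN hU
  simp only [boxIntegral] at htangential ⊢
  linarith

theorem cubic_le_boxIntegral_shearRatioT (h : IsClassicalSolution T L Ue P u₀ u₁ u v)
    (hw : PosVorticity T L u) {x₁ x₂ N ε p U : ℝ} (ht : t ∈ Ioo 0 T) (hx₁ : 0 < x₁) (hx : x₁ ≤ x₂)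
    (hx₂ : x₂ < L) (hε : 0 < ε) (hεN : ε ≤ N) (hp : 0 ≤ p)
    (hpP : ∀ x ∈ Icc 0 L, p ≤ pressureGradient L P t x) (hU0 : 0 < U)
    (hU : ∀ x ∈ Icc 0 L, Ue t x ≤ U)
    (hflux : ∀ x ∈ Icc 0 L,
      -5 ≤ -normalFlux N u v t x ε + ∫ y in ε..N, normalDrift N u v t x y)
    (hE : 0 ≤ boxIntegral L x₁ x₂ N ε (shearRatio u) t) :
    p / (4 * U * L ^ 5) * boxIntegral L x₁ x₂ N ε (shearRatio u) t ^ 3 -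
        boxIntegral L x₁ x₂ N ε (shearRatio u) t - L ^ (3 / 2 : ℝ) * (5 * L + U) ≤
      boxIntegral L x₁ x₂ N ε (shearRatioT T u) t := by
  have hL : 0 < L := by linarith
  set E := boxIntegral L x₁ x₂ N ε (shearRatio u) t
  set k := √U * (L ^ (3 / 2 : ℝ) * L) with hk
  have hk0 : 0 < k := by positivity
  have hk2 : k ^ 2 = U * L ^ 5 := by
    rw [hk, mul_pow, Real.sq_sqrt hU0.le, mul_pow, ← Real.rpow_natCast (L ^ (3 / 2 : ℝ)),
      ← Real.rpow_mul hL.le, show (3 / 2 : ℝ) * (2 : ℕ) = (3 : ℕ) by norm_num, Real.rpow_natCast]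
    ring
  -- `lam = E / (2 k)` maximizes the gain `3 p lam ^ 2 E - 4 p lam ^ 3 k`.
  have henergy := h.energy_inequality hw ht hx₁ hx hx₂ hε hεN hp hpP hU
    (div_nonneg hE (by positivity : 0 ≤ 2 * k)) hflux
  have hcubic : 3 * p * (E / (2 * k)) ^ 2 * E - 4 * p * (E / (2 * k)) ^ 3 * k =
      p / (4 * U * L ^ 5) * E ^ 3 := by
    rw [mul_assoc 4 U, ← hk2]
    field_simp
    ring
  rw [← hcubic, hk]
  linarith

end IsClassicalSolution

section

variable {s t : Set ℝ} {f : ℝ → ℝ → ℝ}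

theorem continuousOn_derivWithin_fst (hs : UniqueDiffOn ℝ s) (ht : UniqueDiffOn ℝ t)
    (hf : ContDiffOn ℝ 1 (fun q : ℝ × ℝ => f q.1 q.2) (s ×ˢ t)) :
    ContinuousOn (fun q : ℝ × ℝ => derivWithin (fun r => f r q.2) s q.1) (s ×ˢ t) := by
  refine ((hf.continuousOn_fderivWithin (hs.prod ht) le_rfl).clm_apply
    (continuousOn_const (c := (1, 0)))).congr fun q hq => ?_
  have hline : HasDerivWithinAt (fun r => (r, q.2)) ((1 : ℝ), (0 : ℝ)) s q.1 :=
    (hasDerivWithinAt_id q.1 s).prodMk (hasDerivWithinAt_const q.1 s q.2)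
  have hmaps : MapsTo (fun r => (r, q.2)) s (s ×ˢ t) := fun r hr => ⟨hr, hq.2⟩
  exact ((hf.differentiableOn one_ne_zero q hq).hasFDerivWithinAt.comp_hasDerivWithinAt q.1 hline
    hmaps).derivWithin (hs q.1 hq.1)

theorem continuousOn_derivWithin_snd (hs : UniqueDiffOn ℝ s) (ht : UniqueDiffOn ℝ t)
    (hf : ContDiffOn ℝ 1 (fun q : ℝ × ℝ => f q.1 q.2) (s ×ˢ t)) :
    ContinuousOn (fun q : ℝ × ℝ => derivWithin (fun r => f q.1 r) t q.2) (s ×ˢ t) := by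
  refine ((hf.continuousOn_fderivWithin (hs.prod ht) le_rfl).clm_apply
    (continuousOn_const (c := (0, 1)))).congr fun q hq => ?_
  have hline : HasDerivWithinAt (fun r => (q.1, r)) ((0 : ℝ), (1 : ℝ)) t q.2 :=
    (hasDerivWithinAt_const q.2 t q.1).prodMk (hasDerivWithinAt_id q.2 t)
  have hmaps : MapsTo (fun r => (q.1, r)) t (s ×ˢ t) := fun r hr => ⟨hq.1, hr⟩
  exact ((hf.differentiableOn one_ne_zero q hq).hasFDerivWithinAt.comp_hasDerivWithinAt q.2 hline
    hmaps).derivWithin (ht q.2 hq.2)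

end

theorem exists_pressure_lower_bound {T L : ℝ} (hT : 0 < T) (hL : 0 < L) {Ue : ℝ → ℝ → ℝ}
    (hUe : ContDiffOn ℝ 1 (fun q : ℝ × ℝ => Ue q.1 q.2) (Icc 0 T ×ˢ Icc 0 L)) :
    ∃ p > 0, ∀ P : ℝ → ℝ → ℝ, Bernoulli T L Ue P → AdversePressure T L P →
      ∀ t ∈ Icc 0 T, ∀ x ∈ Icc 0 L, p ≤ pressureGradient L P t x := by
  let G : ℝ × ℝ → ℝ := fun q => -(derivWithin (fun s => Ue s q.2) (Icc 0 T) q.1 +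
    Ue q.1 q.2 * derivWithin (fun s => Ue q.1 s) (Icc 0 L) q.2)
  have hG : ContinuousOn G (Icc 0 T ×ˢ Icc 0 L) :=
    ((continuousOn_derivWithin_fst (uniqueDiffOn_Icc hT) (uniqueDiffOn_Icc hL) hUe).add
      (hUe.continuousOn.mul
        (continuousOn_derivWithin_snd (uniqueDiffOn_Icc hT) (uniqueDiffOn_Icc hL) hUe))).neg
  have hGP : ∀ P, Bernoulli T L Ue P → ∀ t ∈ Icc 0 T, ∀ x ∈ Icc 0 L,
      G (t, x) = pressureGradient L P t x := fun P hB t ht x hx =>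
    neg_eq_iff_eq_neg.2 (hB t ht x hx)
  by_cases hpos : ∀ q ∈ Icc 0 T ×ˢ Icc 0 L, 0 < G q
  · obtain ⟨p, hp, hpG⟩ := (isCompact_Icc.prod isCompact_Icc).exists_forall_le' hG hpos
    exact ⟨p, hp, fun P hB _ t ht x hx => hGP P hB t ht x hx ▸ hpG (t, x) ⟨ht, hx⟩⟩
  · exact ⟨1, one_pos, fun P hB hA => absurd
      (fun q hq => (hGP P hB q.1 hq.1 q.2 hq.2).symm ▸ hA q.1 hq.1 q.2 hq.2) hpos⟩

/-! ### Exhaustion of the quadrant -/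

/-- Boxes that exhaust `(0, L) × (0, ∞)` as `δ → 0⁺`. -/
def exhaustingBox (L δ : ℝ) : Set (ℝ × ℝ) := Icc δ (L - δ) ×ˢ Icc δ δ⁻¹

theorem exhaustingBox_subset {L δ : ℝ} (hδ : 0 < δ) :
    exhaustingBox L δ ⊆ Ioo 0 L ×ˢ Ioi 0 := fun _ hq =>
  ⟨⟨hδ.trans_le hq.1.1, hq.1.2.trans_lt (sub_lt_self L hδ)⟩, hδ.trans_le hq.2.1⟩

theorem measurableSet_exhaustingBox (L δ : ℝ) : MeasurableSet (exhaustingBox L δ) :=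
  measurableSet_Icc.prod measurableSet_Icc

theorem eventually_mem_exhaustingBox {L : ℝ} {q : ℝ × ℝ} (hq : q ∈ Ioo 0 L ×ˢ Ioi 0) :
    ∀ᶠ δ in 𝓝[>] (0 : ℝ), q ∈ exhaustingBox L δ := by
  filter_upwards [Ioo_mem_nhdsGT hq.1.1, Ioo_mem_nhdsGT (sub_pos.2 hq.1.2), Ioo_mem_nhdsGT hq.2,
    tendsto_inv_nhdsGT_zero.eventually_ge_atTop q.2] with δ hx hxL hy hyN
  exact ⟨⟨hx.2.le, le_sub_comm.1 hxL.2.le⟩, hy.2.le, hyN⟩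

theorem tendsto_cutoff_inv (y : ℝ) : Tendsto (fun δ => cutoff δ⁻¹ y) (𝓝[>] 0) (𝓝 1) := by
  have h : Tendsto (fun δ => (1 - y * δ) ^ 2) (𝓝 0) (𝓝 ((1 - y * 0) ^ 2)) :=
    (by fun_prop : Continuous fun δ => (1 - y * δ) ^ 2).tendsto 0
  simpa [cutoff, div_inv_eq_mul] using h.mono_left nhdsWithin_le_nhds

theorem lintegral_Ioi_lintegral_Icc {L : ℝ} {g : ℝ × ℝ → ENNReal}
    (hg : AEMeasurable g (volume.restrict (Ioo 0 L ×ˢ Ioi 0))) :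
    ∫⁻ y in Ioi (0 : ℝ), ∫⁻ x in Icc 0 L, g (x, y) = ∫⁻ q in Ioo 0 L ×ˢ Ioi 0, g q := by
  rw [Measure.volume_eq_prod, ← Measure.prod_restrict] at hg ⊢
  rw [lintegral_prod_symm _ hg, Measure.restrict_congr_set Ioo_ae_eq_Icc]

section

variable {L δ t : ℝ} {f : ℝ → ℝ → ℝ → ℝ}

theorem ofReal_boxIntegral
    (hf : ContinuousOn (fun q : ℝ × ℝ => f t q.1 q.2) (Icc 0 L ×ˢ Ici 0))
    (hf0 : ∀ x ∈ Icc 0 L, ∀ y ≥ 0, 0 ≤ f t x y) (hδ : 0 < δ) (hδL : δ ≤ L - δ) (hδ1 : δ ≤ δ⁻¹) :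
    ENNReal.ofReal (boxIntegral L δ (L - δ) δ⁻¹ δ f t) = ∫⁻ q in exhaustingBox L δ,
      ENNReal.ofReal ((L - q.1) ^ (3 / 2 : ℝ) * (cutoff δ⁻¹ q.2 * f t q.1 q.2)) := by
  have hsub : exhaustingBox L δ ⊆ Icc 0 L ×ˢ Ici 0 :=
    (exhaustingBox_subset hδ).trans (prod_mono Ioo_subset_Icc_self Ioi_subset_Ici_self)
  have hint : IntegrableOn (fun q : ℝ × ℝ =>
      (L - q.1) ^ (3 / 2 : ℝ) * (cutoff δ⁻¹ q.2 * f t q.1 q.2)) (exhaustingBox L δ)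
      (volume.prod volume) :=
    (((continuous_weight L).comp continuous_fst).continuousOn.mul
      (((continuous_cutoff _).comp continuous_snd).continuousOn.mul
        (hf.mono hsub))).integrableOn_compact (isCompact_Icc.prod isCompact_Icc)
  have hnonneg : 0 ≤ᵐ[volume.restrict (exhaustingBox L δ)] fun q : ℝ × ℝ =>
      (L - q.1) ^ (3 / 2 : ℝ) * (cutoff δ⁻¹ q.2 * f t q.1 q.2) := by
    filter_upwards [ae_restrict_mem (measurableSet_exhaustingBox L δ)] with q hq
    exact mul_nonneg (weight_nonneg (hsub hq).1.2)
      (mul_nonneg (cutoff_nonneg _ _) (hf0 q.1 (hsub hq).1 q.2 (hsub hq).2))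
  rw [Measure.volume_eq_prod, ← ofReal_integral_eq_lintegral_ofReal hint hnonneg, exhaustingBox,
    setIntegral_prod _ hint]
  simp only [boxIntegral, layerIntegral, intervalIntegral.integral_of_le hδL,
    intervalIntegral.integral_of_le hδ1, integral_Icc_eq_integral_Ioc, integral_const_mul]

theorem tendsto_indicator_exhaustingBox {q : ℝ × ℝ} (hq : q ∈ Ioo 0 L ×ˢ Ioi 0) :
    Tendsto (fun δ => (exhaustingBox L δ).indicator (fun q => ENNReal.ofReal
        ((L - q.1) ^ (3 / 2 : ℝ) * (cutoff δ⁻¹ q.2 * f t q.1 q.2))) q) (𝓝[>] 0)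
      (𝓝 (ENNReal.ofReal ((L - q.1) ^ (3 / 2 : ℝ) * f t q.1 q.2))) := by
  have h := ENNReal.tendsto_ofReal
    (((tendsto_cutoff_inv q.2).mul_const (f t q.1 q.2)).const_mul ((L - q.1) ^ (3 / 2 : ℝ)))
  rw [one_mul] at h
  refine h.congr' ?_
  filter_upwards [eventually_mem_exhaustingBox hq] with δ hδ
  rw [indicator_of_mem hδ]

theorem lintegral_le_liminf_boxIntegral (hL : 0 < L)
    (hf : ContinuousOn (fun q : ℝ × ℝ => f t q.1 q.2) (Icc 0 L ×ˢ Ici 0))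
    (hf0 : ∀ x ∈ Icc 0 L, ∀ y ≥ 0, 0 ≤ f t x y) :
    ∫⁻ y in Ioi (0 : ℝ), ∫⁻ x in Icc 0 L, ENNReal.ofReal ((L - x) ^ (3 / 2 : ℝ) * f t x y) ≤
      liminf (fun δ => ENNReal.ofReal (boxIntegral L δ (L - δ) δ⁻¹ δ f t)) (𝓝[>] 0) := by
  let S : Set (ℝ × ℝ) := Ioo 0 L ×ˢ Ioi 0
  let F : ℝ → ℝ × ℝ → ENNReal := fun δ q =>
    ENNReal.ofReal ((L - q.1) ^ (3 / 2 : ℝ) * (cutoff δ⁻¹ q.2 * f t q.1 q.2))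
  have hS : MeasurableSet S := measurableSet_Ioo.prod measurableSet_Ioi
  have hfS : ContinuousOn (fun q : ℝ × ℝ => f t q.1 q.2) S :=
    hf.mono (prod_mono Ioo_subset_Icc_self Ioi_subset_Ici_self)
  have hweight : Continuous fun q : ℝ × ℝ => (L - q.1) ^ (3 / 2 : ℝ) :=
    (continuous_weight L).comp continuous_fst
  have hF : ∀ δ, AEMeasurable ((exhaustingBox L δ).indicator (F δ)) (volume.restrict S) :=
    fun δ => (((hweight.continuousOn.mul
      (((continuous_cutoff _).comp continuous_snd).continuousOn.mul hfS)).aemeasurable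
        hS).ennreal_ofReal).indicator (measurableSet_exhaustingBox L δ)
  have hbox : ∀ᶠ δ in 𝓝[>] (0 : ℝ), ∫⁻ q in S, (exhaustingBox L δ).indicator (F δ) q =
      ENNReal.ofReal (boxIntegral L δ (L - δ) δ⁻¹ δ f t) := by
    filter_upwards [Ioo_mem_nhdsGT (half_pos hL), Ioo_mem_nhdsGT (zero_lt_one' ℝ)] with δ hδL hδ1
    rw [lintegral_indicator (measurableSet_exhaustingBox L δ),
      Measure.restrict_restrict (measurableSet_exhaustingBox L δ),
      inter_eq_left.2 (exhaustingBox_subset hδL.1), ofReal_boxIntegral hf hf0 hδL.1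
        (by linarith [hδL.2]) (hδ1.2.le.trans ((one_le_inv₀ hδ1.1).2 hδ1.2.le))]
  have hmeas : AEMeasurable
      (fun q : ℝ × ℝ => ENNReal.ofReal ((L - q.1) ^ (3 / 2 : ℝ) * f t q.1 q.2))
      (volume.restrict S) :=
    ((hweight.continuousOn.mul hfS).aemeasurable hS).ennreal_ofReal
  calc _
    _ = ∫⁻ q in S, ENNReal.ofReal ((L - q.1) ^ (3 / 2 : ℝ) * f t q.1 q.2) :=
        lintegral_Ioi_lintegral_Icc hmeas
    _ = ∫⁻ q in S, liminf (fun δ => (exhaustingBox L δ).indicator (F δ) q) (𝓝[>] 0) :=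
        setLIntegral_congr_fun hS fun q hq =>
          (tendsto_indicator_exhaustingBox hq).liminf_eq.symm
    _ ≤ liminf (fun δ => ∫⁻ q in S, (exhaustingBox L δ).indicator (F δ) q) (𝓝[>] 0) :=
        lintegral_liminf_le' hF
    _ = _ := liminf_congr hbox

end

namespace IsClassicalSolution

variable {T L K : ℝ} {Ue P u₀ u₁ : ℝ → ℝ → ℝ} {u v : ℝ → ℝ → ℝ → ℝ}

theorem initialFunctional_eq (h : IsClassicalSolution T L Ue P u₀ u₁ u v) :
    initialFunctional L u₀ = ∫⁻ y in Ioi (0 : ℝ), ∫⁻ x in Icc 0 L,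
      ENNReal.ofReal ((L - x) ^ (3 / 2 : ℝ) * shearRatio u 0 x y) := by
  refine setLIntegral_congr_fun measurableSet_Ioi fun y hy => ?_
  refine setLIntegral_congr_fun measurableSet_Icc fun x hx => ?_
  have hy' : 0 ≤ y := le_of_lt hy
  simp only [shearRatio, sinArg]
  rw [h.partialY_initial hx hy', h.initial x hx y hy', mul_div_assoc]

theorem eventually_lt_boxIntegral (h : IsClassicalSolution T L Ue P u₀ u₁ u v)
    (hw : PosVorticity T L u) (hT : 0 < T) (hL : 0 < L)
    (hK : ENNReal.ofReal K < initialFunctional L u₀) :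
    ∀ᶠ δ in 𝓝[>] 0, K < boxIntegral L δ (L - δ) δ⁻¹ δ (shearRatio u) 0 := by
  have h0 : (0 : ℝ) ∈ Ico 0 T := ⟨le_rfl, hT⟩
  rw [h.initialFunctional_eq] at hK
  have hlt := hK.trans_le (lintegral_le_liminf_boxIntegral hL
    ((h.continuousOn_shearRatio hw).comp (f := fun q : ℝ × ℝ => (0, q.1, q.2)) (by fun_prop)
      fun q hq => ⟨h0, hq.1, hq.2⟩)
    fun x hx y hy => sinArg_nonneg _ (hw 0 h0 x hx y hy).le)
  filter_upwards [eventually_lt_of_lt_liminf hlt] with δ hδ using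
    lt_of_not_ge fun hle => hδ.not_ge (ENNReal.ofReal_le_ofReal hle)

theorem posVorticity_of_ne_zero (h : IsClassicalSolution T L Ue P u₀ u₁ u v)
    (hD : MonotoneData T L u₀ u₁)
    (hne : ∀ t ∈ Ioo 0 T, ∀ x ∈ Icc 0 L, ∀ y ≥ 0, partialY u t x y ≠ 0) : PosVorticity T L u :=
  fun _ ht x hx y hy => h.uy_pos_of_ne_zero hD ht hx hy fun s hs =>
    hs.1.eq_or_lt.elim (fun hs0 => hs0 ▸ (h.uy_initial_pos hD hx hy).ne')
      fun hs0 => hne s ⟨hs0, hs.2.trans_lt ht.2⟩ x hx y hy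

theorem isBackFlowPoint (h : IsClassicalSolution T L Ue P u₀ u₁ u v)
    (hD : MonotoneData T L u₀ u₁) {t₀ x₀ : ℝ} (hc : IsFirstCriticalPoint T L u t₀ x₀ 0) :
    IsBackFlowPoint u t₀ x₀ :=
  ⟨hc.zero, fun t ht x hx => h.uy_pos_before_firstCriticalPoint hD hc t
    (Ioo_subset_Ico_self ht) x ⟨hx.1.le, hx.2.le.trans hc.mem_x.2⟩ 0 le_rfl⟩

theorem eventually_neg_five_le_flux (h : IsClassicalSolution T L Ue P u₀ u₁ u v)
    (hw : PosVorticity T L u)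
    (hUe : ContinuousOn (fun q : ℝ × ℝ => Ue q.1 q.2) (Icc 0 T ×ˢ Icc 0 L))
    (hUe_pos : ∀ t ∈ Icc 0 T, ∀ x ∈ Icc 0 L, 0 < Ue t x) {τ : ℝ} (hτ : τ < T) :
    ∀ᶠ δ in 𝓝[>] 0, ∀ t ∈ Icc 0 τ, ∀ x ∈ Icc 0 L,
      -5 ≤ -normalFlux δ⁻¹ u v t x δ + ∫ y in δ..δ⁻¹, normalDrift δ⁻¹ u v t x y := by
  obtain ⟨N₀, hN₀, hdrift⟩ := h.exists_forall_neg_one_le_integral_normalDrift hw hUe hUe_pos hτ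
  obtain ⟨ε₀, hε₀, hwall⟩ := h.exists_forall_abs_shearRatioY_le_one_and_abs_v_le_one hw hτ
  filter_upwards [tendsto_inv_nhdsGT_zero.eventually_ge_atTop N₀, Ioo_mem_nhdsGT hε₀,
    Ioo_mem_nhdsGT (zero_lt_one' ℝ)] with δ hδN hδε hδ1 t ht x hx
  have hN := hN₀.trans hδN
  have hpos := hw t ⟨ht.1, ht.2.trans_lt hτ⟩ x hx δ hδ1.1.le
  obtain ⟨hFY, hv⟩ := hwall δ hδε t ht x hx
  linarith [hdrift δ⁻¹ hδN t ht x hx δ ⟨hδ1.1, hδ1.2.le⟩,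
    normalFlux_le_four hN ⟨hδ1.1.le, hδ1.2.le.trans hN⟩ hpos.le hFY hv]

end IsClassicalSolution

theorem exists_bound_initialFunctional {T L p U : ℝ} (hT : 0 < T) (hL : 0 < L) (hp : 0 < p)
    (hU0 : 0 < U) : ∃ K > 0, ∀ (Ue P u₀ u₁ : ℝ → ℝ → ℝ) (u v : ℝ → ℝ → ℝ → ℝ),
      ContinuousOn (fun q : ℝ × ℝ => Ue q.1 q.2) (Icc 0 T ×ˢ Icc 0 L) →
      (∀ t ∈ Icc 0 T, ∀ x ∈ Icc 0 L, Ue t x ∈ Ioc 0 U) →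
      (∀ t ∈ Icc 0 T, ∀ x ∈ Icc 0 L, p ≤ pressureGradient L P t x) →
      IsClassicalSolution T L Ue P u₀ u₁ u v → PosVorticity T L u →
      initialFunctional L u₀ ≤ ENNReal.ofReal K := by
  obtain ⟨K, hK0, hK⟩ := exists_blowup_threshold (c := p / (4 * U * L ^ 5))
    (C := L ^ (3 / 2 : ℝ) * (5 * L + U)) (by positivity) (by positivity) (half_pos hT)
  refine ⟨K, hK0, fun Ue P u₀ u₁ u v hUe hUe_mem hpP h hw => ?_⟩
  have hτ : T / 2 < T := half_lt_self hT
  by_contra! hini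
  obtain ⟨δ, hδK, hflux, hδL, hδ1⟩ := ((h.eventually_lt_boxIntegral hw hT hL hini).and
    ((h.eventually_neg_five_le_flux hw hUe (fun t ht x hx => (hUe_mem t ht x hx).1) hτ).and
      ((eventually_mem_set.2 (Ioo_mem_nhdsGT (half_pos hL))).and
        (Ioo_mem_nhdsGT one_pos)))).exists
  have hx : δ ≤ L - δ := by linarith [hδL.2]
  have hδN : δ ≤ δ⁻¹ := hδ1.2.le.trans ((one_le_inv₀ hδ1.1).2 hδ1.2.le)
  have hF := h.continuousOn_shearRatio hw
  refine hδK.not_ge (hK _ (boxIntegral L δ (L - δ) δ⁻¹ δ (shearRatioT T u)) ?_ ?_ ?_)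
  · exact (continuousOn_boxIntegral hF hδL.1.le hx (sub_le_self L hδL.1.le) hδL.1.le hδN).mono
      (Icc_subset_Ico_right hτ)
  · exact fun t ht => hasDerivAt_boxIntegral (hF.mono openDomain_subset)
      (h.continuousOn_shearRatioT hw)
      (fun _ ht _ hx _ hy => h.hasDerivAt_shearRatio_t hw ht hx hy)
      ⟨ht.1, ht.2.trans hτ⟩ hδL.1 hx (sub_lt_self L hδL.1) hδL.1 hδN
  · intro t ht hE
    have htT : t ∈ Ioo 0 T := ⟨ht.1, ht.2.trans hτ⟩
    have htc := Ioo_subset_Icc_self htT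
    exact h.cubic_le_boxIntegral_shearRatioT hw htT hδL.1 hx (sub_lt_self L hδL.1) hδL.1 hδN hp.le
      (hpP t htc) hU0 (fun x hx => (hUe_mem t htc x hx).2) (hflux t (Ioo_subset_Icc_self ht)) hE

theorem exists_threshold_posVorticity {T L : ℝ} (hT : 0 < T) (hL : 0 < L) {Ue : ℝ → ℝ → ℝ}
    (hUe : ContDiffOn ℝ 1 (fun q : ℝ × ℝ => Ue q.1 q.2) (Icc 0 T ×ˢ Icc 0 L))
    (hUe_pos : ∀ t ∈ Icc 0 T, ∀ x ∈ Icc 0 L, 0 < Ue t x) :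
    ∃ C > 0, ∀ (P u₀ u₁ : ℝ → ℝ → ℝ) (u v : ℝ → ℝ → ℝ → ℝ),
      Bernoulli T L Ue P → AdversePressure T L P → IsClassicalSolution T L Ue P u₀ u₁ u v →
      PosVorticity T L u → initialFunctional L u₀ < ENNReal.ofReal C := by
  obtain ⟨p, hp, hpP⟩ := exists_pressure_lower_bound hT hL hUe
  obtain ⟨U, hU⟩ :=
    (isCompact_Icc.prod isCompact_Icc).exists_bound_of_continuousOn hUe.continuousOn
  have hUe_mem : ∀ t ∈ Icc 0 T, ∀ x ∈ Icc 0 L, Ue t x ∈ Ioc 0 U := fun t ht x hx =>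
    ⟨hUe_pos t ht x hx, (le_abs_self _).trans (hU (t, x) ⟨ht, hx⟩)⟩
  have hU0 : 0 < U :=
    have h0 := hUe_mem 0 (left_mem_Icc.2 hT.le) 0 (left_mem_Icc.2 hL.le)
    h0.1.trans_le h0.2
  obtain ⟨K, hK0, hK⟩ := exists_bound_initialFunctional hT hL hp hU0
  exact ⟨K + 1, by positivity, fun P u₀ u₁ u v hB hA h hw =>
    (hK Ue P u₀ u₁ u v hUe.continuousOn hUe_mem (hpP P hB hA) h hw).trans_lt
      ((ENNReal.ofReal_lt_ofReal_iff (by positivity)).2 (lt_add_one K))⟩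

end Prandtl

theorem theorem1p1 (T L : ℝ) (hT : 0 < T) (hL : 0 < L) (Ue : ℝ → ℝ → ℝ)
    (hUe : ContDiffOn ℝ 1 (fun q : ℝ × ℝ => Ue q.1 q.2) (Icc 0 T ×ˢ Icc 0 L))
    (hUe_pos : ∀ t ∈ Icc 0 T, ∀ x ∈ Icc 0 L, 0 < Ue t x) :
    (∀ (P u₀ u₁ : ℝ → ℝ → ℝ) (u v : ℝ → ℝ → ℝ → ℝ),
      Prandtl.Bernoulli T L Ue P → Prandtl.AdversePressure T L P →
      Prandtl.MonotoneData T L u₀ u₁ →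
      Prandtl.IsClassicalSolution T L Ue P u₀ u₁ u v →
        (∀ t₀ x₀ y₀ : ℝ, Prandtl.IsFirstCriticalPoint T L u t₀ x₀ y₀ → y₀ = 0) ∧
        ((∃ t ∈ Ioo 0 T, ∃ x ∈ Icc 0 L, ∃ y ≥ 0, Prandtl.partialY u t x y = 0) →
          ∃ t₀ x₀ : ℝ, Prandtl.IsFirstCriticalPoint T L u t₀ x₀ 0)) ∧
    (∃ C : ℝ, 0 < C ∧
      ∀ (P u₀ u₁ : ℝ → ℝ → ℝ) (u v : ℝ → ℝ → ℝ → ℝ),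
      Prandtl.Bernoulli T L Ue P → Prandtl.AdversePressure T L P →
      Prandtl.MonotoneData T L u₀ u₁ →
      Prandtl.IsClassicalSolution T L Ue P u₀ u₁ u v →
      ENNReal.ofReal C ≤ Prandtl.initialFunctional L u₀ →
        ∃ t' ∈ Ioo 0 T, ∃ x' ∈ Icc 0 L,
          Prandtl.IsBackFlowPoint u t' x' ∧
          (∀ t ∈ Ico 0 t', ∀ x ∈ Icc 0 L, ∀ y ≥ 0, 0 < Prandtl.partialY u t x y) ∧
          Prandtl.partialY (Prandtl.partialY u) t' x' 0 = Prandtl.pressureGradient L P t' x' ∧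
          Prandtl.partialY (Prandtl.partialY u) t' x' 0 ≠ 0) := by
  have hUc := hUe.continuousOn
  refine ⟨fun P u₀ u₁ u v _ _ hD h =>
    ⟨fun t₀ x₀ y₀ hc => h.firstCriticalPoint_on_wall hD hc,
      h.exists_firstCriticalPoint hD hUc hUe_pos⟩, ?_⟩
  obtain ⟨C, hC, hcrit⟩ := Prandtl.exists_threshold_posVorticity hT hL hUe hUe_pos
  refine ⟨C, hC, fun P u₀ u₁ u v hB hA hD h hini => ?_⟩
  have hzero : ∃ t ∈ Ioo 0 T, ∃ x ∈ Icc 0 L, ∃ y ≥ 0, Prandtl.partialY u t x y = 0 := by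
    by_contra! hne
    exact (hcrit P u₀ u₁ u v hB hA h (h.posVorticity_of_ne_zero hD hne)).not_ge hini
  obtain ⟨t', x', hc⟩ := h.exists_firstCriticalPoint hD hUc hUe_pos hzero
  have hwall := h.wall_balance (Ioo_subset_Ico_self hc.mem_t) hc.mem_x
  have hpressure := hA t' (Ioo_subset_Icc_self hc.mem_t) x' hc.mem_x
  exact ⟨t', hc.mem_t, x', hc.mem_x, h.isBackFlowPoint hD hc,
    h.uy_pos_before_firstCriticalPoint hD hc, hwall, hwall ▸ hpressure.ne'⟩
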